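/- **Setting.** Let $(\mathcal S,\mathcal A,P,r,\gamma,\rho_0)$ be a Markov decision process with reward $|r(s,a)|\le R$ ($R>0$), discount $\gamma\in(0,1)$ and initial distribution $\rho_0$; let $\pi_\theta(a|s)>0$, $\theta\in\mathbb R^d$, be a parametrized policy (a density with respect to a $\sigma$-finite reference measure on $\mathcal A$), and let $H$ be the horizon. Write $p(\tau|\theta)$ for the law of the trajectory $\tau=(s_0,a_0,\dots,s_{H-1},a_{H-1})$ under $\pi_\theta$, $J(\theta)=\mathbb E_{\tau\sim p(\cdot|\theta)}\big[\sum_{h<H}\gamma^h r(s_h,a_h)\big]$, $J^*=\sup_\theta J(\theta)$, $$g(\tau|\theta)=\sum_{h=0}^{H-1}\sum_{j=h}^{H-1}\gamma^j r(s_j,a_j)\nabla_\theta\log\pi_\theta(a_h|s_h),\qquad \Phi(\tau|\theta)=\sum_{h=0}^{H-1}\sum_{j=h}^{H-1}\gamma^j r(s_j,a_j)\log\pi_\theta(a_h|s_h),$$ $\hat\nabla^2(\theta,\tau)=\nabla\Phi(\tau|\theta)\nabla\log p(\tau|\theta)^T+\nabla^2\Phi(\tau|\theta)$ and $w(\tau|\theta',\theta)=\prod_{h<H}\pi_{\theta'}(a_h|s_h)/\pi_\theta(a_h|s_h)$.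 **Assumptions.** $\log\pi_\theta(a|s)$ is twice differentiable in $\theta$ and there are constants $M_g,M_h,\sigma,W>0$ such that $\|\nabla_\theta\log\pi_\theta(a|s)\|\le M_g$ and $\|\nabla^2_\theta\log\pi_\theta(a|s)\|\le M_h$ for all $\theta,s,a$; $\mathbb E_{\tau\sim p(\cdot|\theta)}\|g(\tau|\theta)-\nabla J(\theta)\|^2\le\sigma^2$ for all $\theta$; and the variance of $w(\tau|\theta_1,\theta_2)$ under $\tau\sim p(\cdot|\theta_2)$ is at most $W$ for all $\theta_1,\theta_2$. **Algorithm (HA-MBPG).** Given parameters $k,m,c$ and $\theta_1$: for $t=1$ sample $\tau_1\sim p(\cdot|\theta_1)$ and put $u_1=g(\tau_1|\theta_1)$. For $t\ge2$ draw $\alpha$ uniformly from $[0,1]$, independently of the past, put $\theta_t(\alpha)=\alpha\theta_t+(1-\alpha)\theta_{t-1}$, sample one trajectory $\tau_t\sim p(\cdot|\theta_t(\alpha))$, and put $\Delta_t=\hat\nabla^2(\theta_t(\alpha),\tau_t)(\theta_t-\theta_{t-1})$ and $$u_t=\beta_t\,w(\tau_t|\theta_t,\theta_t(\alpha))\,g(\tau_t|\theta_t)+(1-\beta_t)(u_{t-1}+\Delta_t).$$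 In every iteration put $G_t=\|g(\tau_t|\theta_t)\|$, $\eta_t=k/(m+\sum_{i=1}^tG_i^2)^{1/3}$, $\theta_{t+1}=\theta_t+\eta_tu_t$, $\beta_{t+1}=c\,\eta_t^2$. The output after $T$ iterations is $\theta_\zeta$ with $\zeta$ uniform on $\{1,\dots,T\}$, independent of the run. **Theorem.** Put $G=\frac{M_gR}{(1-\gamma)^2}$ and $L=\max\Big\{\frac{M_hR}{(1-\gamma)^2},\ \frac{\sqrt{H^2M_g^4R^2+M_h^2R^2}}{(1-\gamma)^2}\Big\}$, let $k>0$, and run the algorithm with $c=\frac{G^2}{3k^3L}+52L^2$ and $m=\max\{2G^2,(2Lk)^3,(\frac{ck}{2L})^3\}$. Then $J$ is differentiable and bounded above, and for every $T\ge1$ $$\mathbb E\|\nabla J(\theta_\zeta)\|\le\frac{\sqrt{2\Lambda}\,m^{1/6}+2\Lambda^{3/4}}{\sqrt T}+\frac{2\sqrt\Lambda\,\sigma^{1/3}}{T^{1/3}},$$ where $\Lambda=\Lambda(T)=\frac1k\Big(16(J^*-J(\theta_1))+\frac{m^{1/3}}{4L^2k}\sigma^2+\frac{(W+1)c^2k^3}{2L^2}\ln(T+2)\Big)=O(\ln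 T)$. Consequently, the problem, $k$ and $\theta_1$ being fixed, there is a constant $C>0$ such that for every $\varepsilon\in(0,\frac12]$ and every $T\ge C\,\varepsilon^{-3}(\ln\frac1\varepsilon)^{3/2}$ one has $\mathbb E\|\nabla J(\theta_\zeta)\|\le\varepsilon$; as each iteration samples one trajectory, $O(\varepsilon^{-3})$ trajectories suffice up to a logarithmic factor. -/

import Mathlib

open MeasureTheory ProbabilityTheory Filter Asymptotics

noncomputable section

/-- A Markov decision process with measurable state space `S` and action space `A`: transition
probabilities `P(ds' | s, a)`, initial distribution `ρ₀`, a reward function with values in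
`[-R, R]`, and a discount factor `γ ∈ (0, 1)`. -/
structure MDP (S A : Type*) [MeasurableSpace S] [MeasurableSpace A] where
  trans : Kernel (S × A) S
  trans_markov : IsMarkovKernel trans
  init : Measure S
  init_prob : IsProbabilityMeasure init
  reward : S → A → ℝ
  reward_meas : Measurable (fun p : S × A => reward p.1 p.2)
  R : ℝ
  R_pos : 0 < R
  reward_bdd : ∀ s a, |reward s a| ≤ R
  γ : ℝ
  γ_pos : 0 < γ
  γ_lt_one : γ < 1

/-- A parametrized stochastic policy: `dens θ s a` is the density `π_θ(a | s)` with respect to a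
σ-finite reference measure `ν` on the actions (counting measure for discrete actions, Lebesgue
measure for continuous ones). Densities are positive, so that `log π_θ(a | s)` makes sense. -/
structure ParamPolicy (E S A : Type*) [MeasurableSpace S] [MeasurableSpace A] where
  ν : Measure A
  ν_sigmaFinite : SigmaFinite ν
  dens : E → S → A → ℝ
  dens_pos : ∀ θ s a, 0 < dens θ s a
  dens_meas : ∀ θ, Measurable (fun p : S × A => dens θ p.1 p.2)
  dens_norm : ∀ θ s, ∫⁻ a, ENNReal.ofReal (dens θ s a) ∂ν = 1

/-- Trajectories `τ = (s₀, a₀, …, s_{H-1}, a_{H-1})`. -/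
abbrev Traj (S A : Type*) (H : ℕ) : Type _ := Fin H → S × A

/-- One draw of the algorithm: a number `α` and a trajectory `τ`. -/
abbrev Draw (S A : Type*) (H : ℕ) : Type _ := ℝ × Traj S A H

section Model

variable {S A : Type*} [MeasurableSpace S] [MeasurableSpace A]

/-- Law of the next state given the first `n` state-action pairs. -/
def MDP.stateKernel (M : MDP S A) : (n : ℕ) → Kernel (Traj S A n) S
  | 0 => Kernel.const _ M.init
  | n + 1 => M.trans.comap (fun τ => τ (Fin.last n)) (measurable_pi_apply (Fin.last n))

/-- The measure `ρ₀(ds₀) ν(da₀) P(ds₁ | s₀, a₀) ν(da₁) ⋯` on trajectories of length `n`, with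
respect to which `∏ₕ π_θ(aₕ | sₕ)` is the density of the law of the trajectory under `π_θ`. -/
def MDP.refMeasure (M : MDP S A) (ν : Measure A) : (n : ℕ) → Measure (Traj S A n)
  | 0 => Measure.dirac (fun i => i.elim0)
  | n + 1 => (((M.refMeasure ν n) ⊗ₘ (M.stateKernel n)).prod ν).map
      (fun p => Fin.snoc (α := fun _ => S × A) p.1.1 (p.1.2, p.2))

/-- The cumulative discounted reward `∑ₕ γ^h r(sₕ, aₕ)` of a trajectory. -/
def MDP.totalReward (M : MDP S A) {H : ℕ} (τ : Traj S A H) : ℝ :=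
  ∑ h : Fin H, M.γ ^ (h : ℕ) * M.reward (τ h).1 (τ h).2

variable {d : ℕ}

/-- `∏ₕ π_θ(aₕ | sₕ)`, the factor of `p(τ | θ)` that depends on `θ`. -/
def ParamPolicy.lik (π : ParamPolicy (EuclideanSpace ℝ (Fin d)) S A) {H : ℕ}
    (τ : Traj S A H) (θ : EuclideanSpace ℝ (Fin d)) : ℝ :=
  ∏ h : Fin H, π.dens θ (τ h).1 (τ h).2

/-- `log p(τ | θ)` up to a summand that does not depend on `θ`. -/
def ParamPolicy.logLik (π : ParamPolicy (EuclideanSpace ℝ (Fin d)) S A) {H : ℕ}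
    (τ : Traj S A H) (θ : EuclideanSpace ℝ (Fin d)) : ℝ :=
  ∑ h : Fin H, Real.log (π.dens θ (τ h).1 (τ h).2)

/-- The importance weight `w(τ | θ', θ) = p(τ | θ') / p(τ | θ)`. -/
def ParamPolicy.weight (π : ParamPolicy (EuclideanSpace ℝ (Fin d)) S A) {H : ℕ}
    (τ : Traj S A H) (θ' θ : EuclideanSpace ℝ (Fin d)) : ℝ :=
  ∏ h : Fin H, π.dens θ' (τ h).1 (τ h).2 / π.dens θ (τ h).1 (τ h).2

/-- `p(· | θ)`, the law of a trajectory of length `H` under the policy `π_θ`. -/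
def MDP.trajLaw (M : MDP S A) (π : ParamPolicy (EuclideanSpace ℝ (Fin d)) S A) (H : ℕ)
    (θ : EuclideanSpace ℝ (Fin d)) : Measure (Traj S A H) :=
  (M.refMeasure π.ν H).withDensity (fun τ => ENNReal.ofReal (π.lik τ θ))

/-- The performance function `J(θ) = 𝔼_{τ ∼ p(· | θ)} [R(τ)]`. -/
def MDP.perf (M : MDP S A) (π : ParamPolicy (EuclideanSpace ℝ (Fin d)) S A) (H : ℕ)
    (θ : EuclideanSpace ℝ (Fin d)) : ℝ :=
  ∫ τ, M.totalReward τ ∂(M.trajLaw π H θ)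

/-- The PGT gradient estimator
`g(τ | θ) = ∑ₕ (∑_{j ≥ h} γ^j r(sⱼ, aⱼ)) ∇_θ log π_θ(aₕ | sₕ)`. -/
def MDP.pgt (M : MDP S A) (π : ParamPolicy (EuclideanSpace ℝ (Fin d)) S A) {H : ℕ}
    (τ : Traj S A H) (θ : EuclideanSpace ℝ (Fin d)) : EuclideanSpace ℝ (Fin d) :=
  ∑ h : Fin H, ∑ j ∈ Finset.Ici h,
    (M.γ ^ (j : ℕ) * M.reward (τ j).1 (τ j).2) •
      gradient (fun x => Real.log (π.dens x (τ h).1 (τ h).2)) θ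

/-- `Φ(τ | θ) = ∑ₕ ∑_{j ≥ h} γ^j r(sⱼ, aⱼ) log π_θ(aₕ | sₕ)`. -/
def MDP.potential (M : MDP S A) (π : ParamPolicy (EuclideanSpace ℝ (Fin d)) S A) {H : ℕ}
    (τ : Traj S A H) (θ : EuclideanSpace ℝ (Fin d)) : ℝ :=
  ∑ h : Fin H, ∑ j ∈ Finset.Ici h,
    M.γ ^ (j : ℕ) * M.reward (τ j).1 (τ j).2 * Real.log (π.dens θ (τ h).1 (τ h).2)

/-- The policy Hessian estimator applied to a vector:
`(∇Φ(τ | θ) ∇log p(τ | θ)ᵀ + ∇²Φ(τ | θ)) v`. -/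
def MDP.hessVec (M : MDP S A) (π : ParamPolicy (EuclideanSpace ℝ (Fin d)) S A) {H : ℕ}
    (τ : Traj S A H) (θ v : EuclideanSpace ℝ (Fin d)) : EuclideanSpace ℝ (Fin d) :=
  (inner ℝ (gradient (π.logLik τ) θ) v) • gradient (M.potential π τ) θ
    + fderiv ℝ (gradient (M.potential π τ)) θ v

/-- What the algorithm remembers at the start of iteration `t`: `θ_{t-1}`, `θ_t`, `u_{t-1}` and
`∑_{i < t} G_i²`. At `t = 1`, where `θ_0` and `u_0` do not exist, the entries `prev` and `u`
are never used for an update. -/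
structure AlgState (d : ℕ) where
  prev : EuclideanSpace ℝ (Fin d)
  cur : EuclideanSpace ℝ (Fin d)
  u : EuclideanSpace ℝ (Fin d)
  gsq : ℝ

/-- The adaptive step size `k / (m + ∑ G_i²)^{1/3}`. -/
def stepSize (k m gsq : ℝ) : ℝ := k / (m + gsq) ^ ((1 : ℝ) / 3)

/-- The state at the start of iteration 1. -/
def AlgState.start (θ₁ : EuclideanSpace ℝ (Fin d)) : AlgState d := ⟨θ₁, θ₁, 0, 0⟩

/-- The parameter at which the trajectory of an iteration is sampled,
`θ_t(α) = α θ_t + (1 - α) θ_{t-1}`; at iteration 1 this is `θ₁` for every `α`, since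
`AlgState.start` has `prev = cur = θ₁`. -/
def AlgState.query (s : AlgState d) (α : ℝ) : EuclideanSpace ℝ (Fin d) :=
  α • s.cur + (1 - α) • s.prev

/-- The estimator `u_t` of iteration `t = n + 1`: `u₁ = g(τ₁ | θ₁)` and, for `t ≥ 2`,
`u_t = β_t w(τ_t | θ_t, θ_t(α)) g(τ_t | θ_t) + (1 - β_t) (u_{t-1} + Δ_t)`, where
`β_t = c η_{t-1}²` and `Δ_t` is the Hessian estimator at `θ_t(α)` applied to
`θ_t - θ_{t-1}`. -/
def MDP.estimator (M : MDP S A) (π : ParamPolicy (EuclideanSpace ℝ (Fin d)) S A) {H : ℕ}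
    (k m c : ℝ) (n : ℕ) (s : AlgState d) (x : Draw S A H) : EuclideanSpace ℝ (Fin d) :=
  if n = 0 then M.pgt π x.2 s.cur
  else
    (c * stepSize k m s.gsq ^ 2 * π.weight x.2 s.cur (s.query x.1)) • M.pgt π x.2 s.cur
      + (1 - c * stepSize k m s.gsq ^ 2) •
        (s.u + M.hessVec π x.2 (s.query x.1) (s.cur - s.prev))

/-- Iteration `t = n + 1`: compute `u_t`, `G_t = ‖g(τ_t | θ_t)‖`, `η_t`, and
`θ_{t+1} = θ_t + η_t u_t`. -/
def MDP.step (M : MDP S A) (π : ParamPolicy (EuclideanSpace ℝ (Fin d)) S A) {H : ℕ}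
    (k m c : ℝ) (n : ℕ) (s : AlgState d) (x : Draw S A H) : AlgState d where
  prev := s.cur
  cur := s.cur + stepSize k m (s.gsq + ‖M.pgt π x.2 s.cur‖ ^ 2) • M.estimator π k m c n s x
  u := M.estimator π k m c n s x
  gsq := s.gsq + ‖M.pgt π x.2 s.cur‖ ^ 2

/-- The state after `n` iterations, as a function of the `n` draws made. -/
def MDP.state (M : MDP S A) (π : ParamPolicy (EuclideanSpace ℝ (Fin d)) S A) {H : ℕ}
    (k m c : ℝ) (θ₁ : EuclideanSpace ℝ (Fin d)) : (n : ℕ) → (Fin n → Draw S A H) → AlgState d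
  | 0, _ => AlgState.start θ₁
  | n + 1, ξ => M.step π k m c n
      (M.state π k m c θ₁ n (fun i => ξ i.castSucc)) (ξ (Fin.last n))

/-- The joint law of the draws of the first `n` iterations. Given the previous draws `ξ`, the new
draw `(α, τ)` has `α` uniform on `[0, 1]` and, given `α`, `τ ∼ p(· | θ_t(α))`: its density with
respect to `dα` times the reference measure on trajectories is `∏ₕ π_{θ_t(α)}(aₕ | sₕ)`.
Every iteration samples exactly one trajectory. (The `α` drawn at iteration 1 is not used.) -/
def MDP.runLaw (M : MDP S A) (π : ParamPolicy (EuclideanSpace ℝ (Fin d)) S A) (H : ℕ)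
    (k m c : ℝ) (θ₁ : EuclideanSpace ℝ (Fin d)) : (n : ℕ) → Measure (Fin n → Draw S A H)
  | 0 => Measure.dirac (fun i => i.elim0)
  | n + 1 =>
    (((M.runLaw π H k m c θ₁ n).prod
        ((volume.restrict (Set.Icc (0 : ℝ) 1)).prod (M.refMeasure π.ν H))).withDensity
      (fun p => ENNReal.ofReal
        (π.lik p.2.2 ((M.state π k m c θ₁ n p.1).query p.2.1)))).map
      (fun p => Fin.snoc (α := fun _ => Draw S A H) p.1 p.2)

/-- The iterate `θ_{t+1}` (for `t = 0, …, T - 1`, so `θ_1, …, θ_T`), a function of the first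
`t` draws. -/
def MDP.iter (M : MDP S A) (π : ParamPolicy (EuclideanSpace ℝ (Fin d)) S A) {H : ℕ}
    (k m c : ℝ) (θ₁ : EuclideanSpace ℝ (Fin d)) {T : ℕ} (ξ : Fin T → Draw S A H) (t : Fin T) :
    EuclideanSpace ℝ (Fin d) :=
  (M.state π k m c θ₁ t (fun i => ξ (Fin.castLE t.isLt.le i))).cur

/-- The joint law of the draws of `T` iterations and of the output index `ζ`, which is uniform on
the `T` indices and independent of the draws. -/
def MDP.outLaw (M : MDP S A) (π : ParamPolicy (EuclideanSpace ℝ (Fin d)) S A) (H : ℕ)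
    (k m c : ℝ) (θ₁ : EuclideanSpace ℝ (Fin d)) (T : ℕ) :
    Measure ((Fin T → Draw S A H) × Fin T) :=
  (M.runLaw π H k m c θ₁ T).prod (uniformOn (Set.univ : Set (Fin T)))

end Model

end

/-!
The proof is a Lyapunov argument for the adaptive recursive-momentum iteration, followed by a
self-bounding Cauchy–Schwarz argument for the random step sizes.

*Unbiasedness.* Two facts make the estimator `u_t` track `∇J(θ_t)`. The policy gradient theorem
(`MDP.hasGradientAt_perf`) says that `g` is an unbiased estimator of `∇J`; past rewards are
uncorrelated with later scores because truncating a trajectory does not change the law of what is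
kept. And for every fixed trajectory the Hessian estimator, multiplied with the likelihood, is the
derivative of `θ ↦ p(τ | θ) g(τ | θ)` along the segment from `θ_{t-1}` to `θ_t`, so that averaging
over the uniform `α` gives exactly `∇J(θ_t) - ∇J(θ_{t-1})` (`MDP.integral_hessVec`).

*Importance weights.* Since `log p(τ | θ)` is Lipschitz in `θ` with constant `H M_g`, a weight is at
most `exp (H M_g ‖θ' - θ‖)` on every trajectory (`ParamPolicy.IsRegular.weight_le`). While the
tracking error `e = u_{t-1} - ∇J(θ_{t-1})` is at most `7 G` the steps are so short that this
exponential is close to one, and the second moment of `e` contracts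
(`MDP.Admissible.integral_trackErr_sq_le`). When `e` is larger, the weights may be huge, but the first
moment of the weighted estimator is still at most `G`. Measuring the error with a Huber function,
quadratic up to `7 G` and linear beyond, makes the first moment sufficient
(`MDP.Admissible.integral_huber_trackErr_le`).

*Lyapunov function.* `16 J`, minus the Huber error divided by `4 L² η`, plus a multiple of
`log (G² + ∑ G_i²)`, grows in expectation by at least `η` times
`2 ‖∇J(θ)‖² + 2 min(G, ‖u‖ / 10)²` in each iteration (`MDP.Admissible.lyapunov_add_gain_le`). The
logarithm pays for the noise of the gradient estimators, and the first summand of `c` is chosen so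
that the slow variation of `1 / η` is harmless. Summation bounds the expected total gain by `k Λ`
(`MDP.Admissible.integral_cumGain_le`).

*Conclusion.* Let `X²` be the sum of the squares `(‖∇J(θ_t)‖ + min(G, ‖u_{t-1}‖ / 10))²`. Step sizes
decrease, so `E[η_T X²] ≤ k Λ`, while `1 / η_T` is a cube root of `∑ G_i²`, which is at most
`2 X²` plus twice the squared noise of the estimators at the sampled parameters
(`MDP.Admissible.gsq_state_le_cum`); the latter has expectation at most `T σ²`. Cauchy–Schwarz and
Jensen give `(E X)² ≤ Λ ((m + 2 T σ²)^{1/3} + 2^{1/3} (E X)^{2/3})` (`sq_integral_sqrt_le`), and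
solving for `E X` gives the bound. The sample complexity follows since `√Λ / T^{1/3}` is the slowest
term.
-/

noncomputable section

/-! ### Calculus and measurability of the log-density -/

/-- The standing smoothness assumptions on a policy: `log π_θ(a | s)` is twice differentiable in
`θ`, its gradient is bounded by `Mg` and its Hessian by `Mh`, uniformly in `θ`, `s` and `a`. -/
structure ParamPolicy.IsRegular {S A : Type*} [MeasurableSpace S] [MeasurableSpace A] {d : ℕ}
    (π : ParamPolicy (EuclideanSpace ℝ (Fin d)) S A) (Mg Mh : ℝ) : Prop where
  diff : ∀ s a, Differentiable ℝ (fun θ => Real.log (π.dens θ s a))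
  diff2 : ∀ s a, Differentiable ℝ (gradient (fun θ => Real.log (π.dens θ s a)))
  grad_le : ∀ θ s a, ‖gradient (fun x => Real.log (π.dens x s a)) θ‖ ≤ Mg
  hess_le : ∀ θ s a, ‖fderiv ℝ (gradient (fun x => Real.log (π.dens x s a))) θ‖ ≤ Mh

/-- Directional derivatives in the parameter of a jointly measurable function are jointly
measurable: they are limits of difference quotients. -/
lemma measurable_fderiv_param {E F X : Type*} [NormedAddCommGroup E] [NormedSpace ℝ E]
    [MeasurableSpace E] [BorelSpace E] [SecondCountableTopology E]
    [NormedAddCommGroup F] [NormedSpace ℝ F] [MeasurableSpace F] [BorelSpace F]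
    [SecondCountableTopology F] [MeasurableSpace X] {f : E → X → F}
    (hf : Measurable (fun p : E × X => f p.1 p.2))
    (hd : ∀ x, Differentiable ℝ (fun θ => f θ x)) :
    Measurable (fun p : (E × E) × X => fderiv ℝ (fun θ => f θ p.2) p.1.1 p.1.2) := by
  refine measurable_of_tendsto_metrizable
    (f := fun (n : ℕ) (p : (E × E) × X) =>
      ((n : ℝ) + 1) • (f (p.1.1 + ((n : ℝ) + 1)⁻¹ • p.1.2) p.2 - f p.1.1 p.2)) ?_ ?_
  · intro n
    have h1 : Measurable (fun p : (E × E) × X => f (p.1.1 + ((n : ℝ) + 1)⁻¹ • p.1.2) p.2) :=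
      hf.comp (f := fun p : (E × E) × X => (p.1.1 + ((n : ℝ) + 1)⁻¹ • p.1.2, p.2)) (by fun_prop)
    have h2 : Measurable (fun p : (E × E) × X => f p.1.1 p.2) :=
      hf.comp (f := fun p : (E × E) × X => (p.1.1, p.2)) (by fun_prop)
    exact (h1.sub h2).const_smul _
  · rw [tendsto_pi_nhds]
    intro p
    refine ((hd p.2) p.1.1).hasFDerivAt.lim (c := fun n : ℕ => (n : ℝ) + 1) p.1.2 ?_
    exact tendsto_norm_atTop_atTop.comp
      (tendsto_atTop_add_const_right _ _ tendsto_natCast_atTop_atTop)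

/-- The gradient in the parameter of a jointly measurable function is jointly measurable. -/
lemma measurable_gradient_param {X : Type*} [MeasurableSpace X] {d : ℕ}
    {f : EuclideanSpace ℝ (Fin d) → X → ℝ}
    (hf : Measurable (fun p : EuclideanSpace ℝ (Fin d) × X => f p.1 p.2))
    (hd : ∀ x, Differentiable ℝ (fun θ => f θ x)) :
    Measurable (fun p : EuclideanSpace ℝ (Fin d) × X => gradient (fun θ => f θ p.2) p.1) := by
  have key : ∀ i : Fin d, Measurable (fun p : EuclideanSpace ℝ (Fin d) × X =>
      gradient (fun θ => f θ p.2) p.1 i) := by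
    intro i
    have h := (measurable_fderiv_param hf hd).comp
      (g := fun p : (EuclideanSpace ℝ (Fin d) × EuclideanSpace ℝ (Fin d)) × X =>
        fderiv ℝ (fun θ => f θ p.2) p.1.1 p.1.2)
      (f := fun p : EuclideanSpace ℝ (Fin d) × X =>
        ((p.1, EuclideanSpace.single i (1 : ℝ)), p.2)) (by fun_prop)
    convert h using 2 with p
    change _ = fderiv ℝ (fun θ => f θ p.2) p.1 (EuclideanSpace.single i (1 : ℝ))
    rw [← inner_gradient_left, EuclideanSpace.inner_single_right]
    simp
  have h2 : Measurable (fun p : EuclideanSpace ℝ (Fin d) × X => WithLp.ofLp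
      (gradient (fun θ => f θ p.2) p.1)) := measurable_pi_iff.2 key
  exact (WithLp.measurable_toLp 2 (Fin d → ℝ)).comp h2

namespace ParamPolicy

variable {S A : Type*} [MeasurableSpace S] [MeasurableSpace A] {d : ℕ}
  {π : ParamPolicy (EuclideanSpace ℝ (Fin d)) S A} {Mg Mh : ℝ}

/-- The score `∇_θ log π_θ(a | s)`. -/
def score (π : ParamPolicy (EuclideanSpace ℝ (Fin d)) S A) (x : S × A)
    (θ : EuclideanSpace ℝ (Fin d)) : EuclideanSpace ℝ (Fin d) :=
  gradient (fun θ => Real.log (π.dens θ x.1 x.2)) θ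

lemma IsRegular.hasGradientAt_log (h : π.IsRegular Mg Mh) (x : S × A)
    (θ : EuclideanSpace ℝ (Fin d)) :
    HasGradientAt (fun θ => Real.log (π.dens θ x.1 x.2)) (π.score x θ) θ :=
  (h.diff x.1 x.2 θ).hasGradientAt

lemma IsRegular.norm_score_le (h : π.IsRegular Mg Mh) (x : S × A)
    (θ : EuclideanSpace ℝ (Fin d)) : ‖π.score x θ‖ ≤ Mg := h.grad_le θ x.1 x.2

lemma IsRegular.differentiable_score (h : π.IsRegular Mg Mh) (x : S × A) :
    Differentiable ℝ (π.score x) := h.diff2 x.1 x.2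

lemma IsRegular.norm_fderiv_score_le (h : π.IsRegular Mg Mh) (x : S × A)
    (θ : EuclideanSpace ℝ (Fin d)) : ‖fderiv ℝ (π.score x) θ‖ ≤ Mh := h.hess_le θ x.1 x.2

lemma IsRegular.measurable_log (h : π.IsRegular Mg Mh) :
    Measurable (fun p : EuclideanSpace ℝ (Fin d) × (S × A) =>
      Real.log (π.dens p.1 p.2.1 p.2.2)) :=
  measurable_uncurry_of_continuous_of_measurable
    (u := fun (θ : EuclideanSpace ℝ (Fin d)) (x : S × A) => Real.log (π.dens θ x.1 x.2))
    (fun x : S × A => (h.diff x.1 x.2).continuous) (fun θ => (π.dens_meas θ).log)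

lemma IsRegular.measurable_score (h : π.IsRegular Mg Mh) :
    Measurable (fun p : EuclideanSpace ℝ (Fin d) × (S × A) => π.score p.2 p.1) :=
  measurable_gradient_param
    (f := fun (θ : EuclideanSpace ℝ (Fin d)) (x : S × A) => Real.log (π.dens θ x.1 x.2))
    h.measurable_log (fun x : S × A => h.diff x.1 x.2)

/-! ### Likelihood of a trajectory -/

variable {H : ℕ}

/-- `∇_θ log p(τ | θ)`, the score of a trajectory. -/
def trajScore (π : ParamPolicy (EuclideanSpace ℝ (Fin d)) S A) (τ : Traj S A H)
    (θ : EuclideanSpace ℝ (Fin d)) : EuclideanSpace ℝ (Fin d) :=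
  ∑ h : Fin H, π.score (τ h) θ

lemma IsRegular.hasGradientAt_logLik (h : π.IsRegular Mg Mh) (τ : Traj S A H)
    (θ : EuclideanSpace ℝ (Fin d)) :
    HasGradientAt (π.logLik τ) (π.trajScore τ θ) θ := by
  rw [hasGradientAt_iff_hasFDerivAt, trajScore, map_sum]
  exact HasFDerivAt.fun_sum fun i _ => (h.hasGradientAt_log (τ i) θ).hasFDerivAt

lemma IsRegular.norm_trajScore_le (h : π.IsRegular Mg Mh) (τ : Traj S A H)
    (θ : EuclideanSpace ℝ (Fin d)) : ‖π.trajScore τ θ‖ ≤ H * Mg := by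
  refine (norm_sum_le_of_le _ fun i _ => h.norm_score_le (τ i) θ).trans ?_
  simp

lemma lik_eq_exp (π : ParamPolicy (EuclideanSpace ℝ (Fin d)) S A) (τ : Traj S A H)
    (θ : EuclideanSpace ℝ (Fin d)) : π.lik τ θ = Real.exp (π.logLik τ θ) := by
  rw [lik, logLik, Real.exp_sum]
  exact Finset.prod_congr rfl fun i _ => (Real.exp_log (π.dens_pos _ _ _)).symm

lemma lik_pos (π : ParamPolicy (EuclideanSpace ℝ (Fin d)) S A) (τ : Traj S A H)
    (θ : EuclideanSpace ℝ (Fin d)) : 0 < π.lik τ θ :=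
  Finset.prod_pos fun _ _ => π.dens_pos _ _ _

lemma weight_eq_div (π : ParamPolicy (EuclideanSpace ℝ (Fin d)) S A) (τ : Traj S A H)
    (θ' θ : EuclideanSpace ℝ (Fin d)) : π.weight τ θ' θ = π.lik τ θ' / π.lik τ θ :=
  Finset.prod_div_distrib ..

lemma weight_pos (π : ParamPolicy (EuclideanSpace ℝ (Fin d)) S A) (τ : Traj S A H)
    (θ' θ : EuclideanSpace ℝ (Fin d)) : 0 < π.weight τ θ' θ := by
  rw [weight_eq_div]; exact div_pos (π.lik_pos τ θ') (π.lik_pos τ θ)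

lemma weight_mul_lik (π : ParamPolicy (EuclideanSpace ℝ (Fin d)) S A) (τ : Traj S A H)
    (θ' θ : EuclideanSpace ℝ (Fin d)) : π.weight τ θ' θ * π.lik τ θ = π.lik τ θ' := by
  rw [weight_eq_div, div_mul_cancel₀ _ (π.lik_pos τ θ).ne']

lemma IsRegular.abs_logLik_sub_le (h : π.IsRegular Mg Mh) (τ : Traj S A H)
    (θ' θ : EuclideanSpace ℝ (Fin d)) :
    |π.logLik τ θ' - π.logLik τ θ| ≤ H * Mg * ‖θ' - θ‖ := by
  have := (convex_univ (𝕜 := ℝ)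
      (E := EuclideanSpace ℝ (Fin d))).norm_image_sub_le_of_norm_hasFDerivWithin_le
    (f := π.logLik τ) (C := H * Mg) (x := θ) (y := θ')
    (fun x _ => (h.hasGradientAt_logLik τ x).hasFDerivAt.hasFDerivWithinAt)
    (fun x _ => by simpa using h.norm_trajScore_le τ x) trivial trivial
  simpa using this

/-- The Lipschitz bound on `log p(τ | θ)` bounds importance weights on every single trajectory,
in terms of the distance of the two parameters only. -/
lemma IsRegular.weight_le (h : π.IsRegular Mg Mh) (τ : Traj S A H)
    (θ' θ : EuclideanSpace ℝ (Fin d)) :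
    π.weight τ θ' θ ≤ Real.exp (H * Mg * ‖θ' - θ‖) := by
  rw [weight_eq_div, lik_eq_exp, lik_eq_exp, ← Real.exp_sub]
  exact Real.exp_le_exp.2 ((le_abs_self _).trans (h.abs_logLik_sub_le τ θ' θ))

lemma IsRegular.lik_le (h : π.IsRegular Mg Mh) (τ : Traj S A H)
    (θ' θ : EuclideanSpace ℝ (Fin d)) :
    π.lik τ θ' ≤ Real.exp (H * Mg * ‖θ' - θ‖) * π.lik τ θ := by
  rw [← weight_mul_lik π τ θ' θ]
  exact mul_le_mul_of_nonneg_right (h.weight_le τ θ' θ) (π.lik_pos τ θ).le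

lemma IsRegular.hasFDerivAt_lik (h : π.IsRegular Mg Mh) (τ : Traj S A H)
    (θ : EuclideanSpace ℝ (Fin d)) :
    HasFDerivAt (π.lik τ) (π.lik τ θ • innerSL ℝ (π.trajScore τ θ)) θ := by
  have h1 : π.lik τ = fun θ => Real.exp (π.logLik τ θ) := funext (π.lik_eq_exp τ)
  rw [h1]
  exact (h.hasGradientAt_logLik τ θ).hasFDerivAt.exp

lemma IsRegular.measurable_logLik (h : π.IsRegular Mg Mh) :
    Measurable (fun p : EuclideanSpace ℝ (Fin d) × Traj S A H => π.logLik p.2 p.1) := by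
  refine Finset.measurable_fun_sum _ fun i _ => h.measurable_log.comp
    (f := fun p : EuclideanSpace ℝ (Fin d) × Traj S A H => (p.1, p.2 i)) (by fun_prop)

lemma IsRegular.measurable_lik (h : π.IsRegular Mg Mh) :
    Measurable (fun p : EuclideanSpace ℝ (Fin d) × Traj S A H => π.lik p.2 p.1) := by
  simp_rw [lik_eq_exp]
  exact h.measurable_logLik.exp

lemma IsRegular.measurable_trajScore (h : π.IsRegular Mg Mh) :
    Measurable (fun p : EuclideanSpace ℝ (Fin d) × Traj S A H => π.trajScore p.2 p.1) := by
  refine Finset.measurable_fun_sum _ fun i _ => h.measurable_score.comp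
    (f := fun p : EuclideanSpace ℝ (Fin d) × Traj S A H => (p.1, p.2 i)) (by fun_prop)

lemma IsRegular.measurable_trajScore_right (h : π.IsRegular Mg Mh)
    (θ : EuclideanSpace ℝ (Fin d)) : Measurable (fun τ : Traj S A H => π.trajScore τ θ) :=
  Measurable.of_uncurry_left (f := fun θ (τ : Traj S A H) => π.trajScore τ θ)
    h.measurable_trajScore

lemma measurable_lik_right (π : ParamPolicy (EuclideanSpace ℝ (Fin d)) S A)
    (θ : EuclideanSpace ℝ (Fin d)) : Measurable (fun τ : Traj S A H => π.lik τ θ) :=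
  Finset.measurable_fun_prod _ fun i _ => (π.dens_meas θ).comp (measurable_pi_apply i)

end ParamPolicy

/-! ### The gradient and Hessian estimators on a single trajectory -/

namespace MDP

variable {S A : Type*} [MeasurableSpace S] [MeasurableSpace A] {d H : ℕ}
  {π : ParamPolicy (EuclideanSpace ℝ (Fin d)) S A} {Mg Mh : ℝ}

/-- `∑_{h < H} ∑_{h ≤ j < H} γ^j ≤ (1 - γ)⁻²`. -/
lemma sum_Ici_pow_le (M : MDP S A) (H : ℕ) :
    ∑ h : Fin H, ∑ j ∈ Finset.Ici h, M.γ ^ (j : ℕ) ≤ 1 / (1 - M.γ) ^ 2 := by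
  have h1 : 0 < 1 - M.γ := sub_pos.2 M.γ_lt_one
  have hg := M.γ_pos.le
  have geo : ∀ n : ℕ, ∑ i ∈ Finset.range n, M.γ ^ i ≤ 1 / (1 - M.γ) := by
    intro n
    rw [geom_sum_eq M.γ_lt_one.ne, ← neg_div_neg_eq, neg_sub, neg_sub]
    gcongr
    linarith [pow_nonneg hg n]
  have tail : ∀ h : Fin H, ∑ j ∈ Finset.Ici h, M.γ ^ (j : ℕ) ≤ M.γ ^ (h : ℕ) * (1 / (1 - M.γ)) := by
    intro h
    have : ∑ j ∈ Finset.Ici h, M.γ ^ (j : ℕ) = ∑ j ∈ Finset.Ico (h : ℕ) H, M.γ ^ j := by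
      rw [← Fin.map_valEmbedding_Ici, Finset.sum_map]; rfl
    rw [this, Finset.sum_Ico_eq_sum_range]
    simp_rw [pow_add]
    rw [← Finset.mul_sum]
    exact mul_le_mul_of_nonneg_left (geo _) (pow_nonneg hg _)
  calc _ ≤ ∑ h : Fin H, M.γ ^ (h : ℕ) * (1 / (1 - M.γ)) := Finset.sum_le_sum fun h _ => tail h
    _ = (∑ i ∈ Finset.range H, M.γ ^ i) * (1 / (1 - M.γ)) := by
        rw [← Finset.sum_mul, Finset.sum_range]
    _ ≤ 1 / (1 - M.γ) * (1 / (1 - M.γ)) := by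
        gcongr
        exact geo _
    _ = _ := by rw [sq, div_mul_div_comm, one_mul]

/-- A discounted double sum of vectors of norm at most `K` has norm at most `K R / (1 - γ)²`. -/
lemma norm_sum_Ici_le (M : MDP S A) {F : Type*} [NormedAddCommGroup F] [NormedSpace ℝ F]
    (τ : Traj S A H) (f : Fin H → F) {K : ℝ} (hK : 0 ≤ K)
    (hf : ∀ h, ‖f h‖ ≤ K) :
    ‖∑ h : Fin H, ∑ j ∈ Finset.Ici h, (M.γ ^ (j : ℕ) * M.reward (τ j).1 (τ j).2) • f h‖
      ≤ K * M.R / (1 - M.γ) ^ 2 := by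
  calc _ ≤ ∑ h : Fin H, ∑ j ∈ Finset.Ici h, M.γ ^ (j : ℕ) * (K * M.R) := by
        refine norm_sum_le_of_le _ fun h _ => norm_sum_le_of_le _ fun j _ => ?_
        rw [norm_smul, norm_mul, norm_pow, Real.norm_of_nonneg M.γ_pos.le, mul_assoc,
          mul_comm K]
        have := M.reward_bdd (τ j).1 (τ j).2
        have := hf h
        have := M.γ_pos.le
        have := M.R_pos.le
        rw [Real.norm_eq_abs]
        gcongr
    _ = (∑ h : Fin H, ∑ j ∈ Finset.Ici h, M.γ ^ (j : ℕ)) * (K * M.R) := by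
        simp_rw [← Finset.sum_mul]
    _ ≤ 1 / (1 - M.γ) ^ 2 * (K * M.R) :=
        mul_le_mul_of_nonneg_right (M.sum_Ici_pow_le H) (mul_nonneg hK M.R_pos.le)
    _ = _ := by ring

end MDP

namespace MDP

variable {S A : Type*} [MeasurableSpace S] [MeasurableSpace A] {d H : ℕ}
  {π : ParamPolicy (EuclideanSpace ℝ (Fin d)) S A} {Mg Mh : ℝ}

lemma pgt_eq (M : MDP S A) (π : ParamPolicy (EuclideanSpace ℝ (Fin d)) S A) (τ : Traj S A H)
    (θ : EuclideanSpace ℝ (Fin d)) :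
    M.pgt π τ θ = ∑ h : Fin H, ∑ j ∈ Finset.Ici h,
      (M.γ ^ (j : ℕ) * M.reward (τ j).1 (τ j).2) • π.score (τ h) θ := rfl

lemma norm_pgt_le (M : MDP S A) (hπ : π.IsRegular Mg Mh) (hMg : 0 ≤ Mg) (τ : Traj S A H)
    (θ : EuclideanSpace ℝ (Fin d)) : ‖M.pgt π τ θ‖ ≤ Mg * M.R / (1 - M.γ) ^ 2 := by
  rw [pgt_eq]
  exact M.norm_sum_Ici_le τ _ hMg fun h => hπ.norm_score_le _ _

lemma hasFDerivAt_pgt (M : MDP S A) (hπ : π.IsRegular Mg Mh) (τ : Traj S A H)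
    (θ : EuclideanSpace ℝ (Fin d)) :
    HasFDerivAt (M.pgt π τ) (∑ h : Fin H, ∑ j ∈ Finset.Ici h,
      (M.γ ^ (j : ℕ) * M.reward (τ j).1 (τ j).2) • fderiv ℝ (π.score (τ h)) θ) θ := by
  have : M.pgt π τ = fun θ => ∑ h : Fin H, ∑ j ∈ Finset.Ici h,
      (M.γ ^ (j : ℕ) * M.reward (τ j).1 (τ j).2) • π.score (τ h) θ := rfl
  rw [this]
  exact HasFDerivAt.fun_sum fun h _ => HasFDerivAt.fun_sum fun j _ =>
    ((hπ.differentiable_score (τ h) θ).hasFDerivAt.fun_const_smul _)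

lemma norm_fderiv_pgt_le (M : MDP S A) (hπ : π.IsRegular Mg Mh) (hMh : 0 ≤ Mh) (τ : Traj S A H)
    (θ : EuclideanSpace ℝ (Fin d)) :
    ‖fderiv ℝ (M.pgt π τ) θ‖ ≤ Mh * M.R / (1 - M.γ) ^ 2 := by
  rw [(M.hasFDerivAt_pgt hπ τ θ).fderiv]
  exact M.norm_sum_Ici_le τ _ hMh fun h => hπ.norm_fderiv_score_le _ _

lemma norm_pgt_sub_le (M : MDP S A) (hπ : π.IsRegular Mg Mh) (hMh : 0 ≤ Mh) (τ : Traj S A H)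
    (x y : EuclideanSpace ℝ (Fin d)) :
    ‖M.pgt π τ y - M.pgt π τ x‖ ≤ Mh * M.R / (1 - M.γ) ^ 2 * ‖y - x‖ :=
  (convex_univ (𝕜 := ℝ) (E := EuclideanSpace ℝ (Fin d))).norm_image_sub_le_of_norm_fderiv_le
    (fun x _ => (M.hasFDerivAt_pgt hπ τ x).differentiableAt)
    (fun x _ => M.norm_fderiv_pgt_le hπ hMh τ x) trivial trivial

lemma gradient_potential (M : MDP S A) (hπ : π.IsRegular Mg Mh) (τ : Traj S A H) :
    gradient (M.potential π τ) = M.pgt π τ := by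
  refine gradient_eq fun θ => ?_
  rw [hasGradientAt_iff_hasFDerivAt, pgt_eq]
  simp_rw [map_sum]
  refine HasFDerivAt.fun_sum fun h _ => HasFDerivAt.fun_sum fun j _ => ?_
  rw [map_smul]
  exact (hπ.hasGradientAt_log (τ h) θ).hasFDerivAt.const_mul _

lemma hessVec_eq (M : MDP S A) (hπ : π.IsRegular Mg Mh) (τ : Traj S A H)
    (θ v : EuclideanSpace ℝ (Fin d)) :
    M.hessVec π τ θ v = inner ℝ (π.trajScore τ θ) v • M.pgt π τ θ
      + fderiv ℝ (M.pgt π τ) θ v := by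
  rw [hessVec, M.gradient_potential hπ, (hπ.hasGradientAt_logLik τ θ).gradient]

lemma norm_hessVec_le (M : MDP S A) (hπ : π.IsRegular Mg Mh) (hMg : 0 ≤ Mg) (hMh : 0 ≤ Mh)
    (τ : Traj S A H) (θ v : EuclideanSpace ℝ (Fin d)) :
    ‖M.hessVec π τ θ v‖
      ≤ (H * Mg * (Mg * M.R / (1 - M.γ) ^ 2) + Mh * M.R / (1 - M.γ) ^ 2) * ‖v‖ := by
  rw [M.hessVec_eq hπ, add_mul]
  refine (norm_add_le _ _).trans (add_le_add ?_ ?_)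
  · rw [norm_smul, mul_right_comm]
    refine mul_le_mul ?_ (M.norm_pgt_le hπ hMg τ θ) (norm_nonneg _) (by positivity)
    exact (norm_inner_le_norm _ _).trans
      (mul_le_mul_of_nonneg_right (hπ.norm_trajScore_le τ θ) (norm_nonneg _))
  · exact ContinuousLinearMap.le_of_opNorm_le _ (M.norm_fderiv_pgt_le hπ hMh τ θ) v

/-- The Hessian estimator is the derivative of `θ ↦ p(τ | θ) g(τ | θ)`, divided by `p(τ | θ)`. -/
lemma hasDerivAt_lik_smul_pgt (M : MDP S A) (hπ : π.IsRegular Mg Mh) (τ : Traj S A H)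
    (x v : EuclideanSpace ℝ (Fin d)) (t : ℝ) :
    HasDerivAt (fun t : ℝ => π.lik τ (x + t • v) • M.pgt π τ (x + t • v))
      (π.lik τ (x + t • v) • M.hessVec π τ (x + t • v) v) t := by
  have hl : HasDerivAt (fun t : ℝ => x + t • v) v t := by
    simpa using ((hasDerivAt_id t).smul_const v).const_add x
  have h1 := (hπ.hasFDerivAt_lik τ (x + t • v)).comp_hasDerivAt t hl
  have h2 := (M.hasFDerivAt_pgt hπ τ (x + t • v)).differentiableAt.hasFDerivAt.comp_hasDerivAt t hl
  refine (h1.smul h2).congr_deriv ?_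
  rw [M.hessVec_eq hπ, smul_add, add_comm, smul_smul]
  rfl

lemma measurable_totalReward (M : MDP S A) :
    Measurable (fun τ : Traj S A H => M.totalReward τ) :=
  Finset.measurable_fun_sum _ fun i _ =>
    (M.reward_meas.comp (measurable_pi_apply i)).const_mul _

lemma measurable_reward_apply (M : MDP S A) (j : Fin H) :
    Measurable (fun τ : Traj S A H => M.reward (τ j).1 (τ j).2) :=
  M.reward_meas.comp (measurable_pi_apply j)

lemma measurable_pgt (M : MDP S A) (hπ : π.IsRegular Mg Mh) :
    Measurable (fun p : EuclideanSpace ℝ (Fin d) × Traj S A H => M.pgt π p.2 p.1) := by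
  simp_rw [pgt_eq]
  refine Finset.measurable_fun_sum _ fun h _ => Finset.measurable_fun_sum _ fun j _ =>
    Measurable.fun_smul ?_ ?_
  · exact ((M.measurable_reward_apply j).comp measurable_snd).const_mul _
  · exact hπ.measurable_score.comp
      (f := fun p : EuclideanSpace ℝ (Fin d) × Traj S A H => (p.1, p.2 h)) (by fun_prop)

lemma measurable_pgt_right (M : MDP S A) (hπ : π.IsRegular Mg Mh)
    (θ : EuclideanSpace ℝ (Fin d)) : Measurable (fun τ : Traj S A H => M.pgt π τ θ) :=
  Measurable.of_uncurry_left (f := fun θ (τ : Traj S A H) => M.pgt π τ θ) (M.measurable_pgt hπ)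

lemma measurable_hessVec (M : MDP S A) (hπ : π.IsRegular Mg Mh) :
    Measurable (fun p : (EuclideanSpace ℝ (Fin d) × EuclideanSpace ℝ (Fin d)) × Traj S A H =>
      M.hessVec π p.2 p.1.1 p.1.2) := by
  simp_rw [M.hessVec_eq hπ]
  refine Measurable.fun_add (Measurable.fun_smul
    (Measurable.inner ?_ (measurable_snd.comp measurable_fst)) ?_) ?_
  · exact hπ.measurable_trajScore.comp
      (f := fun p : (EuclideanSpace ℝ (Fin d) × EuclideanSpace ℝ (Fin d)) × Traj S A H =>
        (p.1.1, p.2)) (by fun_prop)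
  · exact (M.measurable_pgt hπ).comp
      (f := fun p : (EuclideanSpace ℝ (Fin d) × EuclideanSpace ℝ (Fin d)) × Traj S A H =>
        (p.1.1, p.2)) (by fun_prop)
  · exact measurable_fderiv_param (f := fun θ τ => M.pgt π τ θ) (M.measurable_pgt hπ)
      fun τ θ => (M.hasFDerivAt_pgt hπ τ θ).differentiableAt

lemma abs_totalReward_le (M : MDP S A) (τ : Traj S A H) :
    |M.totalReward τ| ≤ H * M.R := by
  rw [totalReward]
  have : ∀ h : Fin H, |M.γ ^ (h : ℕ) * M.reward (τ h).1 (τ h).2| ≤ M.R := by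
    intro h
    rw [abs_mul, abs_of_nonneg (pow_nonneg M.γ_pos.le _)]
    exact (mul_le_of_le_one_left (abs_nonneg _) (pow_le_one₀ M.γ_pos.le M.γ_lt_one.le)).trans
      (M.reward_bdd _ _)
  refine (Finset.abs_sum_le_sum_abs _ _).trans ((Finset.sum_le_sum fun h _ => this h).trans ?_)
  simp

lemma totalReward_succ (M : MDP S A) (τ : Traj S A (H + 1)) :
    M.totalReward τ = M.totalReward (fun i : Fin H => τ i.castSucc)
      + M.γ ^ H * M.reward (τ (Fin.last H)).1 (τ (Fin.last H)).2 := by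
  simp [totalReward, Fin.sum_univ_castSucc]

lemma _root_.ParamPolicy.trajScore_succ (π : ParamPolicy (EuclideanSpace ℝ (Fin d)) S A)
    (τ : Traj S A (H + 1)) (θ : EuclideanSpace ℝ (Fin d)) :
    π.trajScore τ θ = π.trajScore (fun i : Fin H => τ i.castSucc) θ
      + π.score (τ (Fin.last H)) θ := by
  simp [ParamPolicy.trajScore, Fin.sum_univ_castSucc]

lemma _root_.ParamPolicy.lik_succ (π : ParamPolicy (EuclideanSpace ℝ (Fin d)) S A)
    (τ : Traj S A (H + 1)) (θ : EuclideanSpace ℝ (Fin d)) :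
    π.lik τ θ = π.lik (fun i : Fin H => τ i.castSucc) θ
      * π.dens θ (τ (Fin.last H)).1 (τ (Fin.last H)).2 := by
  simp [ParamPolicy.lik, Fin.prod_univ_castSucc]

/-- Adding one step to a trajectory adds its discounted reward times the score of the whole
trajectory to the estimator. -/
lemma pgt_succ (M : MDP S A) (π : ParamPolicy (EuclideanSpace ℝ (Fin d)) S A)
    (τ : Traj S A (H + 1)) (θ : EuclideanSpace ℝ (Fin d)) :
    M.pgt π τ θ = M.pgt π (fun i : Fin H => τ i.castSucc) θ
      + (M.γ ^ H * M.reward (τ (Fin.last H)).1 (τ (Fin.last H)).2) • π.trajScore τ θ := by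
  have key : ∀ (n : ℕ) (τ : Traj S A n), M.pgt π τ θ = ∑ h : Fin n, ∑ j : Fin n,
      if h ≤ j then (M.γ ^ (j : ℕ) * M.reward (τ j).1 (τ j).2) • π.score (τ h) θ else 0 := by
    intro n τ
    rw [pgt_eq]
    refine Finset.sum_congr rfl fun h _ => ?_
    rw [← Finset.sum_filter]
    congr 1
    ext j; simp
  rw [key, key, π.trajScore_succ, smul_add, ParamPolicy.trajScore, Finset.smul_sum]
  simp only [Fin.sum_univ_castSucc, Fin.castSucc_le_castSucc_iff, Fin.val_castSucc, Fin.val_last,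
    Fin.le_last, if_true, Finset.sum_add_distrib]
  have : ∀ j : Fin H, ¬ (Fin.last H ≤ j.castSucc) := fun j => not_le.2 (Fin.castSucc_lt_last j)
  simp only [this, if_false, Finset.sum_const_zero]
  abel

end MDP

/-! ### The law of a trajectory -/

namespace MDP

variable {S A : Type*} [MeasurableSpace S] [MeasurableSpace A] {d H : ℕ}
  {π : ParamPolicy (EuclideanSpace ℝ (Fin d)) S A} {Mg Mh : ℝ}

instance (M : MDP S A) (n : ℕ) : IsMarkovKernel (M.stateKernel n) := by
  have := M.trans_markov
  have := M.init_prob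
  cases n <;> (unfold stateKernel; infer_instance)

instance (M : MDP S A) (π : ParamPolicy (EuclideanSpace ℝ (Fin d)) S A) (n : ℕ) :
    SFinite (M.refMeasure π.ν n) := by
  have := π.ν_sigmaFinite
  induction n with
  | zero => unfold refMeasure; infer_instance
  | succ n ih => unfold refMeasure; infer_instance

lemma measurable_fin_snoc (X : Type*) [MeasurableSpace X] (n : ℕ) :
    Measurable (fun p : (Fin n → X) × X => Fin.snoc (α := fun _ => X) p.1 p.2) := by
  refine measurable_pi_iff.2 fun i => ?_
  refine Fin.lastCases ?_ (fun j => ?_) i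
  · simpa using measurable_snd
  · simp only [Fin.snoc_castSucc]
    fun_prop

lemma lintegral_refMeasure_succ (M : MDP S A)
    (π : ParamPolicy (EuclideanSpace ℝ (Fin d)) S A) (n : ℕ) {f : Traj S A (n + 1) → ENNReal}
    (hf : Measurable f) :
    ∫⁻ τ, f τ ∂(M.refMeasure π.ν (n + 1)) = ∫⁻ τ, ∫⁻ s, ∫⁻ a,
      f (Fin.snoc (α := fun _ => S × A) τ (s, a)) ∂π.ν ∂(M.stateKernel n τ)
        ∂(M.refMeasure π.ν n) := by
  have := π.ν_sigmaFinite
  have hs : Measurable (fun p : (Traj S A n × S) × A =>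
      Fin.snoc (α := fun _ => S × A) p.1.1 (p.1.2, p.2)) :=
    (measurable_fin_snoc (S × A) n).comp
      (f := fun p : (Traj S A n × S) × A => (p.1.1, (p.1.2, p.2))) (by fun_prop)
  have hfs : Measurable (fun p : (Traj S A n × S) × A =>
      f (Fin.snoc (α := fun _ => S × A) p.1.1 (p.1.2, p.2))) := hf.comp hs
  rw [refMeasure, lintegral_map hf hs, lintegral_prod _ hfs.aemeasurable,
    Measure.lintegral_compProd hfs.lintegral_prod_right']

/-- Trajectories of length `n + 1`, truncated, have the law of trajectories of length `n`. -/
lemma map_castSucc_trajLaw (M : MDP S A)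
    (π : ParamPolicy (EuclideanSpace ℝ (Fin d)) S A) (n : ℕ) (θ : EuclideanSpace ℝ (Fin d)) :
    (M.trajLaw π (n + 1) θ).map (fun τ i => τ (Fin.castSucc i)) = M.trajLaw π n θ := by
  have hm : Measurable (fun (τ : Traj S A (n + 1)) (i : Fin n) => τ i.castSucc) := by fun_prop
  refine Measure.ext_of_lintegral _ fun f hf => ?_
  have hfm : Measurable (fun τ : Traj S A (n + 1) => f (fun i : Fin n => τ i.castSucc)) :=
    hf.comp hm
  rw [lintegral_map hf hm, trajLaw, trajLaw,
    lintegral_withDensity_eq_lintegral_mul _ (π.measurable_lik_right θ).ennreal_ofReal hfm,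
    lintegral_withDensity_eq_lintegral_mul _ (π.measurable_lik_right θ).ennreal_ofReal hf,
    lintegral_refMeasure_succ _ _ _
      ((π.measurable_lik_right θ).ennreal_ofReal.mul hfm)]
  refine lintegral_congr fun τ => ?_
  have key : ∀ s a, ENNReal.ofReal
      (π.lik (Fin.snoc (α := fun _ => S × A) τ (s, a) : Traj S A (n + 1)) θ)
      * f (fun i => (Fin.snoc (α := fun _ => S × A) τ (s, a) : Traj S A (n + 1)) i.castSucc)
      = (ENNReal.ofReal (π.lik τ θ) * f τ) * ENNReal.ofReal (π.dens θ s a) := by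
    intro s a
    rw [π.lik_succ]
    simp only [Fin.snoc_castSucc, Fin.snoc_last]
    rw [ENNReal.ofReal_mul (π.lik_pos τ θ).le]
    ring
  simp only [Pi.mul_apply, key]
  have h2 : ∀ s, ∫⁻ a, ENNReal.ofReal (π.lik τ θ) * f τ * ENNReal.ofReal (π.dens θ s a) ∂π.ν
      = ENNReal.ofReal (π.lik τ θ) * f τ := by
    intro s
    rw [lintegral_const_mul, π.dens_norm, mul_one]
    exact ((π.dens_meas θ).comp (measurable_prodMk_left (x := s))).ennreal_ofReal
  simp [h2]

instance (M : MDP S A) (π : ParamPolicy (EuclideanSpace ℝ (Fin d)) S A) (n : ℕ)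
    (θ : EuclideanSpace ℝ (Fin d)) : IsProbabilityMeasure (M.trajLaw π n θ) := by
  induction n with
  | zero =>
    have : (fun τ : Traj S A 0 => ENNReal.ofReal (π.lik τ θ)) = 1 := by
      funext τ; simp [ParamPolicy.lik]
    rw [trajLaw, this, withDensity_one, refMeasure]
    infer_instance
  | succ n ih =>
    rw [← map_castSucc_trajLaw] at ih
    exact Measure.isProbabilityMeasure_of_map (f := fun τ i => τ (Fin.castSucc i))

lemma integral_trajLaw (M : MDP S A)
    (π : ParamPolicy (EuclideanSpace ℝ (Fin d)) S A) {F : Type*} [NormedAddCommGroup F]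
    [NormedSpace ℝ F] (θ : EuclideanSpace ℝ (Fin d)) (f : Traj S A H → F) :
    ∫ τ, f τ ∂(M.trajLaw π H θ) = ∫ τ, π.lik τ θ • f τ ∂(M.refMeasure π.ν H) := by
  rw [trajLaw, integral_withDensity_eq_integral_toReal_smul
    (π.measurable_lik_right θ).ennreal_ofReal (ae_of_all _ fun _ => ENNReal.ofReal_lt_top)]
  simp [ENNReal.toReal_ofReal (π.lik_pos _ θ).le]

lemma integrable_lik (M : MDP S A) (π : ParamPolicy (EuclideanSpace ℝ (Fin d)) S A)
    (θ : EuclideanSpace ℝ (Fin d)) :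
    Integrable (fun τ : Traj S A H => π.lik τ θ) (M.refMeasure π.ν H) := by
  refine ⟨(π.measurable_lik_right θ).aestronglyMeasurable, ?_⟩
  rw [hasFiniteIntegral_iff_ofReal (ae_of_all _ fun τ => (π.lik_pos τ θ).le)]
  have : M.trajLaw π H θ Set.univ = 1 := measure_univ
  rw [trajLaw, withDensity_apply _ MeasurableSet.univ, Measure.restrict_univ] at this
  rw [this]
  exact ENNReal.one_lt_top

/-- The expectation of a bounded function of the trajectory is differentiable in the parameter of
the policy, with the likelihood-ratio (REINFORCE) gradient. -/
lemma hasGradientAt_integral_trajLaw (M : MDP S A) (hπ : π.IsRegular Mg Mh) (hMg : 0 ≤ Mg)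
    {f : Traj S A H → ℝ} (hf : Measurable f) {K : ℝ} (hK : ∀ τ, |f τ| ≤ K)
    (θ : EuclideanSpace ℝ (Fin d)) :
    HasGradientAt (fun θ => ∫ τ, f τ ∂(M.trajLaw π H θ))
      (∫ τ, f τ • π.trajScore τ θ ∂(M.trajLaw π H θ)) θ := by
  simp_rw [integral_trajLaw]
  have hsc : ∀ θ, Measurable (fun τ : Traj S A H => π.trajScore τ θ) :=
    hπ.measurable_trajScore_right
  have hlik : ∀ x ∈ Metric.ball θ 1, ∀ τ : Traj S A H,
      π.lik τ x ≤ Real.exp (H * Mg) * π.lik τ θ := by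
    intro x hx τ
    refine (hπ.lik_le τ x θ).trans (mul_le_mul_of_nonneg_right ?_ (π.lik_pos τ θ).le)
    rw [mem_ball_iff_norm] at hx
    exact Real.exp_le_exp.2 (mul_le_of_le_one_right (by positivity) hx.le)
  have h := hasFDerivAt_integral_of_dominated_of_fderiv_le (𝕜 := ℝ)
    (μ := M.refMeasure π.ν H) (x₀ := θ) (s := Metric.ball θ 1)
    (F := fun θ (τ : Traj S A H) => π.lik τ θ • f τ)
    (F' := fun θ τ => innerSL ℝ (π.lik τ θ • f τ • π.trajScore τ θ))
    (bound := fun τ => Real.exp (H * Mg) * (K * (H * Mg)) * π.lik τ θ)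
    (Metric.ball_mem_nhds θ one_pos)
    (Eventually.of_forall fun x => ((π.measurable_lik_right x).mul hf).aestronglyMeasurable)
    ((M.integrable_lik π θ).mul_bdd (c := K) hf.aestronglyMeasurable (ae_of_all _ hK)) ?_ ?_ ?_ ?_
  · rw [hasGradientAt_iff_hasFDerivAt]
    refine h.congr_fderiv ?_
    have hint : Integrable (fun τ : Traj S A H => π.lik τ θ • f τ • π.trajScore τ θ)
        (M.refMeasure π.ν H) := by
      refine Integrable.smul_bdd (M.integrable_lik π θ) (K * (H * Mg))
        (hf.smul (hsc θ)).aestronglyMeasurable (ae_of_all _ fun τ => ?_)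
      rw [norm_smul]
      exact mul_le_mul (hK τ) (hπ.norm_trajScore_le τ θ) (norm_nonneg _)
        ((abs_nonneg _).trans (hK τ))
    have hint' : Integrable (fun τ : Traj S A H =>
        innerSL ℝ (π.lik τ θ • f τ • π.trajScore τ θ)) (M.refMeasure π.ν H) :=
      hint.mono ((innerSL ℝ).continuous.comp_aestronglyMeasurable hint.aestronglyMeasurable)
        (ae_of_all _ fun τ => (innerSL_apply_norm _ _).le)
    refine ContinuousLinearMap.ext fun v => ?_
    rw [ContinuousLinearMap.integral_apply hint', InnerProductSpace.toDual_apply_apply,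
      real_inner_comm, ← integral_inner hint]
    simp_rw [innerSL_apply_apply, real_inner_comm v]
  · exact (innerSL ℝ (E := EuclideanSpace ℝ (Fin d))).continuous.comp_aestronglyMeasurable
      ((π.measurable_lik_right θ).smul (hf.smul (hsc θ))).aestronglyMeasurable
  · refine ae_of_all _ fun τ x hx => ?_
    rw [innerSL_apply_norm, norm_smul, norm_smul, Real.norm_of_nonneg (π.lik_pos τ x).le]
    calc π.lik τ x * (‖f τ‖ * ‖π.trajScore τ x‖)
        ≤ (Real.exp (H * Mg) * π.lik τ θ) * (K * (H * Mg)) := by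
          refine mul_le_mul (hlik x hx τ) (mul_le_mul (hK τ) (hπ.norm_trajScore_le τ x)
            (norm_nonneg _) ((abs_nonneg _).trans (hK τ))) (by positivity) ?_
          have := π.lik_pos τ θ
          positivity
      _ = _ := by ring
  · exact (M.integrable_lik π θ).const_mul _
  · refine ae_of_all _ fun τ x _ => ?_
    refine ((hπ.hasFDerivAt_lik τ x).mul_const (f τ)).congr_fderiv ?_
    rw [map_smul, map_smul, smul_smul, smul_smul, mul_comm]

/-- The policy gradient theorem: past rewards do not contribute to the gradient, so that `g` is an
unbiased estimator. In the induction on the horizon, the rewards of the first `n` steps have the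
same expectation under the laws of trajectories of length `n` and `n + 1`; comparing the two
likelihood-ratio gradients shows that they are uncorrelated with the last score. -/
lemma integral_totalReward_smul_trajScore (M : MDP S A) (hπ : π.IsRegular Mg Mh) (hMg : 0 ≤ Mg)
    (n : ℕ) (θ : EuclideanSpace ℝ (Fin d)) :
    ∫ τ, M.totalReward τ • π.trajScore τ θ ∂(M.trajLaw π n θ)
      = ∫ τ, M.pgt π τ θ ∂(M.trajLaw π n θ) := by
  have hsc : ∀ n, Measurable (fun τ : Traj S A n => π.trajScore τ θ) := fun _ =>
    hπ.measurable_trajScore_right θ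
  induction n with
  | zero => simp [totalReward, pgt]
  | succ n ih =>
    let c : Traj S A (n + 1) → Traj S A n := fun τ i => τ i.castSucc
    have hc : Measurable c := by fun_prop
    have marg : ∀ {F : Type} [NormedAddCommGroup F] [NormedSpace ℝ F] (θ)
        (f : Traj S A n → F), AEStronglyMeasurable f (M.trajLaw π n θ) →
        ∫ τ, f (c τ) ∂(M.trajLaw π (n + 1) θ) = ∫ τ, f τ ∂(M.trajLaw π n θ) := by
      intro F _ _ θ f hf
      rw [← M.map_castSucc_trajLaw π n θ] at hf ⊢
      exact (integral_map hc.aemeasurable hf).symm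
    have e1 : ∫ τ, M.totalReward (c τ) • π.trajScore τ θ ∂(M.trajLaw π (n + 1) θ)
        = ∫ τ, M.totalReward (c τ) • π.trajScore (c τ) θ ∂(M.trajLaw π (n + 1) θ) := by
      have h1 := M.hasGradientAt_integral_trajLaw hπ hMg
        (f := fun τ => M.totalReward (c τ)) (M.measurable_totalReward.comp hc)
        (fun τ => M.abs_totalReward_le (c τ)) θ
      have h2 := M.hasGradientAt_integral_trajLaw hπ hMg
        (f := fun τ : Traj S A n => M.totalReward τ) M.measurable_totalReward
        (fun τ => M.abs_totalReward_le τ) θ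
      simp_rw [marg _ (fun τ => M.totalReward τ)
        M.measurable_totalReward.aestronglyMeasurable] at h1
      rw [h1.unique h2]
      exact (marg θ (fun τ => M.totalReward τ • π.trajScore τ θ)
        (M.measurable_totalReward.smul (hsc n)).aestronglyMeasurable).symm
    have bd : ∀ (f : Traj S A (n + 1) → EuclideanSpace ℝ (Fin d)) (K : ℝ), Measurable f →
        (∀ τ, ‖f τ‖ ≤ K) → Integrable f (M.trajLaw π (n + 1) θ) := fun f K hf hK =>
      Integrable.of_bound hf.aestronglyMeasurable K (ae_of_all _ hK)
    have hsm : ∀ (x K K' : ℝ) (v : EuclideanSpace ℝ (Fin d)), |x| ≤ K → ‖v‖ ≤ K' →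
        ‖x • v‖ ≤ K * K' := fun x K K' v h h' => by
      rw [norm_smul]
      exact mul_le_mul h h' (norm_nonneg _) ((abs_nonneg _).trans h)
    have hr : ∀ τ : Traj S A (n + 1),
        |M.γ ^ n * M.reward (τ (Fin.last n)).1 (τ (Fin.last n)).2| ≤ 1 * M.R := by
      intro τ
      rw [abs_mul, abs_of_nonneg (pow_nonneg M.γ_pos.le _)]
      exact mul_le_mul (pow_le_one₀ M.γ_pos.le M.γ_lt_one.le) (M.reward_bdd _ _) (abs_nonneg _)
        zero_le_one
    have i1 := bd (fun τ => M.totalReward (c τ) • π.trajScore τ θ) _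
      ((M.measurable_totalReward.comp hc).smul (hsc _))
      (fun τ => hsm _ _ _ _ (M.abs_totalReward_le _) (hπ.norm_trajScore_le τ θ))
    have i2 := bd (fun τ => (M.γ ^ n * M.reward (τ (Fin.last n)).1 (τ (Fin.last n)).2)
        • π.trajScore τ θ) _ (((M.measurable_reward_apply _).const_mul _).smul (hsc _))
      (fun τ => hsm _ _ _ _ (hr τ) (hπ.norm_trajScore_le τ θ))
    have i3 := bd (fun τ => M.pgt π (c τ) θ) _
      ((M.measurable_pgt_right hπ θ).comp hc)
      (fun τ => M.norm_pgt_le hπ hMg _ _)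
    simp_rw [M.totalReward_succ, M.pgt_succ, add_smul]
    rw [integral_add i1 i2, integral_add i3 i2]
    congr 1
    have m1 := marg θ (fun τ => M.totalReward τ • π.trajScore τ θ)
      (M.measurable_totalReward.smul (hsc n)).aestronglyMeasurable
    have m2 := marg θ (fun τ => M.pgt π τ θ)
      (M.measurable_pgt_right hπ θ).aestronglyMeasurable
    exact e1.trans (m1.trans (ih.trans m2.symm))

/-- `J` is differentiable, and `g` is an unbiased estimator of its gradient. -/
lemma hasGradientAt_perf (M : MDP S A) (hπ : π.IsRegular Mg Mh) (hMg : 0 ≤ Mg)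
    (θ : EuclideanSpace ℝ (Fin d)) :
    HasGradientAt (M.perf π H) (∫ τ, M.pgt π τ θ ∂(M.trajLaw π H θ)) θ := by
  rw [← M.integral_totalReward_smul_trajScore hπ hMg]
  exact M.hasGradientAt_integral_trajLaw hπ hMg M.measurable_totalReward
    (fun τ => M.abs_totalReward_le τ) θ

lemma gradient_perf (M : MDP S A) (hπ : π.IsRegular Mg Mh) (hMg : 0 ≤ Mg)
    (θ : EuclideanSpace ℝ (Fin d)) :
    gradient (M.perf π H) θ = ∫ τ, M.pgt π τ θ ∂(M.trajLaw π H θ) :=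
  (M.hasGradientAt_perf hπ hMg θ).gradient

lemma abs_perf_le (M : MDP S A) (π : ParamPolicy (EuclideanSpace ℝ (Fin d)) S A)
    (θ : EuclideanSpace ℝ (Fin d)) : |M.perf π H θ| ≤ H * M.R := by
  simpa [perf] using norm_integral_le_of_norm_le_const (μ := M.trajLaw π H θ)
    (f := fun τ => M.totalReward τ) (ae_of_all _ fun τ => M.abs_totalReward_le τ)

lemma bddAbove_range_perf (M : MDP S A) (π : ParamPolicy (EuclideanSpace ℝ (Fin d)) S A) :
    BddAbove (Set.range (M.perf π H)) := by
  refine ⟨H * M.R, ?_⟩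
  rintro _ ⟨θ, rfl⟩
  exact (le_abs_self _).trans (M.abs_perf_le π θ)

lemma norm_gradient_perf_le (M : MDP S A) (hπ : π.IsRegular Mg Mh) (hMg : 0 ≤ Mg)
    (θ : EuclideanSpace ℝ (Fin d)) :
    ‖gradient (M.perf π H) θ‖ ≤ Mg * M.R / (1 - M.γ) ^ 2 := by
  rw [M.gradient_perf hπ hMg]
  simpa using norm_integral_le_of_norm_le_const (μ := M.trajLaw π H θ)
    (ae_of_all _ fun τ => M.norm_pgt_le hπ hMg τ θ)

end MDP

/-! ### One draw of the algorithm -/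

namespace MDP

variable {S A : Type*} [MeasurableSpace S] [MeasurableSpace A] {d H : ℕ}
  {π : ParamPolicy (EuclideanSpace ℝ (Fin d)) S A} {Mg Mh : ℝ}

/-- The law of the draw `(α, τ)` made by an iteration that starts in the state `s`: `α` is uniform
on `[0, 1]` and `τ` has the law of a trajectory at the parameter `s.query α`. -/
def drawLaw (M : MDP S A) (π : ParamPolicy (EuclideanSpace ℝ (Fin d)) S A) (H : ℕ)
    (s : AlgState d) : Measure (Draw S A H) :=
  ((volume.restrict (Set.Icc (0 : ℝ) 1)).prod (M.refMeasure π.ν H)).withDensity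
    (fun x => ENNReal.ofReal (π.lik x.2 (s.query x.1)))

lemma _root_.AlgState.measurable_query (s : AlgState d) : Measurable s.query := by
  unfold AlgState.query
  fun_prop

lemma _root_.AlgState.query_eq (s : AlgState d) (α : ℝ) :
    s.query α = s.prev + α • (s.cur - s.prev) := by
  rw [AlgState.query]; module

lemma measurable_lik_query (hπ : π.IsRegular Mg Mh) (s : AlgState d) :
    Measurable (fun x : Draw S A H => π.lik x.2 (s.query x.1)) :=
  hπ.measurable_lik.comp (f := fun x : Draw S A H => (s.query x.1, x.2))
    ((s.measurable_query.comp measurable_fst).prodMk measurable_snd)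

lemma isProbabilityMeasure_drawLaw (M : MDP S A) (hπ : π.IsRegular Mg Mh) (s : AlgState d) :
    IsProbabilityMeasure (M.drawLaw π H s) := by
  refine ⟨?_⟩
  rw [drawLaw, withDensity_apply _ MeasurableSet.univ, Measure.restrict_univ,
    lintegral_prod _ (measurable_lik_query hπ s).ennreal_ofReal.aemeasurable]
  have : ∀ α, ∫⁻ τ : Traj S A H, ENNReal.ofReal (π.lik τ (s.query α)) ∂(M.refMeasure π.ν H) = 1 := by
    intro α
    have h : M.trajLaw π H (s.query α) Set.univ = 1 := measure_univ
    rwa [trajLaw, withDensity_apply _ MeasurableSet.univ, Measure.restrict_univ] at h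
  simp [this]

lemma ae_drawLaw_mem_Icc (M : MDP S A) (π : ParamPolicy (EuclideanSpace ℝ (Fin d)) S A)
    (s : AlgState d) : ∀ᵐ x ∂(M.drawLaw π H s), x.1 ∈ Set.Icc (0 : ℝ) 1 := by
  refine (withDensity_absolutelyContinuous _ _).ae_le ?_
  exact Measure.quasiMeasurePreserving_fst.ae (ae_restrict_mem measurableSet_Icc)

/-- A function of the draw that is bounded for `α ∈ [0, 1]` is integrable. -/
lemma integrable_drawLaw (M : MDP S A) (hπ : π.IsRegular Mg Mh) (s : AlgState d)
    {F : Type*} [NormedAddCommGroup F] [MeasurableSpace F] [BorelSpace F]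
    [SecondCountableTopology F] {f : Draw S A H → F} (hf : Measurable f) {K : ℝ}
    (hK : ∀ x, x.1 ∈ Set.Icc (0 : ℝ) 1 → ‖f x‖ ≤ K) : Integrable f (M.drawLaw π H s) := by
  have := M.isProbabilityMeasure_drawLaw (H := H) hπ s
  refine Integrable.of_bound hf.aestronglyMeasurable K ?_
  filter_upwards [M.ae_drawLaw_mem_Icc π s] with x hx using hK x hx

lemma integral_drawLaw (M : MDP S A) (hπ : π.IsRegular Mg Mh) (s : AlgState d)
    {F : Type*} [NormedAddCommGroup F] [NormedSpace ℝ F] {f : Draw S A H → F}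
    (hf : Integrable f (M.drawLaw π H s)) :
    ∫ x, f x ∂(M.drawLaw π H s)
      = ∫ α in Set.Icc (0 : ℝ) 1, ∫ τ, f (α, τ) ∂(M.trajLaw π H (s.query α)) := by
  have hl := (measurable_lik_query (H := H) hπ s).ennreal_ofReal
  have hr : ∀ x : Draw S A H, (ENNReal.ofReal (π.lik x.2 (s.query x.1))).toReal • f x
      = π.lik x.2 (s.query x.1) • f x := fun x => by
    rw [ENNReal.toReal_ofReal (π.lik_pos _ _).le]
  rw [drawLaw, integrable_withDensity_iff_integrable_smul' hl
    (ae_of_all _ fun _ => ENNReal.ofReal_lt_top)] at hf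
  rw [drawLaw, integral_withDensity_eq_integral_toReal_smul hl
    (ae_of_all _ fun _ => ENNReal.ofReal_lt_top)]
  simp_rw [hr] at hf ⊢
  rw [integral_prod _ hf]
  simp_rw [M.integral_trajLaw π]

lemma measurable_weight_query (hπ : π.IsRegular Mg Mh) (s : AlgState d)
    (θ : EuclideanSpace ℝ (Fin d)) :
    Measurable (fun x : Draw S A H => π.weight x.2 θ (s.query x.1)) := by
  simp_rw [π.weight_eq_div]
  exact ((π.measurable_lik_right θ).comp measurable_snd).div (measurable_lik_query hπ s)

lemma _root_.AlgState.norm_sub_query_le (s : AlgState d) {α : ℝ} (hα : α ∈ Set.Icc (0 : ℝ) 1) :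
    ‖s.cur - s.query α‖ ≤ ‖s.cur - s.prev‖ := by
  have : s.cur - s.query α = (1 - α) • (s.cur - s.prev) := by rw [AlgState.query]; module
  rw [this, norm_smul, Real.norm_of_nonneg (by linarith [hα.2])]
  exact mul_le_of_le_one_left (norm_nonneg _) (by linarith [hα.1])

lemma weight_query_le (hπ : π.IsRegular Mg Mh) (hMg : 0 ≤ Mg) (s : AlgState d)
    {x : Draw S A H} (hx : x.1 ∈ Set.Icc (0 : ℝ) 1) :
    π.weight x.2 s.cur (s.query x.1) ≤ Real.exp (H * Mg * ‖s.cur - s.prev‖) := by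
  refine (hπ.weight_le _ _ _).trans (Real.exp_le_exp.2 ?_)
  exact mul_le_mul_of_nonneg_left (s.norm_sub_query_le hx) (by positivity)

/-- The importance-weighted gradient estimator is unbiased. -/
lemma integral_weight_smul_pgt (M : MDP S A) (hπ : π.IsRegular Mg Mh) (hMg : 0 ≤ Mg)
    (s : AlgState d) :
    ∫ x, π.weight x.2 s.cur (s.query x.1) • M.pgt π x.2 s.cur ∂(M.drawLaw π H s)
      = gradient (M.perf π H) s.cur := by
  rw [M.integral_drawLaw hπ s, M.gradient_perf hπ hMg]
  · simp_rw [M.integral_trajLaw π, smul_smul, mul_comm (π.lik _ _), π.weight_mul_lik]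
    simp
  · refine M.integrable_drawLaw hπ s ((measurable_weight_query hπ s _).smul
      ((M.measurable_pgt_right hπ _).comp measurable_snd))
      (K := Real.exp (H * Mg * ‖s.cur - s.prev‖) * (Mg * M.R / (1 - M.γ) ^ 2)) fun x hx => ?_
    rw [norm_smul, Real.norm_of_nonneg (π.weight_pos _ _ _).le]
    exact mul_le_mul (weight_query_le hπ hMg s hx) (M.norm_pgt_le hπ hMg _ _) (norm_nonneg _)
      (Real.exp_pos _).le

lemma integral_weight (M : MDP S A) (hπ : π.IsRegular Mg Mh) (hMg : 0 ≤ Mg) (s : AlgState d) :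
    ∫ x, π.weight x.2 s.cur (s.query x.1) ∂(M.drawLaw π H s) = 1 := by
  rw [M.integral_drawLaw hπ s]
  · simp_rw [M.integral_trajLaw π, smul_eq_mul, mul_comm (π.lik _ _), π.weight_mul_lik]
    have h := M.integral_trajLaw (H := H) π s.cur (fun _ => (1 : ℝ))
    simp only [integral_const, probReal_univ, smul_eq_mul, mul_one] at h
    simp [← h]
  · refine M.integrable_drawLaw hπ s (measurable_weight_query hπ s _)
      (K := Real.exp (H * Mg * ‖s.cur - s.prev‖)) fun x hx => ?_
    rw [Real.norm_of_nonneg (π.weight_pos _ _ _).le]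
    exact weight_query_le hπ hMg s hx

/-- The expectation of a function that is bounded by `K`, reweighted, is bounded by `K`, no matter
how large the weights are. -/
lemma integral_norm_weight_smul_pgt_le (M : MDP S A) (hπ : π.IsRegular Mg Mh) (hMg : 0 ≤ Mg)
    (s : AlgState d) :
    ∫ x, ‖π.weight x.2 s.cur (s.query x.1) • M.pgt π x.2 s.cur‖ ∂(M.drawLaw π H s)
      ≤ Mg * M.R / (1 - M.γ) ^ 2 := by
  have h1 := M.integral_weight (H := H) hπ hMg s
  calc _ ≤ ∫ x, π.weight x.2 s.cur (s.query x.1) * (Mg * M.R / (1 - M.γ) ^ 2)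
        ∂(M.drawLaw π H s) := by
        refine integral_mono_of_nonneg (ae_of_all _ fun _ => norm_nonneg _) ?_
          (ae_of_all _ fun x => ?_)
        · exact (Integrable.of_integral_ne_zero (by rw [h1]; exact one_ne_zero)).mul_const _
        · beta_reduce
          rw [norm_smul, Real.norm_of_nonneg (π.weight_pos _ _ _).le]
          exact mul_le_mul_of_nonneg_left (M.norm_pgt_le hπ hMg _ _) (π.weight_pos _ _ _).le
    _ = _ := by rw [integral_mul_const, h1, one_mul]

lemma measurable_hessVec_query (M : MDP S A) (hπ : π.IsRegular Mg Mh) (s : AlgState d) :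
    Measurable (fun x : Draw S A H => M.hessVec π x.2 (s.query x.1) (s.cur - s.prev)) :=
  (M.measurable_hessVec hπ).comp
    (f := fun x : Draw S A H => ((s.query x.1, s.cur - s.prev), x.2))
    (((s.measurable_query.comp measurable_fst).prodMk measurable_const).prodMk measurable_snd)

/-- Averaged over the segment from `s.prev` to `s.cur`, the Hessian estimator is an unbiased
estimator of the difference of the gradients: for every trajectory `τ` it integrates the derivative
of `θ ↦ p(τ | θ) g(τ | θ)` along the segment. -/
lemma integral_hessVec (M : MDP S A) (hπ : π.IsRegular Mg Mh) (hMg : 0 ≤ Mg) (hMh : 0 ≤ Mh)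
    (s : AlgState d) :
    ∫ x, M.hessVec π x.2 (s.query x.1) (s.cur - s.prev) ∂(M.drawLaw π H s)
      = gradient (M.perf π H) s.cur - gradient (M.perf π H) s.prev := by
  set v := s.cur - s.prev with hv
  have hmeas := M.measurable_hessVec_query (H := H) hπ s
  rw [← hv] at hmeas
  have hbd := fun (τ : Traj S A H) θ => M.norm_hessVec_le hπ hMg hMh τ θ v
  set B := (H * Mg * (Mg * M.R / (1 - M.γ) ^ 2) + Mh * M.R / (1 - M.γ) ^ 2) * ‖v‖
  have hB : 0 ≤ B := by
    have := M.R_pos.le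
    positivity
  rw [M.integral_drawLaw hπ s (M.integrable_drawLaw hπ s hmeas (K := B) fun x _ => hbd _ _)]
  simp_rw [M.integral_trajLaw π]
  have hbd2 : ∀ (α : ℝ) (τ : Traj S A H), α ∈ Set.Icc (0 : ℝ) 1 →
      ‖π.lik τ (s.query α) • M.hessVec π τ (s.query α) v‖
        ≤ Real.exp (H * Mg * ‖v‖) * B * π.lik τ s.prev := by
    intro α τ hα
    rw [norm_smul, Real.norm_of_nonneg (π.lik_pos _ _).le, mul_right_comm]
    refine mul_le_mul ((hπ.lik_le τ _ s.prev).trans ?_) (hbd τ _) (norm_nonneg _) ?_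
    · refine mul_le_mul_of_nonneg_right (Real.exp_le_exp.2 ?_) (π.lik_pos _ _).le
      refine mul_le_mul_of_nonneg_left ?_ (by positivity)
      rw [s.query_eq, add_sub_cancel_left, norm_smul, Real.norm_of_nonneg hα.1]
      exact mul_le_of_le_one_left (norm_nonneg _) hα.2
    · have := π.lik_pos τ s.prev
      positivity
  have hm2 : Measurable (fun x : Draw S A H => π.lik x.2 (s.query x.1) •
      M.hessVec π x.2 (s.query x.1) v) := (measurable_lik_query hπ s).smul hmeas
  rw [integral_integral_swap]
  · have key : ∀ τ : Traj S A H, ∫ α in Set.Icc (0 : ℝ) 1,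
        π.lik τ (s.query α) • M.hessVec π τ (s.query α) v
          = π.lik τ s.cur • M.pgt π τ s.cur - π.lik τ s.prev • M.pgt π τ s.prev := by
      intro τ
      have hi : IntegrableOn (fun α => π.lik τ (s.query α) • M.hessVec π τ (s.query α) v)
          (Set.Icc (0 : ℝ) 1) := by
        refine Measure.integrableOn_of_bounded (M := Real.exp (H * Mg * ‖v‖) * B * π.lik τ s.prev)
          (by simp) (hm2.comp measurable_prodMk_right).aestronglyMeasurable ?_
        filter_upwards [ae_restrict_mem measurableSet_Icc] with α hα using hbd2 α τ hα
      have ftc := intervalIntegral.integral_eq_sub_of_hasDerivAt (a := 0) (b := 1)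
        (fun t _ => M.hasDerivAt_lik_smul_pgt hπ τ s.prev v t)
        (by
          rw [intervalIntegrable_iff_integrableOn_Icc_of_le zero_le_one]
          simpa only [s.query_eq] using hi)
      rw [intervalIntegral.integral_of_le zero_le_one, ← integral_Icc_eq_integral_Ioc] at ftc
      simp only [s.query_eq]
      rw [ftc]
      simp [hv]
    have hg : ∀ θ, Integrable (fun τ : Traj S A H => π.lik τ θ • M.pgt π τ θ)
        (M.refMeasure π.ν H) := fun θ =>
      (M.integrable_lik π θ).smul_bdd _ (M.measurable_pgt_right hπ θ).aestronglyMeasurable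
        (ae_of_all _ fun τ => M.norm_pgt_le hπ hMg τ θ)
    simp_rw [key]
    rw [integral_sub (hg _) (hg _), M.gradient_perf hπ hMg, M.gradient_perf hπ hMg,
      M.integral_trajLaw π, M.integral_trajLaw π]
  · have hi := (integrable_const (μ := volume.restrict (Set.Icc (0 : ℝ) 1))
      (Real.exp (H * Mg * ‖v‖) * B)).mul_prod (M.integrable_lik (H := H) π s.prev)
    refine hi.mono' hm2.aestronglyMeasurable ?_
    have hmem : ∀ᵐ x ∂((volume.restrict (Set.Icc (0 : ℝ) 1)).prod (M.refMeasure π.ν H)),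
        x.1 ∈ Set.Icc (0 : ℝ) 1 :=
      Measure.quasiMeasurePreserving_fst.ae (ae_restrict_mem measurableSet_Icc)
    filter_upwards [hmem] with x hx using hbd2 _ _ hx

lemma norm_gradient_perf_sub_le (M : MDP S A) (hπ : π.IsRegular Mg Mh) (hMg : 0 ≤ Mg)
    (hMh : 0 ≤ Mh) (x y : EuclideanSpace ℝ (Fin d)) :
    ‖gradient (M.perf π H) y - gradient (M.perf π H) x‖
      ≤ (H * Mg * (Mg * M.R / (1 - M.γ) ^ 2) + Mh * M.R / (1 - M.γ) ^ 2) * ‖y - x‖ := by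
  have h := M.integral_hessVec (H := H) hπ hMg hMh ⟨x, y, 0, 0⟩
  have := M.isProbabilityMeasure_drawLaw (H := H) hπ (⟨x, y, 0, 0⟩ : AlgState d)
  rw [← h]
  simpa using norm_integral_le_of_norm_le_const (μ := M.drawLaw π H ⟨x, y, 0, 0⟩)
    (ae_of_all _ fun z => M.norm_hessVec_le hπ hMg hMh z.2 _ (y - x))

/-- A lower bound for the performance after a step, from the Lipschitz bound on its gradient. -/
lemma perf_sub_ge (M : MDP S A) (hπ : π.IsRegular Mg Mh) (hMg : 0 ≤ Mg)
    (hMh : 0 ≤ Mh) (x y : EuclideanSpace ℝ (Fin d)) :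
    inner ℝ (gradient (M.perf π H) x) (y - x)
      - (H * Mg * (Mg * M.R / (1 - M.γ) ^ 2) + Mh * M.R / (1 - M.γ) ^ 2) * ‖y - x‖ ^ 2
      ≤ M.perf π H y - M.perf π H x := by
  have hR := M.R_pos.le
  set B := H * Mg * (Mg * M.R / (1 - M.γ) ^ 2) + Mh * M.R / (1 - M.γ) ^ 2
  have hB : 0 ≤ B := by positivity
  have h := (convex_segment (𝕜 := ℝ) x y).norm_image_sub_le_of_norm_hasFDerivWithin_le'
    (f := M.perf π H) (C := B * ‖y - x‖) (x := x) (y := y)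
    (φ := innerSL ℝ (gradient (M.perf π H) x))
    (f' := fun z => innerSL ℝ (gradient (M.perf π H) z))
    (fun z _ => by
      have := M.hasGradientAt_perf (H := H) hπ hMg z
      rw [← this.gradient] at this
      exact this.hasFDerivAt.hasFDerivWithinAt)
    (fun z hz => by
      rw [← map_sub, innerSL_apply_norm]
      refine (M.norm_gradient_perf_sub_le hπ hMg hMh x z).trans
        (mul_le_mul_of_nonneg_left ?_ hB)
      obtain ⟨t, ht, rfl⟩ := segment_eq_image' ℝ x y ▸ hz
      rw [add_sub_cancel_left, norm_smul, Real.norm_of_nonneg ht.1]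
      exact mul_le_of_le_one_left (norm_nonneg _) ht.2)
    (left_mem_segment ℝ x y) (right_mem_segment ℝ x y)
  rw [innerSL_apply_apply, Real.norm_eq_abs] at h
  nlinarith [(abs_le.1 h).1]

lemma perf_sub_ge_of_gradient_le (M : MDP S A) (hπ : π.IsRegular Mg Mh) (hMg : 0 ≤ Mg)
    (x y : EuclideanSpace ℝ (Fin d)) :
    -(Mg * M.R / (1 - M.γ) ^ 2 * ‖y - x‖) ≤ M.perf π H y - M.perf π H x := by
  have h := (convex_univ (𝕜 := ℝ)
      (E := EuclideanSpace ℝ (Fin d))).norm_image_sub_le_of_norm_hasFDerivWithin_le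
    (f := M.perf π H) (C := Mg * M.R / (1 - M.γ) ^ 2) (x := x) (y := y)
    (f' := fun z => innerSL ℝ (gradient (M.perf π H) z))
    (fun z _ => by
      have := M.hasGradientAt_perf (H := H) hπ hMg z
      rw [← this.gradient] at this
      exact this.hasFDerivAt.hasFDerivWithinAt)
    (fun z _ => by
      rw [innerSL_apply_norm]
      exact M.norm_gradient_perf_le hπ hMg z) trivial trivial
  exact (abs_le.1 h).1

end MDP

/-! ### The Huber function -/

/-- The Huber function of a nonnegative number: quadratic up to `ρ` and linear with slope `2ρ`
beyond. -/
def huber (ρ t : ℝ) : ℝ := if t ≤ ρ then t ^ 2 else 2 * ρ * t - ρ ^ 2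

lemma huber_nonneg {ρ t : ℝ} (hρ : 0 ≤ ρ) : 0 ≤ huber ρ t := by
  unfold huber
  split_ifs with h
  · positivity
  · nlinarith

lemma huber_le_sq (ρ t : ℝ) : huber ρ t ≤ t ^ 2 := by
  unfold huber
  split_ifs with h
  · exact le_rfl
  · nlinarith [sq_nonneg (t - ρ)]

/-- The Huber function is the lower envelope of a family of quadratic functions. -/
lemma huber_le_quadratic {ρ r t : ℝ} (hρ : 0 ≤ ρ) (hr : ρ ≤ r) (hr0 : 0 < r) (ht : 0 ≤ t) :
    huber ρ t ≤ ρ / r * t ^ 2 + ρ * r - ρ ^ 2 := by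
  have e : ρ / r * t ^ 2 + ρ * r - ρ ^ 2
      = (2 * ρ * t - ρ ^ 2) + ρ / r * (t - r) ^ 2 := by field_simp; ring
  unfold huber
  split_ifs with h
  · have e2 : ρ / r * t ^ 2 + ρ * r - ρ ^ 2 - t ^ 2 = (r - ρ) * (ρ * r - t ^ 2) / r := by
      field_simp; ring
    have : 0 ≤ (r - ρ) * (ρ * r - t ^ 2) / r := by
      refine div_nonneg (mul_nonneg (sub_nonneg.2 hr) ?_) hr0.le
      nlinarith
    linarith
  · rw [e]
    have : 0 ≤ ρ / r * (t - r) ^ 2 := by positivity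
    linarith

lemma huber_add_le {ρ s t : ℝ} (ht : 0 ≤ t) :
    huber ρ (s + t) ≤ huber ρ s + 2 * ρ * t := by
  unfold huber
  split_ifs with h1 h2 h2
  · nlinarith
  · linarith
  · nlinarith [sq_nonneg (s - ρ)]
  · nlinarith

lemma huber_mono {ρ s t : ℝ} (hρ : 0 ≤ ρ) (hs : 0 ≤ s) (hst : s ≤ t) :
    huber ρ s ≤ huber ρ t := by
  unfold huber
  split_ifs with h1 h2 h2
  · nlinarith
  · nlinarith [sq_nonneg (s - ρ)]
  · linarith
  · nlinarith

lemma measurable_huber (ρ : ℝ) : Measurable (huber ρ) :=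
  Measurable.ite measurableSet_Iic (by fun_prop) (by fun_prop)

/-! ### The adaptive step size -/

/-- The relations between the constants of the algorithm (`k`, `m`, `c`), a bound `G` on the
gradient estimators, and a smoothness constant `L`. -/
structure StepParams (G L k c m : ℝ) : Prop where
  G_pos : 0 < G
  L_pos : 0 < L
  k_pos : 0 < k
  c_eq : c = G ^ 2 / (3 * k ^ 3 * L) + 52 * L ^ 2
  sq_le : 2 * G ^ 2 ≤ m
  cube_le : (c * k / (2 * L)) ^ 3 ≤ m

namespace StepParams

variable {G L k c m : ℝ}

lemma le_c (h : StepParams G L k c m) : 52 * L ^ 2 ≤ c := by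
  have := h.G_pos; have := h.L_pos; have := h.k_pos
  rw [h.c_eq]
  have : 0 ≤ G ^ 2 / (3 * k ^ 3 * L) := by positivity
  linarith

lemma c_pos (h : StepParams G L k c m) : 0 < c := by
  have := h.L_pos
  exact lt_of_lt_of_le (by positivity) h.le_c

lemma sq_le_c (h : StepParams G L k c m) : G ^ 2 ≤ c * (3 * k ^ 3 * L) := by
  have := h.L_pos; have := h.k_pos
  rw [h.c_eq, add_mul, div_mul_cancel₀ _ (by positivity)]
  have : 0 ≤ 52 * L ^ 2 * (3 * k ^ 3 * L) := by positivity
  linarith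

lemma m_pos (h : StepParams G L k c m) : 0 < m := by
  have := h.G_pos
  exact lt_of_lt_of_le (by positivity) h.sq_le

lemma stepSize_pos (h : StepParams G L k c m) {x : ℝ} (hx : 0 ≤ x) : 0 < stepSize k m x := by
  have := h.m_pos
  exact div_pos h.k_pos (Real.rpow_pos_of_pos (by linarith) _)

lemma stepSize_cube (h : StepParams G L k c m) {x : ℝ} (hx : 0 ≤ x) :
    stepSize k m x ^ 3 = k ^ 3 / (m + x) := by
  have := h.m_pos
  rw [stepSize, div_pow, ← Real.rpow_natCast (_ ^ _), ← Real.rpow_mul (by linarith)]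
  norm_num

lemma stepSize_anti (h : StepParams G L k c m) {x y : ℝ} (hx : 0 ≤ x) (hxy : x ≤ y) :
    stepSize k m y ≤ stepSize k m x := by
  have := h.m_pos
  have := h.k_pos
  refine div_le_div_of_nonneg_left this.le (Real.rpow_pos_of_pos (by linarith) _) ?_
  exact Real.rpow_le_rpow (by linarith) (by linarith) (by norm_num)

lemma c_mul_stepSize_le (h : StepParams G L k c m) {x : ℝ} (hx : 0 ≤ x) :
    c * stepSize k m x ≤ 2 * L := by
  have hL := h.L_pos
  have hk := h.k_pos
  have hc := h.c_pos
  have h1 : c * k / (2 * L) ≤ (m + x) ^ ((1 : ℝ) / 3) := by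
    have : c * k / (2 * L) = ((c * k / (2 * L)) ^ 3) ^ ((1 : ℝ) / 3) := by
      rw [← Real.rpow_natCast, ← Real.rpow_mul (by positivity)]
      norm_num
    rw [this]
    exact Real.rpow_le_rpow (by positivity) (h.cube_le.trans (by linarith)) (by norm_num)
  have h2 : 0 < (m + x) ^ ((1 : ℝ) / 3) := Real.rpow_pos_of_pos (by linarith [h.m_pos]) _
  rw [stepSize, mul_div_assoc', div_le_iff₀ h2]
  rw [div_le_iff₀ (by positivity)] at h1
  linarith

lemma L_mul_stepSize_le (h : StepParams G L k c m) {x : ℝ} (hx : 0 ≤ x) :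
    L * stepSize k m x ≤ 1 / 26 := by
  have hL := h.L_pos
  have h1 := h.c_mul_stepSize_le hx
  have h2 := mul_le_mul_of_nonneg_right h.le_c (h.stepSize_pos hx).le
  have h3 : (52 * L) * (L * stepSize k m x) ≤ (52 * L) * (1 / 26) := by nlinarith
  exact le_of_mul_le_mul_left h3 (by positivity)

lemma beta_le (h : StepParams G L k c m) {x : ℝ} (hx : 0 ≤ x) :
    c * stepSize k m x ^ 2 ≤ 1 / 13 := by
  have h1 := mul_le_mul_of_nonneg_right (h.c_mul_stepSize_le hx) (h.stepSize_pos hx).le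
  have h2 := h.L_mul_stepSize_le hx
  nlinarith

lemma beta_nonneg (h : StepParams G L k c m) (x : ℝ) : 0 ≤ c * stepSize k m x ^ 2 := by
  have := h.c_pos
  positivity

/-- The inverse step size grows slowly; the first summand of `c` is made for this. -/
lemma inv_stepSize_sub_le (h : StepParams G L k c m) {x y : ℝ} (hx : 0 ≤ x) (hy : 0 ≤ y)
    (hyG : y ≤ G ^ 2) :
    1 / stepSize k m (x + y) - c / 16 * stepSize k m (x + y) ≤ 1 / stepSize k m x := by
  have hL := h.L_pos
  have hk := h.k_pos
  have hc := h.c_pos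
  have hm := h.m_pos
  have hp := h.stepSize_pos hx
  have hp' := h.stepSize_pos (add_nonneg hx hy)
  have e := h.stepSize_cube hx
  have e' := h.stepSize_cube (add_nonneg hx hy)
  have hle := h.stepSize_anti hx (le_add_of_nonneg_right hy)
  have hL1 := h.L_mul_stepSize_le hx
  set a := stepSize k m x
  set b := stepSize k m (x + y)
  -- `a³ - b³ = a³ b³ y / k³`, in terms of the step sizes `b ≤ a`
  have e1 : (a ^ 3 - b ^ 3) * k ^ 3 = a ^ 3 * b ^ 3 * y := by
    have h1 : 0 < m + x := by linarith
    have h2 : 0 < m + (x + y) := by linarith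
    rw [e, e']
    field_simp
    ring
  -- `a³ ≤ 3/2 b³`, since `m ≥ 2 G²`
  have e2 : a ^ 3 ≤ 3 / 2 * b ^ 3 := by
    have h1 : 0 < m + x := by linarith
    have h2 : 0 < m + (x + y) := by linarith
    rw [e, e', div_le_iff₀ h1, mul_div_assoc', div_mul_eq_mul_div, le_div_iff₀ h2]
    have : m + (x + y) ≤ 3 / 2 * (m + x) := by linarith [h.sq_le]
    nlinarith [pow_pos hk 3]
  have e3 : a ^ 3 * b ^ 3 * y ≤ a ^ 3 * b ^ 3 * (c * (3 * k ^ 3 * L)) :=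
    mul_le_mul_of_nonneg_left (hyG.trans h.sq_le_c) (by positivity)
  have e4 : a ^ 3 - b ^ 3 ≤ 3 * c * L * (a ^ 3 * b ^ 3) := by
    refine le_of_mul_le_mul_right (a := k ^ 3) ?_ (by positivity)
    rw [e1]
    linarith
  have e5 : 3 * b ^ 2 * (a - b) ≤ a ^ 3 - b ^ 3 := by
    nlinarith [mul_nonneg (sub_nonneg.2 hle) (mul_nonneg hp'.le (sub_nonneg.2 hle)),
      mul_nonneg (sub_nonneg.2 hle) (mul_nonneg hp.le (sub_nonneg.2 hle))]
  have e6 : L * a ^ 3 ≤ 1 / 26 * a ^ 2 := by nlinarith [sq_nonneg a]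
  have e7 : a - b ≤ c * (1 / 26) * (a ^ 2 * b) := by
    have h1 : 3 * b ^ 2 * (a - b) ≤ 3 * b ^ 2 * (c * (1 / 26) * (a ^ 2 * b)) := by
      calc _ ≤ 3 * c * L * (a ^ 3 * b ^ 3) := e5.trans e4
        _ = 3 * c * b ^ 3 * (L * a ^ 3) := by ring
        _ ≤ 3 * c * b ^ 3 * (1 / 26 * a ^ 2) := mul_le_mul_of_nonneg_left e6 (by positivity)
        _ = _ := by ring
    exact le_of_mul_le_mul_left h1 (by positivity)
  have e8 : a ≤ 3 / 2 * b := by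
    by_contra hcon
    push Not at hcon
    have : (3 / 2 * b) ^ 3 < a ^ 3 := by gcongr
    nlinarith [pow_pos hp' 3]
  have e9 : 1 / b - 1 / a = (a - b) / (a * b) := by field_simp
  have e10 : (a - b) / (a * b) ≤ c / 16 * b := by
    rw [div_le_iff₀ (by positivity)]
    have : c * (1 / 26) * (a ^ 2 * b) ≤ c / 16 * b * (a * b) := by
      have : c * a * b * (a / 26) ≤ c * a * b * (b / 16) :=
        mul_le_mul_of_nonneg_left (by linarith) (by positivity)
      linarith
    exact e7.trans this
  linarith

/-- The logarithmic potential pays for the squared gradient estimators. -/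
lemma stepSize_cube_mul_le (h : StepParams G L k c m) {x y : ℝ} (hx : 0 ≤ x) (hy : 0 ≤ y)
    (hyG : y ≤ G ^ 2) :
    stepSize k m x ^ 3 * y ≤ k ^ 3 * (Real.log (G ^ 2 + (x + y)) - Real.log (G ^ 2 + x)) := by
  have hG := h.G_pos
  have hk := h.k_pos
  have hm := h.m_pos
  have h1 : 0 < G ^ 2 + x := by positivity
  have h2 : 0 < G ^ 2 + (x + y) := by positivity
  rw [h.stepSize_cube hx, ← Real.log_div h2.ne' h1.ne', div_mul_eq_mul_div, mul_div_assoc]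
  refine mul_le_mul_of_nonneg_left ?_ (by positivity)
  refine le_trans ?_ (Real.one_sub_inv_le_log_of_pos (div_pos h2 h1))
  rw [inv_div, one_sub_div h2.ne']
  have : G ^ 2 + (x + y) - (G ^ 2 + x) = y := by ring
  rw [this]
  exact div_le_div_of_nonneg_left hy h2 (by linarith [h.sq_le])

end StepParams

/-- The bound for the squared importance weights over a short step. -/
lemma exp_eight_thirteenths_le : Real.exp (8 / 13) ≤ 13 / 7 := by
  have h : Real.exp (8 / 13) ^ 13 ≤ (13 / 7 : ℝ) ^ 13 := by
    rw [← Real.exp_nat_mul]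
    have e : ((13 : ℕ) : ℝ) * (8 / 13) = ((8 : ℕ) : ℝ) * 1 := by norm_num
    rw [e, Real.exp_nat_mul]
    calc Real.exp 1 ^ 8 ≤ 2.7182818286 ^ 8 := by gcongr; exact Real.exp_one_lt_d9.le
      _ ≤ _ := by norm_num
  exact le_of_pow_le_pow_left₀ (by norm_num) (by norm_num) h

/-- A second-moment bound for a centred random vector shifted by a constant. -/
lemma integral_norm_add_sub_integral_sq_le {Ω E : Type*} [MeasurableSpace Ω] {μ : Measure Ω}
    [IsProbabilityMeasure μ] [NormedAddCommGroup E] [InnerProductSpace ℝ E] [CompleteSpace E]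
    {X : Ω → E} (hX : Integrable X μ) (hX2 : Integrable (fun ω => ‖X ω‖ ^ 2) μ) (a : E) :
    ∫ ω, ‖a + (X ω - ∫ ω, X ω ∂μ)‖ ^ 2 ∂μ ≤ ‖a‖ ^ 2 + ∫ ω, ‖X ω‖ ^ 2 ∂μ := by
  set z := ∫ ω, X ω ∂μ with hz
  have e : ∀ ω, ‖a + (X ω - z)‖ ^ 2
      = ‖a - z‖ ^ 2 + 2 * inner ℝ (a - z) (X ω) + ‖X ω‖ ^ 2 := by
    intro ω
    rw [← norm_add_sq_real]
    congr 2
    abel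
  have hi : Integrable (fun ω => 2 * inner ℝ (a - z) (X ω)) μ :=
    (hX.const_inner (a - z)).const_mul 2
  have hi' : Integrable (fun ω => ‖a - z‖ ^ 2 + 2 * inner ℝ (a - z) (X ω)) μ :=
    (integrable_const _).add hi
  simp_rw [e]
  rw [integral_add hi' hX2, integral_add (integrable_const _) hi,
    integral_const_mul, integral_inner hX, ← hz, integral_const, probReal_univ, one_smul]
  have e2 : ‖a - z‖ ^ 2 + 2 * inner ℝ (a - z) z + ‖z‖ ^ 2 = ‖a‖ ^ 2 := by
    rw [← norm_add_sq_real, sub_add_cancel]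
  nlinarith [sq_nonneg ‖z‖]

/-! ### Measurability of the iteration -/

/-- The product σ-algebra on the states of the algorithm. -/
instance AlgState.instMeasurableSpace (d : ℕ) : MeasurableSpace (AlgState d) :=
  MeasurableSpace.comap (fun s => (s.prev, s.cur, s.u, s.gsq)) inferInstance

namespace AlgState

variable {d : ℕ}

lemma measurable_toProd :
    Measurable (fun s : AlgState d => (s.prev, s.cur, s.u, s.gsq)) := comap_measurable _

@[fun_prop]
lemma measurable_prev : Measurable (AlgState.prev (d := d)) := measurable_toProd.fst

@[fun_prop]
lemma measurable_cur : Measurable (AlgState.cur (d := d)) := measurable_toProd.snd.fst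

@[fun_prop]
lemma measurable_u : Measurable (AlgState.u (d := d)) := measurable_toProd.snd.snd.fst

@[fun_prop]
lemma measurable_gsq : Measurable (AlgState.gsq (d := d)) := measurable_toProd.snd.snd.snd

lemma measurable_mk {X : Type*} [MeasurableSpace X] {f : X → AlgState d}
    (h1 : Measurable (fun x => (f x).prev)) (h2 : Measurable (fun x => (f x).cur))
    (h3 : Measurable (fun x => (f x).u)) (h4 : Measurable (fun x => (f x).gsq)) :
    Measurable f :=
  measurable_comap_iff.2 (h1.prodMk (h2.prodMk (h3.prodMk h4)))

end AlgState

lemma measurable_stepSize (k m : ℝ) : Measurable (stepSize k m) := by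
  unfold stepSize
  fun_prop

namespace MDP

variable {S A : Type*} [MeasurableSpace S] [MeasurableSpace A] {d H : ℕ}
  {π : ParamPolicy (EuclideanSpace ℝ (Fin d)) S A} {Mg Mh : ℝ}

lemma measurable_query_prod : Measurable (fun p : AlgState d × Draw S A H => p.1.query p.2.1) := by
  unfold AlgState.query
  fun_prop

lemma measurable_lik_query_prod (hπ : π.IsRegular Mg Mh) :
    Measurable (fun p : AlgState d × Draw S A H => π.lik p.2.2 (p.1.query p.2.1)) :=
  hπ.measurable_lik.comp
    (f := fun p : AlgState d × Draw S A H => (p.1.query p.2.1, p.2.2))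
    (measurable_query_prod.prodMk (by fun_prop))

lemma measurable_pgt_cur (M : MDP S A) (hπ : π.IsRegular Mg Mh) :
    Measurable (fun p : AlgState d × Draw S A H => M.pgt π p.2.2 p.1.cur) :=
  (M.measurable_pgt hπ).comp (f := fun p : AlgState d × Draw S A H => (p.1.cur, p.2.2))
    (by fun_prop)

lemma measurable_pgt_query (M : MDP S A) (hπ : π.IsRegular Mg Mh) :
    Measurable (fun p : AlgState d × Draw S A H => M.pgt π p.2.2 (p.1.query p.2.1)) :=
  (M.measurable_pgt hπ).comp (f := fun p : AlgState d × Draw S A H => (p.1.query p.2.1, p.2.2))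
    (measurable_query_prod.prodMk (by fun_prop))

lemma measurable_estimator (M : MDP S A) (hπ : π.IsRegular Mg Mh) (k m c : ℝ) (n : ℕ) :
    Measurable (fun p : AlgState d × Draw S A H => M.estimator π k m c n p.1 p.2) := by
  unfold estimator
  split_ifs with h
  · exact M.measurable_pgt_cur hπ
  have hη : Measurable (fun p : AlgState d × Draw S A H => stepSize k m p.1.gsq) :=
    (measurable_stepSize k m).comp (by fun_prop)
  have hw : Measurable (fun p : AlgState d × Draw S A H =>
      π.weight p.2.2 p.1.cur (p.1.query p.2.1)) := by
    simp_rw [π.weight_eq_div]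
    exact (hπ.measurable_lik.comp (f := fun p : AlgState d × Draw S A H => (p.1.cur, p.2.2))
      (by fun_prop)).div (measurable_lik_query_prod hπ)
  have hh : Measurable (fun p : AlgState d × Draw S A H =>
      M.hessVec π p.2.2 (p.1.query p.2.1) (p.1.cur - p.1.prev)) :=
    (M.measurable_hessVec hπ).comp (f := fun p : AlgState d × Draw S A H =>
      ((p.1.query p.2.1, p.1.cur - p.1.prev), p.2.2))
      ((measurable_query_prod.prodMk (by fun_prop)).prodMk (by fun_prop))
  have hu : Measurable (fun p : AlgState d × Draw S A H => p.1.u) := by fun_prop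
  exact (((hη.pow_const 2).const_mul c |>.mul hw).smul (M.measurable_pgt_cur hπ)).add
    ((((hη.pow_const 2).const_mul c).const_sub 1).smul (hu.add hh))

lemma measurable_step (M : MDP S A) (hπ : π.IsRegular Mg Mh) (k m c : ℝ) (n : ℕ) :
    Measurable (fun p : AlgState d × Draw S A H => M.step π k m c n p.1 p.2) := by
  have hg : Measurable (fun p : AlgState d × Draw S A H =>
      p.1.gsq + ‖M.pgt π p.2.2 p.1.cur‖ ^ 2) := by
    have := (M.measurable_pgt_cur (H := H) hπ).norm.pow_const 2
    have h2 : Measurable (fun p : AlgState d × Draw S A H => p.1.gsq) := by fun_prop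
    exact h2.add this
  have hu := M.measurable_estimator (H := H) hπ k m c n
  have hc : Measurable (fun p : AlgState d × Draw S A H => p.1.cur) := by fun_prop
  exact AlgState.measurable_mk hc
    (hc.add (((measurable_stepSize k m).comp hg).smul hu)) hu hg

lemma measurable_state (M : MDP S A) (hπ : π.IsRegular Mg Mh) (k m c : ℝ)
    (θ₁ : EuclideanSpace ℝ (Fin d)) (n : ℕ) :
    Measurable (M.state π k m c θ₁ n : (Fin n → Draw S A H) → AlgState d) := by
  induction n with
  | zero =>
    change Measurable (fun _ : Fin 0 → Draw S A H => AlgState.start θ₁)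
    exact measurable_const
  | succ n ih =>
    exact (M.measurable_step hπ k m c n).comp
      (f := fun ξ : Fin (n + 1) → Draw S A H =>
        (M.state π k m c θ₁ n (fun i => ξ i.castSucc), ξ (Fin.last n)))
      ((ih.comp (by fun_prop)).prodMk (by fun_prop))

lemma measurable_gradient_perf (M : MDP S A) (hπ : π.IsRegular Mg Mh) (hMg : 0 ≤ Mg) :
    Measurable (gradient (M.perf π H)) := by
  refine (measurable_gradient_param (X := Unit) (f := fun θ _ => M.perf π H θ) ?_ ?_).comp
    (f := fun θ => (θ, ())) (by fun_prop)
  · have : Continuous (M.perf π H) := continuous_iff_continuousAt.2 fun θ =>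
      (M.hasGradientAt_perf hπ hMg θ).differentiableAt.continuousAt
    exact this.measurable.comp measurable_fst
  · exact fun _ θ => (M.hasGradientAt_perf hπ hMg θ).differentiableAt

lemma measurable_perf (M : MDP S A) (hπ : π.IsRegular Mg Mh) (hMg : 0 ≤ Mg) :
    Measurable (M.perf π H) := by
  have : Continuous (M.perf π H) := continuous_iff_continuousAt.2 fun θ =>
    (M.hasGradientAt_perf hπ hMg θ).differentiableAt.continuousAt
  exact this.measurable

/-! ### The tracking error after one iteration -/

/-- The assumptions on the problem together with the relations between the constants, as they are
used in the analysis of one iteration. -/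
structure Admissible (M : MDP S A) (π : ParamPolicy (EuclideanSpace ℝ (Fin d)) S A) (H : ℕ)
    (Mg Mh G L k c m : ℝ) : Prop extends StepParams G L k c m where
  regular : π.IsRegular Mg Mh
  Mg_nonneg : 0 ≤ Mg
  Mh_nonneg : 0 ≤ Mh
  G_eq : G = Mg * M.R / (1 - M.γ) ^ 2
  score_mul_le : H * Mg * G ≤ L
  hess_le : Mh * M.R / (1 - M.γ) ^ 2 ≤ L
  hess_sq_le : (H * Mg * G + Mh * M.R / (1 - M.γ) ^ 2) ^ 2 ≤ 2 * L ^ 2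

/-- The error `u - ∇J(prev)` of the momentum estimator as an estimator of the gradient at the
parameter at which it was formed. -/
def trackErr (M : MDP S A) (π : ParamPolicy (EuclideanSpace ℝ (Fin d)) S A) (H : ℕ)
    (s : AlgState d) : EuclideanSpace ℝ (Fin d) := s.u - gradient (M.perf π H) s.prev

variable {M : MDP S A} {G L k c m : ℝ}

namespace Admissible

lemma norm_pgt_le (h : M.Admissible π H Mg Mh G L k c m) (τ : Traj S A H)
    (θ : EuclideanSpace ℝ (Fin d)) : ‖M.pgt π τ θ‖ ≤ G :=
  h.G_eq ▸ M.norm_pgt_le h.regular h.Mg_nonneg τ θ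

lemma norm_gradient_le (h : M.Admissible π H Mg Mh G L k c m)
    (θ : EuclideanSpace ℝ (Fin d)) : ‖gradient (M.perf π H) θ‖ ≤ G :=
  h.G_eq ▸ M.norm_gradient_perf_le h.regular h.Mg_nonneg θ

lemma norm_hessVec_le (h : M.Admissible π H Mg Mh G L k c m) (τ : Traj S A H)
    (θ v : EuclideanSpace ℝ (Fin d)) :
    ‖M.hessVec π τ θ v‖ ≤ (H * Mg * G + Mh * M.R / (1 - M.γ) ^ 2) * ‖v‖ :=
  h.G_eq ▸ M.norm_hessVec_le h.regular h.Mg_nonneg h.Mh_nonneg τ θ v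

lemma norm_hessVec_sq_le (h : M.Admissible π H Mg Mh G L k c m) (τ : Traj S A H)
    (θ v : EuclideanSpace ℝ (Fin d)) : ‖M.hessVec π τ θ v‖ ^ 2 ≤ 2 * L ^ 2 * ‖v‖ ^ 2 := by
  refine (pow_le_pow_left₀ (norm_nonneg _) (h.norm_hessVec_le τ θ v) 2).trans ?_
  rw [mul_pow]
  exact mul_le_mul_of_nonneg_right h.hess_sq_le (sq_nonneg _)

lemma hess_le' (h : M.Admissible π H Mg Mh G L k c m) :
    H * Mg * G + Mh * M.R / (1 - M.γ) ^ 2 ≤ 3 / 2 * L :=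
  abs_le_of_sq_le_sq' (by nlinarith [h.hess_sq_le, sq_nonneg L]) (by linarith [h.L_pos]) |>.2

lemma estimator_eq (n : ℕ) (hn : n ≠ 0) (s : AlgState d) (x : Draw S A H) :
    M.estimator π k m c n s x
      = (c * stepSize k m s.gsq ^ 2) • π.weight x.2 s.cur (s.query x.1) • M.pgt π x.2 s.cur
        + (1 - c * stepSize k m s.gsq ^ 2) •
          (s.u + M.hessVec π x.2 (s.query x.1) (s.cur - s.prev)) := by
  rw [estimator, if_neg hn, smul_smul]

lemma integrable_weight_smul (h : M.Admissible π H Mg Mh G L k c m) (s : AlgState d) :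
    Integrable (fun x : Draw S A H =>
      π.weight x.2 s.cur (s.query x.1) • M.pgt π x.2 s.cur) (M.drawLaw π H s) := by
  refine M.integrable_drawLaw h.regular s ((measurable_weight_query h.regular s _).smul
    ((M.measurable_pgt_right h.regular _).comp measurable_snd))
    (K := Real.exp (H * Mg * ‖s.cur - s.prev‖) * G) fun x hx => ?_
  rw [norm_smul, Real.norm_of_nonneg (π.weight_pos _ _ _).le]
  exact mul_le_mul (weight_query_le h.regular h.Mg_nonneg s hx) (h.norm_pgt_le _ _)
    (norm_nonneg _) (Real.exp_pos _).le

lemma integrable_hessVec (h : M.Admissible π H Mg Mh G L k c m) (s : AlgState d) :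
    Integrable (fun x : Draw S A H =>
      M.hessVec π x.2 (s.query x.1) (s.cur - s.prev)) (M.drawLaw π H s) :=
  M.integrable_drawLaw h.regular s (M.measurable_hessVec_query h.regular s)
    fun _ _ => h.norm_hessVec_le _ _ _

lemma integrable_norm_hessVec_sq (h : M.Admissible π H Mg Mh G L k c m) (s : AlgState d) :
    Integrable (fun x : Draw S A H =>
      ‖M.hessVec π x.2 (s.query x.1) (s.cur - s.prev)‖ ^ 2) (M.drawLaw π H s) := by
  refine M.integrable_drawLaw h.regular s
    ((M.measurable_hessVec_query h.regular s).norm.pow_const 2)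
    (K := 2 * L ^ 2 * ‖s.cur - s.prev‖ ^ 2) fun x _ => ?_
  rw [Real.norm_of_nonneg (sq_nonneg _)]
  exact h.norm_hessVec_sq_le _ _ _

lemma integrable_norm_pgt_sq (h : M.Admissible π H Mg Mh G L k c m) (s : AlgState d) :
    Integrable (fun x : Draw S A H => ‖M.pgt π x.2 s.cur‖ ^ 2) (M.drawLaw π H s) := by
  refine M.integrable_drawLaw h.regular s
    (((M.measurable_pgt_right h.regular _).comp measurable_snd).norm.pow_const 2)
    (K := G ^ 2) fun x _ => ?_
  rw [Real.norm_of_nonneg (sq_nonneg _)]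
  exact pow_le_pow_left₀ (norm_nonneg _) (h.norm_pgt_le _ _) 2

/-- While the tracking error is moderate, the step is so short that the importance weights are
close to one, and the second moment of the error contracts. -/
lemma integral_trackErr_sq_le (h : M.Admissible π H Mg Mh G L k c m) {n : ℕ} (hn : n ≠ 0)
    {s : AlgState d} (hs : s.cur = s.prev + stepSize k m s.gsq • s.u) (hg : 0 ≤ s.gsq)
    (he : ‖M.trackErr π H s‖ ≤ 7 * G) :
    ∫ x, ‖M.trackErr π H (M.step π k m c n s x)‖ ^ 2 ∂(M.drawLaw π H s)
      ≤ (1 - c * stepSize k m s.gsq ^ 2) ^ 2 * ‖M.trackErr π H s‖ ^ 2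
        + 28 * L ^ 2 * (stepSize k m s.gsq ^ 2 * ‖s.u‖ ^ 2)
        + 2 * (c * stepSize k m s.gsq ^ 2) ^ 2
          * ∫ x, ‖M.pgt π x.2 s.cur‖ ^ 2 ∂(M.drawLaw π H s) := by
  have hπ := h.regular
  have hprob := M.isProbabilityMeasure_drawLaw (H := H) hπ s
  have hη := h.stepSize_pos hg
  have hLη := h.L_mul_stepSize_le hg
  have hβ0 := h.beta_nonneg s.gsq
  have hβ1 := h.beta_le hg
  have hG := h.G_pos
  set η := stepSize k m s.gsq
  set β := c * η ^ 2 with hβ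
  have hv : ‖s.cur - s.prev‖ = η * ‖s.u‖ := by
    rw [hs, add_sub_cancel_left, norm_smul, Real.norm_of_nonneg hη.le]
  have hu : ‖s.u‖ ≤ 8 * G := by
    have : s.u = M.trackErr π H s + gradient (M.perf π H) s.prev := by
      rw [trackErr, sub_add_cancel]
    rw [this]
    linarith [norm_add_le (M.trackErr π H s) (gradient (M.perf π H) s.prev),
      h.norm_gradient_le s.prev]
  have hw : ∀ x : Draw S A H, x.1 ∈ Set.Icc (0 : ℝ) 1 →
      π.weight x.2 s.cur (s.query x.1) ^ 2 ≤ 13 / 7 := by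
    intro x hx
    have h1 : H * Mg * ‖s.cur - s.prev‖ ≤ 4 / 13 := by
      have hM := h.Mg_nonneg
      calc H * Mg * ‖s.cur - s.prev‖ ≤ H * Mg * (η * (8 * G)) := by
            rw [hv]; gcongr
        _ = 8 * η * (H * Mg * G) := by ring
        _ ≤ 8 * η * L := mul_le_mul_of_nonneg_left h.score_mul_le (by positivity)
        _ ≤ 4 / 13 := by linarith
    have h2 := (weight_query_le hπ h.Mg_nonneg s hx).trans (Real.exp_le_exp.2 h1)
    calc _ ≤ Real.exp (4 / 13) ^ 2 := pow_le_pow_left₀ (π.weight_pos _ _ _).le h2 2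
      _ = Real.exp (8 / 13) := by rw [← Real.exp_nat_mul]; norm_num
      _ ≤ 13 / 7 := exp_eight_thirteenths_le
  let W : Draw S A H → EuclideanSpace ℝ (Fin d) := fun x =>
    π.weight x.2 s.cur (s.query x.1) • M.pgt π x.2 s.cur
  let D : Draw S A H → EuclideanSpace ℝ (Fin d) := fun x =>
    M.hessVec π x.2 (s.query x.1) (s.cur - s.prev)
  have iW : Integrable W (M.drawLaw π H s) := h.integrable_weight_smul s
  have iD : Integrable D (M.drawLaw π H s) := h.integrable_hessVec s
  have iD2 : Integrable (fun x => ‖D x‖ ^ 2) (M.drawLaw π H s) := h.integrable_norm_hessVec_sq s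
  have ig := h.integrable_norm_pgt_sq s
  let Z : Draw S A H → EuclideanSpace ℝ (Fin d) := fun x => β • W x + (1 - β) • D x
  have iZ : Integrable Z (M.drawLaw π H s) := (iW.smul β).add (iD.smul (1 - β))
  have eZ : ∫ x, Z x ∂(M.drawLaw π H s) = β • gradient (M.perf π H) s.cur
      + (1 - β) • (gradient (M.perf π H) s.cur - gradient (M.perf π H) s.prev) := by
    rw [← M.integral_hessVec hπ h.Mg_nonneg h.Mh_nonneg s,
      ← M.integral_weight_smul_pgt hπ h.Mg_nonneg s, ← integral_smul, ← integral_smul]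
    exact integral_add (iW.smul β) (iD.smul (1 - β))
  have step_eq : ∀ x, M.trackErr π H (M.step π k m c n s x)
      = (1 - β) • M.trackErr π H s + (Z x - ∫ x, Z x ∂(M.drawLaw π H s)) := by
    intro x
    rw [eZ]
    simp only [trackErr, step, estimator_eq n hn]
    simp only [Z, W, D, β, η]
    module
  -- `(a + b)² ≤ (14/13) a² + 14 b²` for the noise of the weighted gradient estimator and that of
  -- the Hessian estimator; the first weight times the bound `13/7` for `w²` is `2`
  have hZ2 : ∀ x : Draw S A H, x.1 ∈ Set.Icc (0 : ℝ) 1 →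
      ‖Z x‖ ^ 2 ≤ 2 * β ^ 2 * ‖M.pgt π x.2 s.cur‖ ^ 2 + 14 * ‖D x‖ ^ 2 := by
    intro x hx
    have h1 : ‖Z x‖ ≤ β * ‖W x‖ + ‖D x‖ := by
      refine (norm_add_le _ _).trans (add_le_add ?_ ?_)
      · rw [norm_smul, Real.norm_of_nonneg hβ0]
      · rw [norm_smul, Real.norm_of_nonneg (by linarith)]
        exact mul_le_of_le_one_left (norm_nonneg _) (by linarith)
    have h2 : ‖W x‖ ^ 2 ≤ 13 / 7 * ‖M.pgt π x.2 s.cur‖ ^ 2 := by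
      simp only [W]
      rw [norm_smul, mul_pow, Real.norm_eq_abs, sq_abs]
      exact mul_le_mul_of_nonneg_right (hw x hx) (sq_nonneg _)
    have h3 := pow_le_pow_left₀ (norm_nonneg _) h1 2
    have h4 := mul_le_mul_of_nonneg_left h2 (sq_nonneg β)
    nlinarith [sq_nonneg (β * ‖W x‖ - 13 * ‖D x‖)]
  have iZ2 : Integrable (fun x => ‖Z x‖ ^ 2) (M.drawLaw π H s) := by
    refine Integrable.mono' ((ig.const_mul (2 * β ^ 2)).add (iD2.const_mul 14))
      (iZ.aestronglyMeasurable.norm.pow 2) ?_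
    filter_upwards [M.ae_drawLaw_mem_Icc π s] with x hx
    rw [Real.norm_of_nonneg (sq_nonneg _)]
    exact hZ2 x hx
  simp_rw [step_eq]
  refine (integral_norm_add_sub_integral_sq_le iZ iZ2 _).trans ?_
  rw [norm_smul, mul_pow, Real.norm_eq_abs, sq_abs, add_assoc]
  refine add_le_add le_rfl ?_
  calc ∫ x, ‖Z x‖ ^ 2 ∂(M.drawLaw π H s)
      ≤ ∫ x, 2 * β ^ 2 * ‖M.pgt π x.2 s.cur‖ ^ 2 + 14 * (2 * L ^ 2 * (η * ‖s.u‖) ^ 2)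
          ∂(M.drawLaw π H s) := by
        refine integral_mono_ae iZ2 ((ig.const_mul _).add (integrable_const _)) ?_
        filter_upwards [M.ae_drawLaw_mem_Icc π s] with x hx
        have := h.norm_hessVec_sq_le x.2 (s.query x.1) (s.cur - s.prev)
        rw [hv] at this
        have h5 := hZ2 x hx
        simp only [D] at h5
        linarith
    _ = _ := by
        rw [integral_add (ig.const_mul _) (integrable_const _), integral_const_mul, integral_const,
          probReal_univ, one_smul]
        ring

/-- When the tracking error is large, only the first moment of the importance-weighted estimator is
used, which is bounded however large the weights are; in return the error is measured by the
Huber function. -/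
lemma integral_huber_trackErr_le (h : M.Admissible π H Mg Mh G L k c m) {n : ℕ} (hn : n ≠ 0)
    {s : AlgState d} (hs : s.cur = s.prev + stepSize k m s.gsq • s.u) (hg : 0 ≤ s.gsq)
    (he : 7 * G ≤ ‖M.trackErr π H s‖) :
    ∫ x, huber (7 * G) ‖M.trackErr π H (M.step π k m c n s x)‖ ∂(M.drawLaw π H s)
      ≤ 7 * G * ‖M.trackErr π H s‖ * ((1 - c * stepSize k m s.gsq ^ 2) ^ 2 + 1) - 49 * G ^ 2
        + 7 * G / ‖M.trackErr π H s‖ * (2 * L ^ 2 * (stepSize k m s.gsq ^ 2 * ‖s.u‖ ^ 2))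
        + 28 * G ^ 2 * (c * stepSize k m s.gsq ^ 2) := by
  have hπ := h.regular
  have hprob := M.isProbabilityMeasure_drawLaw (H := H) hπ s
  have hη := h.stepSize_pos hg
  have hβ0 := h.beta_nonneg s.gsq
  have hβ1 := h.beta_le hg
  have hG := h.G_pos
  set η := stepSize k m s.gsq
  set β := c * η ^ 2 with hβ
  set r := ‖M.trackErr π H s‖ with hr
  have hr0 : 0 < r := by linarith
  have hv : ‖s.cur - s.prev‖ = η * ‖s.u‖ := by
    rw [hs, add_sub_cancel_left, norm_smul, Real.norm_of_nonneg hη.le]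
  let W : Draw S A H → EuclideanSpace ℝ (Fin d) := fun x =>
    π.weight x.2 s.cur (s.query x.1) • M.pgt π x.2 s.cur
  let D : Draw S A H → EuclideanSpace ℝ (Fin d) := fun x =>
    M.hessVec π x.2 (s.query x.1) (s.cur - s.prev)
  have iW : Integrable W (M.drawLaw π H s) := h.integrable_weight_smul s
  have iD : Integrable D (M.drawLaw π H s) := h.integrable_hessVec s
  have iD2 : Integrable (fun x => ‖D x‖ ^ 2) (M.drawLaw π H s) := h.integrable_norm_hessVec_sq s
  have eD : ∫ x, D x ∂(M.drawLaw π H s)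
      = gradient (M.perf π H) s.cur - gradient (M.perf π H) s.prev :=
    M.integral_hessVec hπ h.Mg_nonneg h.Mh_nonneg s
  let Y : Draw S A H → EuclideanSpace ℝ (Fin d) := fun x =>
    M.trackErr π H s + (D x - ∫ x, D x ∂(M.drawLaw π H s))
  have step_eq : ∀ x, M.trackErr π H (M.step π k m c n s x)
      = (1 - β) • Y x + β • (W x - gradient (M.perf π H) s.cur) := by
    intro x
    simp only [Y, eD]
    simp only [trackErr, step, estimator_eq n hn]
    simp only [W, D, β, η]
    module
  have iY : Integrable Y (M.drawLaw π H s) :=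
    (integrable_const _).add (iD.sub (integrable_const _))
  have iY2 : Integrable (fun x => ‖Y x‖ ^ 2) (M.drawLaw π H s) := by
    refine Integrable.mono' (((iD2.const_mul 2)).add
      (integrable_const (2 * ‖M.trackErr π H s - ∫ x, D x ∂(M.drawLaw π H s)‖ ^ 2)))
      (iY.aestronglyMeasurable.norm.pow 2) (ae_of_all _ fun x => ?_)
    rw [Real.norm_of_nonneg (sq_nonneg _)]
    have e : Y x = D x + (M.trackErr π H s - ∫ x, D x ∂(M.drawLaw π H s)) := by
      simp only [Y]; abel
    rw [e]
    have h1 := pow_le_pow_left₀ (norm_nonneg _) (norm_add_le (D x)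
      (M.trackErr π H s - ∫ x, D x ∂(M.drawLaw π H s))) 2
    simp only [Pi.add_apply]
    nlinarith [sq_nonneg (‖D x‖ - ‖M.trackErr π H s - ∫ x, D x ∂(M.drawLaw π H s)‖)]
  have bd : ∀ x, huber (7 * G) ‖M.trackErr π H (M.step π k m c n s x)‖
      ≤ 7 * G / r * ((1 - β) ^ 2 * ‖Y x‖ ^ 2) + (7 * G * r - (7 * G) ^ 2)
        + 2 * (7 * G) * (β * (‖W x‖ + G)) := by
    intro x
    have h1 : ‖M.trackErr π H (M.step π k m c n s x)‖ ≤ (1 - β) * ‖Y x‖ + β * (‖W x‖ + G) := by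
      rw [step_eq]
      refine (norm_add_le _ _).trans (add_le_add ?_ ?_)
      · rw [norm_smul, Real.norm_of_nonneg (by linarith)]
      · rw [norm_smul, Real.norm_of_nonneg hβ0]
        refine mul_le_mul_of_nonneg_left ((norm_sub_le _ _).trans ?_) hβ0
        linarith [h.norm_gradient_le s.cur]
    have h2 : 0 ≤ (1 - β) * ‖Y x‖ := mul_nonneg (by linarith) (norm_nonneg _)
    refine (huber_mono (by positivity) (norm_nonneg _) h1).trans
      ((huber_add_le (by positivity)).trans ?_)
    have h3 := huber_le_quadratic (ρ := 7 * G) (by positivity) he hr0 h2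
    rw [mul_pow] at h3
    linarith
  have iB : Integrable (fun x => 7 * G / r * ((1 - β) ^ 2 * ‖Y x‖ ^ 2) + (7 * G * r - (7 * G) ^ 2))
      (M.drawLaw π H s) := ((iY2.const_mul _).const_mul _).add (integrable_const _)
  have iB' : Integrable (fun x => 2 * (7 * G) * (β * (‖W x‖ + G))) (M.drawLaw π H s) :=
    ((iW.norm.add (integrable_const G)).const_mul β).const_mul _
  refine (integral_mono_of_nonneg (ae_of_all _ fun x => huber_nonneg (by positivity))
    (iB.add iB') (ae_of_all _ bd)).trans ?_
  have eq1 : ∫ x, (7 * G / r * ((1 - β) ^ 2 * ‖Y x‖ ^ 2) + (7 * G * r - (7 * G) ^ 2))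
      + 2 * (7 * G) * (β * (‖W x‖ + G)) ∂(M.drawLaw π H s)
      = 7 * G / r * ((1 - β) ^ 2 * ∫ x, ‖Y x‖ ^ 2 ∂(M.drawLaw π H s))
        + (7 * G * r - (7 * G) ^ 2)
        + 2 * (7 * G) * (β * ((∫ x, ‖W x‖ ∂(M.drawLaw π H s)) + G)) := by
    rw [integral_add iB iB', integral_add ((iY2.const_mul _).const_mul _) (integrable_const _),
      integral_const_mul, integral_const_mul, integral_const_mul, integral_const_mul,
      integral_add iW.norm (integrable_const _), integral_const, integral_const, probReal_univ,
      one_smul, one_smul]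
  have hW : ∫ x, ‖W x‖ ∂(M.drawLaw π H s) ≤ G :=
    h.G_eq ▸ M.integral_norm_weight_smul_pgt_le hπ h.Mg_nonneg s
  have hD : ∫ x, ‖D x‖ ^ 2 ∂(M.drawLaw π H s) ≤ 2 * L ^ 2 * (η ^ 2 * ‖s.u‖ ^ 2) := by
    have := integral_mono iD2 (integrable_const (2 * L ^ 2 * (η * ‖s.u‖) ^ 2)) fun x => by
      have := h.norm_hessVec_sq_le x.2 (s.query x.1) (s.cur - s.prev)
      rwa [hv] at this
    rwa [integral_const, probReal_univ, one_smul, mul_pow] at this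
  have hY : ∫ x, ‖Y x‖ ^ 2 ∂(M.drawLaw π H s) ≤ r ^ 2 + 2 * L ^ 2 * (η ^ 2 * ‖s.u‖ ^ 2) :=
    (integral_norm_add_sub_integral_sq_le iD iD2 _).trans (add_le_add le_rfl hD)
  refine eq1.le.trans ?_
  have hβ2 : (1 - β) ^ 2 ≤ 1 := by nlinarith
  have t1 : 7 * G / r * ((1 - β) ^ 2 * ∫ x, ‖Y x‖ ^ 2 ∂(M.drawLaw π H s))
      ≤ 7 * G * r * (1 - β) ^ 2 + 7 * G / r * (2 * L ^ 2 * (η ^ 2 * ‖s.u‖ ^ 2)) := by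
    have e : 7 * G * r * (1 - β) ^ 2 = 7 * G / r * ((1 - β) ^ 2 * r ^ 2) := by
      field_simp
    rw [e, ← mul_add]
    refine mul_le_mul_of_nonneg_left ?_ (by positivity)
    have h5 := mul_le_mul_of_nonneg_left hY (sq_nonneg (1 - β))
    have h6 : (1 - β) ^ 2 * (2 * L ^ 2 * (η ^ 2 * ‖s.u‖ ^ 2))
        ≤ 2 * L ^ 2 * (η ^ 2 * ‖s.u‖ ^ 2) := mul_le_of_le_one_left (by positivity) hβ2
    linarith
  have t2 : β * ((∫ x, ‖W x‖ ∂(M.drawLaw π H s)) + G) ≤ β * (2 * G) :=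
    mul_le_mul_of_nonneg_left (by linarith) hβ0
  have t3 := mul_le_mul_of_nonneg_left t2 (by positivity : (0 : ℝ) ≤ 2 * (7 * G))
  linarith

end Admissible

end MDP

/-! ### The Lyapunov function -/

/-- The arithmetic of one iteration while the tracking error is moderate. Here `η` is the step size,
`J₀` and `J₁` are the performances before and after the step, and `D`, `U`, `Q` and `S` stand for
`‖∇J‖²`, `‖u‖²`, `‖u - ∇J‖²` and `min(G, ‖u‖/10)²`. -/
lemma drift_small_error {η L c D U Q S P J₀ J₁ : ℝ} (hη : 0 < η) (hL : 0 < L)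
    (hc : 52 * L ^ 2 ≤ c) (hLη : L * η ≤ 1 / 26) (hβ : c * η ^ 2 ≤ 1 / 13)
    (hD : 0 ≤ D) (hU : 0 ≤ U) (hQ : 0 ≤ Q) (hS : S ≤ U / 100)
    (hP : 2 * P = D + U - Q) (hJ : η * P - 3 / 2 * L * (η ^ 2 * U) ≤ J₁ - J₀) :
    16 * J₀ + η * (2 * D + 2 * S) ≤ 16 * J₁ + Q * (1 / η - c / 16 * η) / (4 * L ^ 2)
      - ((1 - c * η ^ 2) ^ 2 * Q + 28 * L ^ 2 * (η ^ 2 * U)) / (4 * L ^ 2 * η) := by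
  have e : Q * (1 / η - c / 16 * η) / (4 * L ^ 2)
      - ((1 - c * η ^ 2) ^ 2 * Q + 28 * L ^ 2 * (η ^ 2 * U)) / (4 * L ^ 2 * η)
      = Q * (c * η) * (2 - c * η ^ 2 - 1 / 16) / (4 * L ^ 2) - 7 * (η * U) := by
    field_simp
    ring
  have h1 : 13 * (η * Q) ≤ Q * (c * η) * (2 - c * η ^ 2 - 1 / 16) / (4 * L ^ 2) := by
    rw [le_div_iff₀ (by positivity)]
    have h2 : Q * (52 * L ^ 2 * η) ≤ Q * (c * η) := by gcongr
    have h3 : 0 ≤ Q * (52 * L ^ 2 * η) := by positivity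
    nlinarith
  have h4 : 24 * L * (η ^ 2 * U) ≤ 24 / 26 * (η * U) := by
    have := mul_le_mul_of_nonneg_right hLη (by positivity : 0 ≤ 24 * (η * U))
    linarith
  have h5 : η * S ≤ η * (U / 100) := by gcongr
  have h6 : 0 ≤ η * D := by positivity
  have h7 : 0 ≤ η * U := by positivity
  have h8 : 0 ≤ η * Q := by positivity
  have h9 : 16 * (η * P) = 8 * (η * D) + 8 * (η * U) - 8 * (η * Q) := by
    linear_combination 8 * η * hP
  linarith

/-- The arithmetic of one iteration while the tracking error `r` is large; `y` stands for `‖u‖`,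
the other letters are as in `drift_small_error`. The momentum term decreases the error at a rate
proportional to `r`, which outweighs all the losses. -/
lemma drift_large_error {η L c G r y D S J₀ J₁ : ℝ} (hη : 0 < η) (hL : 0 < L) (hG : 0 < G)
    (hc : 52 * L ^ 2 ≤ c) (hβ : c * η ^ 2 ≤ 1 / 13)
    (hr : 7 * G ≤ r) (hy0 : 0 ≤ y) (hy : y ≤ r + G) (hD : D ≤ G ^ 2) (hS : S ≤ G ^ 2)
    (hJ : -(G * (η * y)) ≤ J₁ - J₀) :
    16 * J₀ + η * (2 * D + 2 * S)
      ≤ 16 * J₁ + (2 * (7 * G) * r - (7 * G) ^ 2) * (1 / η - c / 16 * η) / (4 * L ^ 2)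
      - (7 * G * r * ((1 - c * η ^ 2) ^ 2 + 1) - 49 * G ^ 2
        + 7 * G / r * (2 * L ^ 2 * (η ^ 2 * y ^ 2)) + 28 * G ^ 2 * (c * η ^ 2))
        / (4 * L ^ 2 * η) := by
  have hr0 : 0 < r := by linarith
  have hc0 : 0 < c := lt_of_lt_of_le (by positivity) hc
  have e : (2 * (7 * G) * r - (7 * G) ^ 2) * (1 / η - c / 16 * η) / (4 * L ^ 2)
      - (7 * G * r * ((1 - c * η ^ 2) ^ 2 + 1) - 49 * G ^ 2
        + 7 * G / r * (2 * L ^ 2 * (η ^ 2 * y ^ 2)) + 28 * G ^ 2 * (c * η ^ 2))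
        / (4 * L ^ 2 * η)
      = G * (c * η) * ((14 - 7 * (c * η ^ 2) - 14 / 16) * r + (49 / 16 - 28) * G) / (4 * L ^ 2)
        - 7 / 2 * (G * η) * (y ^ 2 / r) := by
    field_simp
    ring
  have hx : 8 * r ≤ (14 - 7 * (c * η ^ 2) - 14 / 16) * r + (49 / 16 - 28) * G := by nlinarith
  have h1 : 13 * (G * η) * (8 * r)
      ≤ G * (c * η) * ((14 - 7 * (c * η ^ 2) - 14 / 16) * r + (49 / 16 - 28) * G)
        / (4 * L ^ 2) := by
    rw [le_div_iff₀ (by positivity)]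
    have h2 : G * (52 * L ^ 2 * η) ≤ G * (c * η) := by gcongr
    have h3 := mul_le_mul h2 hx (by positivity) (by positivity)
    linarith
  have h2 : y ^ 2 / r ≤ 8 / 7 * (8 / 7 * r) := by
    rw [div_le_iff₀ hr0]
    have : y ≤ 8 / 7 * r := by linarith
    nlinarith
  have h3 : 7 / 2 * (G * η) * (y ^ 2 / r) ≤ 7 / 2 * (G * η) * (8 / 7 * (8 / 7 * r)) := by gcongr
  have h4 : G * (η * y) ≤ G * (η * (8 / 7 * r)) := by
    gcongr
    linarith
  have h5 : η * (2 * D + 2 * S) ≤ η * (4 * G ^ 2) := by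
    gcongr
    linarith
  have h6 : η * (4 * G ^ 2) ≤ 4 / 7 * (G * η * r) := by
    have : G * η * (7 * G) ≤ G * η * r := by gcongr
    linarith
  have h7 : 0 ≤ G * η * r := by positivity
  linarith

namespace MDP

variable {S A : Type*} [MeasurableSpace S] [MeasurableSpace A] {d H : ℕ}
  {π : ParamPolicy (EuclideanSpace ℝ (Fin d)) S A} {Mg Mh : ℝ}

/-- The Lyapunov function of the analysis: the performance, minus the tracking error, measured by
the Huber function and divided by the step size, plus a logarithmic term that pays for the noise.
The correction `c / 16 * η` accounts for the change of the step size in one iteration. -/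
def lyapunov (M : MDP S A) (π : ParamPolicy (EuclideanSpace ℝ (Fin d)) S A) (H : ℕ)
    (G L k c m : ℝ) (s : AlgState d) : ℝ :=
  16 * M.perf π H s.prev
    - huber (7 * G) ‖M.trackErr π H s‖
      * (1 / stepSize k m s.gsq - c / 16 * stepSize k m s.gsq) / (4 * L ^ 2)
    + c ^ 2 * k ^ 3 / (2 * L ^ 2) * Real.log (G ^ 2 + s.gsq)

/-- A lower bound for the expected growth of the Lyapunov function in one iteration. The second
summand controls the distance between `θ_t` and the parameter at which the trajectory is sampled; it
is capped because the gradient estimators are bounded by `G` anyway. -/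
def gain (M : MDP S A) (π : ParamPolicy (EuclideanSpace ℝ (Fin d)) S A) (H : ℕ)
    (G k m : ℝ) (s : AlgState d) : ℝ :=
  stepSize k m s.gsq *
    (2 * ‖gradient (M.perf π H) s.prev‖ ^ 2 + 2 * min G (‖s.u‖ / 10) ^ 2)

variable {M : MDP S A} {G L k c m : ℝ}

namespace Admissible

lemma norm_estimator_le (h : M.Admissible π H Mg Mh G L k c m) (n : ℕ)
    {s : AlgState d} (hg : 0 ≤ s.gsq) {x : Draw S A H} (hx : x.1 ∈ Set.Icc (0 : ℝ) 1) :
    ‖M.estimator π k m c n s x‖ ≤ Real.exp (H * Mg * ‖s.cur - s.prev‖) * G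
      + (‖s.u‖ + 3 / 2 * L * ‖s.cur - s.prev‖) := by
  have hL := h.L_pos
  have hG := h.G_pos
  have h1 : 1 ≤ Real.exp (H * Mg * ‖s.cur - s.prev‖) := by
    have := h.Mg_nonneg
    exact Real.one_le_exp (by positivity)
  have hβ0 := h.beta_nonneg s.gsq
  have hβ1 := h.beta_le hg
  rcases eq_or_ne n 0 with rfl | hn
  · rw [estimator, if_pos rfl]
    have := h.norm_pgt_le x.2 s.cur
    have h2 : 1 * G ≤ Real.exp (H * Mg * ‖s.cur - s.prev‖) * G := by gcongr
    have h3 : 0 ≤ ‖s.u‖ + 3 / 2 * L * ‖s.cur - s.prev‖ := by positivity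
    linarith
  rw [estimator_eq n hn]
  set β := c * stepSize k m s.gsq ^ 2
  refine (norm_add_le _ _).trans (add_le_add ?_ ?_)
  · rw [norm_smul, norm_smul, Real.norm_of_nonneg hβ0,
      Real.norm_of_nonneg (π.weight_pos _ _ _).le]
    refine (mul_le_of_le_one_left (mul_nonneg (π.weight_pos _ _ _).le (norm_nonneg _))
      (by linarith)).trans ?_
    exact mul_le_mul (weight_query_le h.regular h.Mg_nonneg s hx) (h.norm_pgt_le _ _)
      (norm_nonneg _) (by positivity)
  · rw [norm_smul, Real.norm_of_nonneg (by linarith)]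
    refine (mul_le_of_le_one_left (norm_nonneg _) (by linarith)).trans
      ((norm_add_le _ _).trans (add_le_add le_rfl ?_))
    exact (h.norm_hessVec_le _ _ _).trans
      (mul_le_mul_of_nonneg_right h.hess_le' (norm_nonneg _))

lemma measurable_trackErr (h : M.Admissible π H Mg Mh G L k c m) :
    Measurable (M.trackErr π H : AlgState d → EuclideanSpace ℝ (Fin d)) :=
  AlgState.measurable_u.sub
    ((M.measurable_gradient_perf h.regular h.Mg_nonneg).comp AlgState.measurable_prev)

lemma measurable_step_right (h : M.Admissible π H Mg Mh G L k c m) (n : ℕ) (s : AlgState d) :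
    Measurable (fun x : Draw S A H => M.step π k m c n s x) :=
  (M.measurable_step h.regular k m c n).comp
    (f := fun x : Draw S A H => (s, x)) (by fun_prop)

lemma norm_trackErr_step_le (h : M.Admissible π H Mg Mh G L k c m) (n : ℕ)
    {s : AlgState d} (hg : 0 ≤ s.gsq) {x : Draw S A H} (hx : x.1 ∈ Set.Icc (0 : ℝ) 1) :
    ‖M.trackErr π H (M.step π k m c n s x)‖ ≤ Real.exp (H * Mg * ‖s.cur - s.prev‖) * G
      + (‖s.u‖ + 3 / 2 * L * ‖s.cur - s.prev‖) + G :=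
  (norm_sub_le _ _).trans (add_le_add (h.norm_estimator_le n hg hx) (h.norm_gradient_le _))

lemma integrable_norm_trackErr_step_sq (h : M.Admissible π H Mg Mh G L k c m) (n : ℕ)
    {s : AlgState d} (hg : 0 ≤ s.gsq) :
    Integrable (fun x => ‖M.trackErr π H (M.step π k m c n s x)‖ ^ 2) (M.drawLaw π H s) := by
  refine M.integrable_drawLaw h.regular s
    ((h.measurable_trackErr.comp (h.measurable_step_right n s)).norm.pow_const 2)
    (K := (Real.exp (H * Mg * ‖s.cur - s.prev‖) * G
      + (‖s.u‖ + 3 / 2 * L * ‖s.cur - s.prev‖) + G) ^ 2) fun x hx => ?_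
  rw [Real.norm_of_nonneg (sq_nonneg _)]
  exact pow_le_pow_left₀ (norm_nonneg _) (h.norm_trackErr_step_le n hg hx) 2

lemma integrable_huber_trackErr_step (h : M.Admissible π H Mg Mh G L k c m) (n : ℕ)
    {s : AlgState d} (hg : 0 ≤ s.gsq) :
    Integrable (fun x => huber (7 * G) ‖M.trackErr π H (M.step π k m c n s x)‖)
      (M.drawLaw π H s) := by
  have hG := h.G_pos
  refine (h.integrable_norm_trackErr_step_sq n hg).mono'
    ((measurable_huber _).comp
      (h.measurable_trackErr.comp (h.measurable_step_right n s)).norm).aestronglyMeasurable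
    (ae_of_all _ fun x => ?_)
  rw [Real.norm_of_nonneg (huber_nonneg (by positivity))]
  exact huber_le_sq _ _

/-- The improvement of the performance in an iteration, combined with the contraction of the
tracking error. The number `b` bounds the new tracking error up to the noise of the gradient
estimator. -/
lemma exists_drift (h : M.Admissible π H Mg Mh G L k c m) {n : ℕ} (hn : n ≠ 0)
    {s : AlgState d} (hs : s.cur = s.prev + stepSize k m s.gsq • s.u) (hg : 0 ≤ s.gsq) :
    ∃ b : ℝ, 0 ≤ b ∧
      ∫ x, huber (7 * G) ‖M.trackErr π H (M.step π k m c n s x)‖ ∂(M.drawLaw π H s)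
        ≤ b + 2 * (c * stepSize k m s.gsq ^ 2) ^ 2
          * ∫ x, ‖M.pgt π x.2 s.cur‖ ^ 2 ∂(M.drawLaw π H s) ∧
      16 * M.perf π H s.prev + M.gain π H G k m s ≤ 16 * M.perf π H s.cur
        + huber (7 * G) ‖M.trackErr π H s‖
          * (1 / stepSize k m s.gsq - c / 16 * stepSize k m s.gsq) / (4 * L ^ 2)
        - b / (4 * L ^ 2 * stepSize k m s.gsq) := by
  have hη := h.stepSize_pos hg
  have hLη := h.L_mul_stepSize_le hg
  have hβ0 := h.beta_nonneg s.gsq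
  have hβ1 := h.beta_le hg
  have hG := h.G_pos
  have hL := h.L_pos
  have hc := h.le_c
  have hc0 := h.c_pos
  have hdiff : s.cur - s.prev = stepSize k m s.gsq • s.u := by rw [hs, add_sub_cancel_left]
  have hmin0 : 0 ≤ min G (‖s.u‖ / 10) := le_min hG.le (by positivity)
  rcases le_total ‖M.trackErr π H s‖ (7 * G) with he | he
  · refine ⟨(1 - c * stepSize k m s.gsq ^ 2) ^ 2 * ‖M.trackErr π H s‖ ^ 2
        + 28 * L ^ 2 * (stepSize k m s.gsq ^ 2 * ‖s.u‖ ^ 2), by positivity, ?_, ?_⟩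
    · exact (integral_mono (h.integrable_huber_trackErr_step n hg)
        (h.integrable_norm_trackErr_step_sq n hg) fun x => huber_le_sq _ _).trans
        (h.integral_trackErr_sq_le hn hs hg he)
    · have hJ := M.perf_sub_ge (H := H) h.regular h.Mg_nonneg h.Mh_nonneg s.prev s.cur
      rw [hdiff, inner_smul_right, norm_smul, Real.norm_of_nonneg hη.le, mul_pow,
        ← h.G_eq] at hJ
      have hJ2 := mul_le_mul_of_nonneg_right h.hess_le'
        (by positivity : 0 ≤ stepSize k m s.gsq ^ 2 * ‖s.u‖ ^ 2)
      have hP := norm_sub_sq_real s.u (gradient (M.perf π H) s.prev)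
      rw [real_inner_comm] at hP
      have hS : min G (‖s.u‖ / 10) ^ 2 ≤ ‖s.u‖ ^ 2 / 100 := by
        have := pow_le_pow_left₀ hmin0 (min_le_right G (‖s.u‖ / 10)) 2
        rw [div_pow] at this
        norm_num at this
        exact this
      rw [huber, if_pos he, gain]
      refine drift_small_error hη hL hc hLη hβ1 (sq_nonneg _) (sq_nonneg _) (sq_nonneg _) hS
        (P := inner ℝ (gradient (M.perf π H) s.prev) s.u) ?_ (by linarith)
      rw [trackErr, hP]
      ring
  · have hr0 : 0 < ‖M.trackErr π H s‖ := by linarith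
    refine ⟨_, ?_, (h.integral_huber_trackErr_le hn hs hg he).trans
      (le_add_of_nonneg_right ?_), ?_⟩
    · have : 7 * G * (7 * G) ≤ 7 * G * ‖M.trackErr π H s‖ := by gcongr
      have h2 : 0 ≤ 7 * G * ‖M.trackErr π H s‖ * (1 - c * stepSize k m s.gsq ^ 2) ^ 2 := by
        positivity
      have h3 : 0 ≤ 7 * G / ‖M.trackErr π H s‖
        * (2 * L ^ 2 * (stepSize k m s.gsq ^ 2 * ‖s.u‖ ^ 2)) := by positivity
      have h4 : 0 ≤ 28 * G ^ 2 * (c * stepSize k m s.gsq ^ 2) := by positivity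
      linarith
    · exact mul_nonneg (by positivity) (integral_nonneg fun x => sq_nonneg _)
    · have hJ := M.perf_sub_ge_of_gradient_le (H := H) h.regular h.Mg_nonneg s.prev s.cur
      rw [hdiff, norm_smul, Real.norm_of_nonneg hη.le, ← h.G_eq] at hJ
      have hV : huber (7 * G) ‖M.trackErr π H s‖
          = 2 * (7 * G) * ‖M.trackErr π H s‖ - (7 * G) ^ 2 := by
        unfold huber
        split_ifs with h1
        · rw [le_antisymm h1 he]; ring
        · rfl
      have hu : ‖s.u‖ ≤ ‖M.trackErr π H s‖ + G := by
        have : s.u = M.trackErr π H s + gradient (M.perf π H) s.prev := by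
          rw [trackErr, sub_add_cancel]
        have h2 := norm_add_le (M.trackErr π H s) (gradient (M.perf π H) s.prev)
        rw [← this] at h2
        linarith [h.norm_gradient_le s.prev]
      rw [hV, gain]
      exact drift_large_error hη hL hG hc hβ1 he (norm_nonneg _) hu
        (pow_le_pow_left₀ (norm_nonneg _) (h.norm_gradient_le _) 2)
        (pow_le_pow_left₀ hmin0 (min_le_left _ _) 2) hJ

lemma integrable_log_gsq_step (h : M.Admissible π H Mg Mh G L k c m) (n : ℕ)
    {s : AlgState d} (hg : 0 ≤ s.gsq) :
    Integrable (fun x => Real.log (G ^ 2 + (M.step π k m c n s x).gsq)) (M.drawLaw π H s) := by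
  have hG := h.G_pos
  have hm : Measurable (fun x => Real.log (G ^ 2 + (M.step π k m c n s x).gsq)) :=
    ((AlgState.measurable_gsq.comp (h.measurable_step_right n s)).const_add _).log
  refine M.integrable_drawLaw h.regular s hm
    (K := |Real.log (G ^ 2)| + |Real.log (G ^ 2 + (s.gsq + G ^ 2))|) fun x _ => ?_
  have h1 : ‖M.pgt π x.2 s.cur‖ ^ 2 ≤ G ^ 2 :=
    pow_le_pow_left₀ (norm_nonneg _) (h.norm_pgt_le _ _) 2
  have h2 : 0 ≤ ‖M.pgt π x.2 s.cur‖ ^ 2 := sq_nonneg _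
  have h3 : (0 : ℝ) < G ^ 2 := by positivity
  simp only [step]
  refine abs_le.2 ⟨?_, ?_⟩
  · have := Real.log_le_log h3 (by linarith : G ^ 2 ≤ G ^ 2 + (s.gsq + ‖M.pgt π x.2 s.cur‖ ^ 2))
    linarith [neg_abs_le (Real.log (G ^ 2)), abs_nonneg (Real.log (G ^ 2 + (s.gsq + G ^ 2)))]
  · have := Real.log_le_log (by linarith)
      (by linarith : G ^ 2 + (s.gsq + ‖M.pgt π x.2 s.cur‖ ^ 2) ≤ G ^ 2 + (s.gsq + G ^ 2))
    linarith [le_abs_self (Real.log (G ^ 2 + (s.gsq + G ^ 2))), abs_nonneg (Real.log (G ^ 2))]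

/-- The Lyapunov function after an iteration, in terms of the step size before it. -/
lemma lyapunov_step_ge (h : M.Admissible π H Mg Mh G L k c m) (n : ℕ)
    {s : AlgState d} (hg : 0 ≤ s.gsq) (x : Draw S A H) :
    16 * M.perf π H s.cur
      - huber (7 * G) ‖M.trackErr π H (M.step π k m c n s x)‖ / (4 * L ^ 2 * stepSize k m s.gsq)
      + c ^ 2 * k ^ 3 / (2 * L ^ 2) * Real.log (G ^ 2 + (M.step π k m c n s x).gsq)
      ≤ M.lyapunov π H G L k c m (M.step π k m c n s x) := by
  have hL := h.L_pos
  have hG := h.G_pos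
  have hη := h.stepSize_pos hg
  have h1 := h.inv_stepSize_sub_le hg (sq_nonneg ‖M.pgt π x.2 s.cur‖)
    (pow_le_pow_left₀ (norm_nonneg _) (h.norm_pgt_le _ _) 2)
  have h2 : 0 ≤ huber (7 * G) ‖M.trackErr π H (M.step π k m c n s x)‖ / (4 * L ^ 2) :=
    div_nonneg (huber_nonneg (by positivity)) (by positivity)
  have h3 := mul_le_mul_of_nonneg_left h1 h2
  have e : huber (7 * G) ‖M.trackErr π H (M.step π k m c n s x)‖ / (4 * L ^ 2)
      * (1 / stepSize k m s.gsq) = huber (7 * G) ‖M.trackErr π H (M.step π k m c n s x)‖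
      / (4 * L ^ 2 * stepSize k m s.gsq) := by field_simp
  rw [e, div_mul_eq_mul_div] at h3
  rw [lyapunov]
  exact add_le_add (sub_le_sub le_rfl h3) le_rfl

/-- Integrability of the lower bound in `lyapunov_step_ge`, and the value of its integral. -/
lemma integral_lyapunov_step_ge (h : M.Admissible π H Mg Mh G L k c m) (n : ℕ)
    {s : AlgState d} (hg : 0 ≤ s.gsq)
    (hi : Integrable (fun x => M.lyapunov π H G L k c m (M.step π k m c n s x))
      (M.drawLaw π H s)) :
    16 * M.perf π H s.cur
      - (∫ x, huber (7 * G) ‖M.trackErr π H (M.step π k m c n s x)‖ ∂(M.drawLaw π H s))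
        / (4 * L ^ 2 * stepSize k m s.gsq)
      + c ^ 2 * k ^ 3 / (2 * L ^ 2)
        * ∫ x, Real.log (G ^ 2 + (M.step π k m c n s x).gsq) ∂(M.drawLaw π H s)
      ≤ ∫ x, M.lyapunov π H G L k c m (M.step π k m c n s x) ∂(M.drawLaw π H s) := by
  have hprob := M.isProbabilityMeasure_drawLaw (H := H) h.regular s
  have i1 := h.integrable_huber_trackErr_step n hg
  have i2 := h.integrable_log_gsq_step n hg
  have i3 : Integrable (fun x => 16 * M.perf π H s.cur
      - huber (7 * G) ‖M.trackErr π H (M.step π k m c n s x)‖ / (4 * L ^ 2 * stepSize k m s.gsq))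
      (M.drawLaw π H s) := (integrable_const _).sub (i1.div_const _)
  have := integral_mono (i3.add (i2.const_mul (c ^ 2 * k ^ 3 / (2 * L ^ 2)))) hi
    fun x => h.lyapunov_step_ge n hg x
  refine le_trans (le_of_eq ?_) this
  rw [integral_add' i3 (i2.const_mul _), integral_sub (integrable_const _) (i1.div_const _),
    integral_div, integral_const, probReal_univ, one_smul, integral_const_mul]

/-- One iteration raises the Lyapunov function by the gain, in expectation. -/
lemma lyapunov_add_gain_le (h : M.Admissible π H Mg Mh G L k c m) {n : ℕ} (hn : n ≠ 0)
    {s : AlgState d} (hs : s.cur = s.prev + stepSize k m s.gsq • s.u) (hg : 0 ≤ s.gsq)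
    (hi : Integrable (fun x => M.lyapunov π H G L k c m (M.step π k m c n s x))
      (M.drawLaw π H s)) :
    M.lyapunov π H G L k c m s + M.gain π H G k m s
      ≤ ∫ x, M.lyapunov π H G L k c m (M.step π k m c n s x) ∂(M.drawLaw π H s) := by
  have hprob := M.isProbabilityMeasure_drawLaw (H := H) h.regular s
  obtain ⟨b, -, hb1, hb2⟩ := h.exists_drift hn hs hg
  refine le_trans ?_ (h.integral_lyapunov_step_ge n hg hi)
  have hL := h.L_pos
  have hη := h.stepSize_pos hg
  have ig := h.integrable_norm_pgt_sq s
  have il := h.integrable_log_gsq_step n hg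
  -- the noise of the gradient estimator is paid for by the logarithmic term
  have hlog : stepSize k m s.gsq ^ 3 * ∫ x, ‖M.pgt π x.2 s.cur‖ ^ 2 ∂(M.drawLaw π H s)
      ≤ k ^ 3 * ((∫ x, Real.log (G ^ 2 + (M.step π k m c n s x).gsq) ∂(M.drawLaw π H s))
        - Real.log (G ^ 2 + s.gsq)) := by
    have := integral_mono (ig.const_mul (stepSize k m s.gsq ^ 3))
      ((il.sub (integrable_const (Real.log (G ^ 2 + s.gsq)))).const_mul (k ^ 3))
      fun x => h.stepSize_cube_mul_le hg (sq_nonneg ‖M.pgt π x.2 s.cur‖)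
        (pow_le_pow_left₀ (norm_nonneg _) (h.norm_pgt_le _ _) 2)
    rw [integral_const_mul, integral_const_mul, integral_sub' il (integrable_const _),
      integral_const, probReal_univ, one_smul] at this
    exact this
  have hN := div_le_div_of_nonneg_right hb1
    (by positivity : 0 ≤ 4 * L ^ 2 * stepSize k m s.gsq)
  set N := ∫ x, huber (7 * G) ‖M.trackErr π H (M.step π k m c n s x)‖ ∂(M.drawLaw π H s)
  set g2 := ∫ x, ‖M.pgt π x.2 s.cur‖ ^ 2 ∂(M.drawLaw π H s)
  set l := ∫ x, Real.log (G ^ 2 + (M.step π k m c n s x).gsq) ∂(M.drawLaw π H s)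
  have e : (b + 2 * (c * stepSize k m s.gsq ^ 2) ^ 2 * g2) / (4 * L ^ 2 * stepSize k m s.gsq)
      = b / (4 * L ^ 2 * stepSize k m s.gsq)
        + c ^ 2 / (2 * L ^ 2) * (stepSize k m s.gsq ^ 3 * g2) := by
    field_simp
    ring
  have h5 := mul_le_mul_of_nonneg_left hlog (by positivity : 0 ≤ c ^ 2 / (2 * L ^ 2))
  have e2 : c ^ 2 / (2 * L ^ 2) * (k ^ 3 * (l - Real.log (G ^ 2 + s.gsq)))
      = c ^ 2 * k ^ 3 / (2 * L ^ 2) * l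
        - c ^ 2 * k ^ 3 / (2 * L ^ 2) * Real.log (G ^ 2 + s.gsq) := by ring
  rw [lyapunov]
  linarith

/-- A bound for the Lyapunov function that does not refer to a further iteration. -/
lemma lyapunov_add_gain_le_perf (h : M.Admissible π H Mg Mh G L k c m)
    {s : AlgState d} (hs : s.cur = s.prev + stepSize k m s.gsq • s.u) (hg : 0 ≤ s.gsq) :
    M.lyapunov π H G L k c m s + M.gain π H G k m s ≤ 16 * M.perf π H s.cur
      + c ^ 2 * k ^ 3 / (2 * L ^ 2) * Real.log (G ^ 2 + s.gsq) := by
  obtain ⟨b, hb0, -, hb2⟩ := h.exists_drift one_ne_zero hs hg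
  have hL := h.L_pos
  have hη := h.stepSize_pos hg
  have : 0 ≤ b / (4 * L ^ 2 * stepSize k m s.gsq) := by positivity
  rw [lyapunov]
  linarith

end Admissible

end MDP

/-! ### The law of a run -/

namespace MDP

/-- All the numbers `α` drawn in a run lie in `[0, 1]`. -/
def ValidDraws {S A : Type*} {H n : ℕ} (ξ : Fin n → Draw S A H) : Prop :=
  ∀ i, (ξ i).1 ∈ Set.Icc (0 : ℝ) 1

lemma ValidDraws.snoc {S A : Type*} {H n : ℕ} {ξ : Fin n → Draw S A H} (hξ : ValidDraws ξ)
    {x : Draw S A H} (hx : x.1 ∈ Set.Icc (0 : ℝ) 1) :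
    ValidDraws (Fin.snoc (α := fun _ => Draw S A H) ξ x : Fin (n + 1) → Draw S A H) := by
  intro i
  refine Fin.lastCases ?_ (fun j => ?_) i
  · simpa using hx
  · simpa using hξ j

variable {S A : Type*} [MeasurableSpace S] [MeasurableSpace A] {d H : ℕ}
  {π : ParamPolicy (EuclideanSpace ℝ (Fin d)) S A} {Mg Mh : ℝ}

/-- The law of the next draw given the first `n` draws, as a kernel. -/
def drawKernel (M : MDP S A) (π : ParamPolicy (EuclideanSpace ℝ (Fin d)) S A) (H : ℕ)
    (k m c : ℝ) (θ₁ : EuclideanSpace ℝ (Fin d)) (n : ℕ) :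
    Kernel (Fin n → Draw S A H) (Draw S A H) :=
  Kernel.withDensity
    (Kernel.const _ ((volume.restrict (Set.Icc (0 : ℝ) 1)).prod (M.refMeasure π.ν H)))
    (fun ξ x => ENNReal.ofReal (π.lik x.2 ((M.state π k m c θ₁ n ξ).query x.1)))

variable {M : MDP S A} {k m c : ℝ} {θ₁ : EuclideanSpace ℝ (Fin d)} {n : ℕ}

lemma measurable_lik_state (hπ : π.IsRegular Mg Mh) :
    Measurable (Function.uncurry fun (ξ : Fin n → Draw S A H) (x : Draw S A H) =>
      ENNReal.ofReal (π.lik x.2 ((M.state π k m c θ₁ n ξ).query x.1))) :=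
  ((measurable_lik_query_prod hπ).comp
    (f := fun p : (Fin n → Draw S A H) × Draw S A H => (M.state π k m c θ₁ n p.1, p.2))
    (((M.measurable_state hπ k m c θ₁ n).comp measurable_fst).prodMk
      measurable_snd)).ennreal_ofReal

lemma drawKernel_apply (hπ : π.IsRegular Mg Mh) (ξ : Fin n → Draw S A H) :
    M.drawKernel π H k m c θ₁ n ξ = M.drawLaw π H (M.state π k m c θ₁ n ξ) := by
  rw [drawKernel, Kernel.withDensity_apply _ (measurable_lik_state hπ), Kernel.const_apply,
    drawLaw]

lemma isMarkovKernel_drawKernel (hπ : π.IsRegular Mg Mh) :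
    IsMarkovKernel (M.drawKernel π H k m c θ₁ n) :=
  ⟨fun ξ => by
    rw [drawKernel_apply hπ]
    exact M.isProbabilityMeasure_drawLaw hπ _⟩

lemma measurable_snoc_draw (n : ℕ) :
    Measurable (fun p : (Fin n → Draw S A H) × Draw S A H =>
      Fin.snoc (α := fun _ => Draw S A H) p.1 p.2) := measurable_fin_snoc _ n

instance : SFinite (M.runLaw π H k m c θ₁ n) := by
  cases n with
  | zero => unfold runLaw; infer_instance
  | succ n =>
    have : ∀ n, SFinite (M.runLaw π H k m c θ₁ n) := fun n => by
      induction n with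
      | zero => unfold runLaw; infer_instance
      | succ n ih => unfold runLaw; infer_instance
    exact this _

/-- The recursive definition of the law of a run, as a disintegration over the past. -/
lemma runLaw_succ (hπ : π.IsRegular Mg Mh) :
    M.runLaw π H k m c θ₁ (n + 1)
      = ((M.runLaw π H k m c θ₁ n) ⊗ₘ (M.drawKernel π H k m c θ₁ n)).map
        (fun p => Fin.snoc (α := fun _ => Draw S A H) p.1 p.2) := by
  have := isMarkovKernel_drawKernel (M := M) (H := H) (k := k) (m := m) (c := c) (θ₁ := θ₁)
    (n := n) hπ
  have h1 : IsSFiniteKernel (M.drawKernel π H k m c θ₁ n) := inferInstance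
  unfold drawKernel at h1 ⊢
  rw [Measure.compProd_withDensity (measurable_lik_state hπ), Measure.compProd_const]
  rfl

lemma isProbabilityMeasure_runLaw (hπ : π.IsRegular Mg Mh) (n : ℕ) :
    IsProbabilityMeasure (M.runLaw π H k m c θ₁ n) := by
  induction n with
  | zero => unfold runLaw; infer_instance
  | succ n ih =>
    have := isMarkovKernel_drawKernel (M := M) (H := H) (k := k) (m := m) (c := c) (θ₁ := θ₁)
      (n := n) hπ
    rw [runLaw_succ hπ]
    exact Measure.isProbabilityMeasure_map (measurable_snoc_draw n).aemeasurable

lemma integral_runLaw_succ (hπ : π.IsRegular Mg Mh)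
    {f : (Fin (n + 1) → Draw S A H) → ℝ} (hm : Measurable f)
    (hf : Integrable f (M.runLaw π H k m c θ₁ (n + 1))) :
    ∫ ξ, f ξ ∂(M.runLaw π H k m c θ₁ (n + 1))
      = ∫ ξ, ∫ x, f (Fin.snoc (α := fun _ => Draw S A H) ξ x)
          ∂(M.drawLaw π H (M.state π k m c θ₁ n ξ)) ∂(M.runLaw π H k m c θ₁ n) := by
  have := isMarkovKernel_drawKernel (M := M) (H := H) (k := k) (m := m) (c := c) (θ₁ := θ₁)
    (n := n) hπ
  rw [runLaw_succ hπ] at hf ⊢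
  rw [integrable_map_measure hm.aestronglyMeasurable (measurable_snoc_draw n).aemeasurable] at hf
  rw [integral_map (measurable_snoc_draw n).aemeasurable hm.aestronglyMeasurable]
  refine (Measure.integral_compProd hf).trans ?_
  simp_rw [drawKernel_apply hπ]
  rfl

/-- The inner integral in `integral_runLaw_succ` is an integrable function of the past. -/
lemma integrable_integral_drawLaw (hπ : π.IsRegular Mg Mh)
    {f : (Fin (n + 1) → Draw S A H) → ℝ} (hm : Measurable f)
    (hf : Integrable f (M.runLaw π H k m c θ₁ (n + 1))) :
    Integrable (fun ξ => ∫ x, f (Fin.snoc (α := fun _ => Draw S A H) ξ x)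
          ∂(M.drawLaw π H (M.state π k m c θ₁ n ξ))) (M.runLaw π H k m c θ₁ n) := by
  have := isMarkovKernel_drawKernel (M := M) (H := H) (k := k) (m := m) (c := c) (θ₁ := θ₁)
    (n := n) hπ
  rw [runLaw_succ hπ] at hf
  rw [integrable_map_measure hm.aestronglyMeasurable (measurable_snoc_draw n).aemeasurable] at hf
  have h2 : Integrable (fun ξ => ∫ x, f (Fin.snoc (α := fun _ => Draw S A H) ξ x)
      ∂(M.drawKernel π H k m c θ₁ n ξ)) (M.runLaw π H k m c θ₁ n) := hf.integral_compProd
  simp_rw [drawKernel_apply hπ] at h2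
  exact h2

/-- The law of the first `n` draws of a run of `n + 1` iterations is the law of a run of `n`
iterations. -/
lemma integral_comp_castSucc (hπ : π.IsRegular Mg Mh)
    {f : (Fin n → Draw S A H) → ℝ} (hm : Measurable f) :
    ∫ ξ, f (fun i => ξ i.castSucc) ∂(M.runLaw π H k m c θ₁ (n + 1))
      = ∫ ξ, f ξ ∂(M.runLaw π H k m c θ₁ n) := by
  have := isMarkovKernel_drawKernel (M := M) (H := H) (k := k) (m := m) (c := c) (θ₁ := θ₁)
    (n := n) hπ
  have hc : Measurable (fun (ξ : Fin (n + 1) → Draw S A H) (i : Fin n) => ξ i.castSucc) := by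
    fun_prop
  have hmap : (M.runLaw π H k m c θ₁ (n + 1)).map (fun ξ (i : Fin n) => ξ i.castSucc)
      = M.runLaw π H k m c θ₁ n := by
    rw [runLaw_succ hπ, Measure.map_map hc (measurable_snoc_draw n)]
    have : (fun (ξ : Fin (n + 1) → Draw S A H) (i : Fin n) => ξ i.castSucc) ∘
        (fun p : (Fin n → Draw S A H) × Draw S A H =>
          Fin.snoc (α := fun _ => Draw S A H) p.1 p.2) = Prod.fst := by
      funext p i
      simp
    rw [this]
    exact Measure.fst_compProd _ _
  rw [← hmap, integral_map hc.aemeasurable hm.aestronglyMeasurable]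

lemma ae_validDraws (hπ : π.IsRegular Mg Mh) (n : ℕ) :
    ∀ᵐ ξ ∂(M.runLaw π H k m c θ₁ n), ValidDraws ξ := by
  have hms : ∀ n, MeasurableSet {ξ : Fin n → Draw S A H | ValidDraws ξ} := fun n => by
    have : {ξ : Fin n → Draw S A H | ValidDraws ξ}
        = ⋂ i, (fun ξ : Fin n → Draw S A H => (ξ i).1) ⁻¹' Set.Icc (0 : ℝ) 1 := by
      ext ξ; simp [ValidDraws]
    rw [this]
    exact MeasurableSet.iInter fun i => measurableSet_Icc.preimage (by fun_prop)
  induction n with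
  | zero => exact ae_of_all _ fun ξ i => i.elim0
  | succ n ih =>
    have := isMarkovKernel_drawKernel (M := M) (H := H) (k := k) (m := m) (c := c) (θ₁ := θ₁)
      (n := n) hπ
    rw [runLaw_succ hπ, ae_map_iff (measurable_snoc_draw n).aemeasurable (hms _)]
    refine Measure.ae_compProd_of_ae_ae (measurable_snoc_draw n (hms _)) ?_
    filter_upwards [ih] with ξ hξ
    rw [drawKernel_apply hπ]
    filter_upwards [M.ae_drawLaw_mem_Icc π _] with x hx
    exact hξ.snoc hx

/-- A function of the draws that is bounded on the valid ones is integrable. -/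
lemma integrable_runLaw (hπ : π.IsRegular Mg Mh) {f : (Fin n → Draw S A H) → ℝ}
    (hf : Measurable f) {K : ℝ} (hK : ∀ ξ, ValidDraws ξ → |f ξ| ≤ K) :
    Integrable f (M.runLaw π H k m c θ₁ n) := by
  have := isProbabilityMeasure_runLaw (M := M) (H := H) (k := k) (m := m) (c := c) (θ₁ := θ₁)
    hπ n
  refine Integrable.of_bound hf.aestronglyMeasurable K ?_
  filter_upwards [ae_validDraws hπ n] with ξ hξ using hK ξ hξ

lemma state_succ (M : MDP S A) (π : ParamPolicy (EuclideanSpace ℝ (Fin d)) S A) (k m c : ℝ)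
    (θ₁ : EuclideanSpace ℝ (Fin d)) (ξ : Fin (n + 1) → Draw S A H) :
    M.state π k m c θ₁ (n + 1) ξ = M.step π k m c n
      (M.state π k m c θ₁ n (fun i => ξ i.castSucc)) (ξ (Fin.last n)) := rfl

lemma state_snoc (M : MDP S A) (π : ParamPolicy (EuclideanSpace ℝ (Fin d)) S A) (k m c : ℝ)
    (θ₁ : EuclideanSpace ℝ (Fin d)) (ξ : Fin n → Draw S A H) (x : Draw S A H) :
    M.state π k m c θ₁ (n + 1) (Fin.snoc (α := fun _ => Draw S A H) ξ x) = M.step π k m c n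
      (M.state π k m c θ₁ n ξ) x := by
  rw [state_succ]
  simp

lemma cur_state_succ (ξ : Fin (n + 1) → Draw S A H) :
    (M.state π k m c θ₁ (n + 1) ξ).cur = (M.state π k m c θ₁ (n + 1) ξ).prev
      + stepSize k m (M.state π k m c θ₁ (n + 1) ξ).gsq • (M.state π k m c θ₁ (n + 1) ξ).u := rfl

lemma cur_state (ξ : Fin n → Draw S A H) :
    (M.state π k m c θ₁ n ξ).cur = (M.state π k m c θ₁ n ξ).prev
      + stepSize k m (M.state π k m c θ₁ n ξ).gsq • (M.state π k m c θ₁ n ξ).u := by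
  cases n with
  | zero => simp [state, AlgState.start]
  | succ n => exact cur_state_succ ξ

lemma gsq_state_nonneg (ξ : Fin n → Draw S A H) : 0 ≤ (M.state π k m c θ₁ n ξ).gsq := by
  induction n with
  | zero => simp [state, AlgState.start]
  | succ n ih =>
    rw [state_succ]
    exact add_nonneg (ih _) (sq_nonneg _)

variable {G L : ℝ}

namespace Admissible

lemma gsq_state_le (h : M.Admissible π H Mg Mh G L k c m) (ξ : Fin n → Draw S A H) :
    (M.state π k m c θ₁ n ξ).gsq ≤ n * G ^ 2 := by
  induction n with
  | zero => simp [state, AlgState.start]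
  | succ n ih =>
    rw [state_succ]
    have h1 := ih (fun i => ξ i.castSucc)
    have h2 := pow_le_pow_left₀ (norm_nonneg _) (h.norm_pgt_le (ξ (Fin.last n)).2
      (M.state π k m c θ₁ n (fun i => ξ i.castSucc)).cur) 2
    simp only [step]
    push_cast
    linarith

lemma norm_cur_sub_prev_le (h : M.Admissible π H Mg Mh G L k c m) (ξ : Fin n → Draw S A H) :
    L * ‖(M.state π k m c θ₁ n ξ).cur - (M.state π k m c θ₁ n ξ).prev‖
      ≤ 1 / 26 * ‖(M.state π k m c θ₁ n ξ).u‖ := by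
  have hg := gsq_state_nonneg (M := M) (π := π) (k := k) (m := m) (c := c) (θ₁ := θ₁) ξ
  rw [cur_state ξ, add_sub_cancel_left, norm_smul, Real.norm_of_nonneg (h.stepSize_pos hg).le,
    ← mul_assoc]
  exact mul_le_mul_of_nonneg_right (h.L_mul_stepSize_le hg) (norm_nonneg _)

/-- After `n` iterations, the estimator is bounded by a number that depends only on `n`. -/
lemma exists_norm_u_le (h : M.Admissible π H Mg Mh G L k c m) (n : ℕ) :
    ∃ K : ℝ, ∀ ξ : Fin n → Draw S A H, ValidDraws ξ → ‖(M.state π k m c θ₁ n ξ).u‖ ≤ K := by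
  induction n with
  | zero => exact ⟨0, fun ξ _ => by simp [state, AlgState.start]⟩
  | succ n ih =>
    obtain ⟨K, hK⟩ := ih
    have hL := h.L_pos
    have hG := h.G_pos
    have hMg := h.Mg_nonneg
    refine ⟨Real.exp (H * Mg * (1 / (26 * L) * K)) * G + (K + 3 / 2 * L * (1 / (26 * L) * K)),
      fun ξ hξ => ?_⟩
    have h1 := hK _ fun i : Fin n => hξ i.castSucc
    have h2 := h.norm_estimator_le n (gsq_state_nonneg _) (hξ (Fin.last n))
      (s := M.state π k m c θ₁ n (fun i => ξ i.castSucc))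
    have h3 := h.norm_cur_sub_prev_le (θ₁ := θ₁) (fun i : Fin n => ξ i.castSucc)
    rw [state_succ]
    refine h2.trans ?_
    have h4 : ‖(M.state π k m c θ₁ n (fun i => ξ i.castSucc)).cur
        - (M.state π k m c θ₁ n (fun i => ξ i.castSucc)).prev‖ ≤ 1 / (26 * L) * K := by
      rw [← mul_le_mul_iff_of_pos_left hL]
      refine h3.trans ((mul_le_mul_of_nonneg_left h1 (by norm_num)).trans_eq ?_)
      field_simp
    gcongr

lemma measurable_lyapunov (h : M.Admissible π H Mg Mh G L k c m) :
    Measurable (M.lyapunov π H G L k c m) := by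
  have hη : Measurable (fun s : AlgState d => stepSize k m s.gsq) :=
    (measurable_stepSize k m).comp AlgState.measurable_gsq
  have h1 : Measurable (fun s : AlgState d => M.perf π H s.prev) :=
    (M.measurable_perf h.regular h.Mg_nonneg).comp AlgState.measurable_prev
  have h2 : Measurable (fun s : AlgState d => huber (7 * G) ‖M.trackErr π H s‖) :=
    (measurable_huber _).comp h.measurable_trackErr.norm
  have h3 : Measurable (fun s : AlgState d => Real.log (G ^ 2 + s.gsq)) :=
    (AlgState.measurable_gsq.const_add _).log
  exact ((h1.const_mul 16).sub ((h2.mul ((hη.const_div 1).sub (hη.const_mul _))).div_const _)).add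
    (h3.const_mul _)

lemma measurable_min_u : Measurable (fun s : AlgState d => min G (‖s.u‖ / 10)) :=
  measurable_const.min (AlgState.measurable_u.norm.div_const _)

lemma measurable_gain (h : M.Admissible π H Mg Mh G L k c m) :
    Measurable (M.gain π H G k m) := by
  have hη : Measurable (fun s : AlgState d => stepSize k m s.gsq) :=
    (measurable_stepSize k m).comp AlgState.measurable_gsq
  have h1 : Measurable (fun s : AlgState d => gradient (M.perf π H) s.prev) :=
    (M.measurable_gradient_perf h.regular h.Mg_nonneg).comp AlgState.measurable_prev
  exact hη.mul (((h1.norm.pow_const 2).const_mul 2).add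
    ((measurable_min_u.pow_const 2).const_mul 2))

lemma exists_lyapunov_le (h : M.Admissible π H Mg Mh G L k c m) (n : ℕ) :
    ∃ K : ℝ, ∀ ξ : Fin n → Draw S A H, ValidDraws ξ →
      |M.lyapunov π H G L k c m (M.state π k m c θ₁ n ξ)| ≤ K := by
  obtain ⟨K, hK⟩ := h.exists_norm_u_le (θ₁ := θ₁) n
  have hL := h.L_pos
  have hG := h.G_pos
  have hc := h.c_pos
  have hk := h.k_pos
  have hn : 0 ≤ n * G ^ 2 := by positivity
  have hηn := h.stepSize_pos hn
  refine ⟨16 * (H * M.R) + (K + G) ^ 2 * (1 / stepSize k m (n * G ^ 2)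
      + c / 16 * stepSize k m 0) / (4 * L ^ 2)
    + c ^ 2 * k ^ 3 / (2 * L ^ 2) * (|Real.log (G ^ 2)| + |Real.log (G ^ 2 + n * G ^ 2)|),
    fun ξ hξ => ?_⟩
  have hg := gsq_state_nonneg (M := M) (π := π) (k := k) (m := m) (c := c) (θ₁ := θ₁) ξ
  have hg2 := h.gsq_state_le (θ₁ := θ₁) ξ
  have hu := hK ξ hξ
  set s := M.state π k m c θ₁ n ξ
  have hη := h.stepSize_pos hg
  have t1 : |16 * M.perf π H s.prev| ≤ 16 * (H * M.R) := by
    rw [abs_mul, abs_of_pos (by norm_num : (0 : ℝ) < 16)]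
    exact mul_le_mul_of_nonneg_left (M.abs_perf_le π _) (by norm_num)
  have t2 : |huber (7 * G) ‖M.trackErr π H s‖| ≤ (K + G) ^ 2 := by
    rw [abs_of_nonneg (huber_nonneg (by positivity))]
    refine (huber_le_sq _ _).trans (pow_le_pow_left₀ (norm_nonneg _) ?_ 2)
    exact (norm_sub_le _ _).trans (add_le_add hu (h.norm_gradient_le _))
  have t3 : |1 / stepSize k m s.gsq - c / 16 * stepSize k m s.gsq|
      ≤ 1 / stepSize k m (n * G ^ 2) + c / 16 * stepSize k m 0 := by
    refine (abs_sub _ _).trans (add_le_add ?_ ?_)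
    · rw [abs_of_pos (by positivity)]
      exact one_div_le_one_div_of_le hηn (h.stepSize_anti hg hg2)
    · rw [abs_of_pos (by positivity)]
      exact mul_le_mul_of_nonneg_left (h.stepSize_anti le_rfl hg) (by positivity)
  have t4 : |Real.log (G ^ 2 + s.gsq)|
      ≤ |Real.log (G ^ 2)| + |Real.log (G ^ 2 + n * G ^ 2)| := by
    have h3 : (0 : ℝ) < G ^ 2 := by positivity
    have l1 := Real.log_le_log h3 (by linarith : G ^ 2 ≤ G ^ 2 + s.gsq)
    have l2 := Real.log_le_log (by linarith) (by linarith : G ^ 2 + s.gsq ≤ G ^ 2 + n * G ^ 2)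
    refine abs_le.2 ⟨?_, ?_⟩
    · linarith [neg_abs_le (Real.log (G ^ 2)), abs_nonneg (Real.log (G ^ 2 + n * G ^ 2))]
    · linarith [le_abs_self (Real.log (G ^ 2 + n * G ^ 2)), abs_nonneg (Real.log (G ^ 2))]
  rw [lyapunov]
  refine (abs_add_le _ _).trans (add_le_add ((abs_sub _ _).trans (add_le_add t1 ?_)) ?_)
  · rw [abs_div, abs_mul, abs_of_pos (by positivity : 0 < 4 * L ^ 2)]
    gcongr
  · rw [abs_mul, abs_of_nonneg (by positivity)]
    gcongr

lemma gain_nonneg (h : M.Admissible π H Mg Mh G L k c m) {s : AlgState d} (hg : 0 ≤ s.gsq) :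
    0 ≤ M.gain π H G k m s := by
  have := h.stepSize_pos hg
  rw [gain]
  positivity

lemma gain_le (h : M.Admissible π H Mg Mh G L k c m) {s : AlgState d} (hg : 0 ≤ s.gsq) :
    M.gain π H G k m s ≤ stepSize k m 0 * (4 * G ^ 2) := by
  have hG := h.G_pos
  have h1 := pow_le_pow_left₀ (norm_nonneg _) (h.norm_gradient_le s.prev) 2
  have h2 := pow_le_pow_left₀ (le_min hG.le (by positivity : 0 ≤ ‖s.u‖ / 10))
    (min_le_left G (‖s.u‖ / 10)) 2
  exact mul_le_mul (h.stepSize_anti le_rfl hg) (by linarith) (by positivity)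
    (h.stepSize_pos le_rfl).le

end Admissible

end MDP

/-! ### Summation over the iterations -/

namespace MDP

variable {S A : Type*} [MeasurableSpace S] [MeasurableSpace A] {d H : ℕ}

/-- The sum of the gains over the first `n` iterations. -/
def cumGain (M : MDP S A) (π : ParamPolicy (EuclideanSpace ℝ (Fin d)) S A)
    (G k m c : ℝ) (θ₁ : EuclideanSpace ℝ (Fin d)) : (n : ℕ) → (Fin n → Draw S A H) → ℝ
  | 0, _ => 0
  | n + 1, ξ => M.cumGain π G k m c θ₁ n (fun i => ξ i.castSucc)
      + M.gain π H G k m (M.state π k m c θ₁ (n + 1) ξ)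

/-- `∑_{t ≤ n} (‖∇J(θ_t)‖ + min(G, ‖u_{t-1}‖ / 10))²`, a bound for the squared gradients along the
run, enlarged by what the gradient estimators can deviate from them by because trajectories are
not sampled at `θ_t`. -/
def cumSq (M : MDP S A) (π : ParamPolicy (EuclideanSpace ℝ (Fin d)) S A)
    (G k m c : ℝ) (θ₁ : EuclideanSpace ℝ (Fin d)) : (n : ℕ) → (Fin n → Draw S A H) → ℝ
  | 0, _ => 0
  | n + 1, ξ => M.cumSq π G k m c θ₁ n (fun i => ξ i.castSucc)
      + (‖gradient (M.perf π H) (M.state π k m c θ₁ n (fun i => ξ i.castSucc)).cur‖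
        + min G (‖(M.state π k m c θ₁ n (fun i => ξ i.castSucc)).u‖ / 10)) ^ 2

/-- The squared error of the gradient estimator at the parameter at which the trajectory of the
iteration is sampled. -/
def noiseSq (M : MDP S A) (π : ParamPolicy (EuclideanSpace ℝ (Fin d)) S A) (s : AlgState d)
    (x : Draw S A H) : ℝ :=
  ‖M.pgt π x.2 (s.query x.1) - gradient (M.perf π H) (s.query x.1)‖ ^ 2

/-- The sum of the squared errors `noiseSq` over the first `n` iterations. -/
def cumNoise (M : MDP S A) (π : ParamPolicy (EuclideanSpace ℝ (Fin d)) S A)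
    (k m c : ℝ) (θ₁ : EuclideanSpace ℝ (Fin d)) : (n : ℕ) → (Fin n → Draw S A H) → ℝ
  | 0, _ => 0
  | n + 1, ξ => M.cumNoise π k m c θ₁ n (fun i => ξ i.castSucc)
      + M.noiseSq π (M.state π k m c θ₁ n (fun i => ξ i.castSucc)) (ξ (Fin.last n))

variable {π : ParamPolicy (EuclideanSpace ℝ (Fin d)) S A} {Mg Mh : ℝ}
  {M : MDP S A} {G L k c m σ : ℝ} {θ₁ : EuclideanSpace ℝ (Fin d)} {n : ℕ}

namespace Admissible

lemma measurable_noiseSq (h : M.Admissible π H Mg Mh G L k c m) :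
    Measurable (fun p : AlgState d × Draw S A H => M.noiseSq π p.1 p.2) :=
  ((M.measurable_pgt_query h.regular).sub
    ((M.measurable_gradient_perf h.regular h.Mg_nonneg).comp measurable_query_prod)).norm.pow_const 2

lemma noiseSq_nonneg (s : AlgState d) (x : Draw S A H) : 0 ≤ M.noiseSq π s x := sq_nonneg _

lemma noiseSq_le (h : M.Admissible π H Mg Mh G L k c m) (s : AlgState d) (x : Draw S A H) :
    M.noiseSq π s x ≤ (G + G) ^ 2 :=
  pow_le_pow_left₀ (norm_nonneg _) ((norm_sub_le _ _).trans
    (add_le_add (h.norm_pgt_le _ _) (h.norm_gradient_le _))) 2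

lemma integrable_noiseSq (h : M.Admissible π H Mg Mh G L k c m) (s : AlgState d) :
    Integrable (M.noiseSq π s) (M.drawLaw π H s) :=
  M.integrable_drawLaw h.regular s (h.measurable_noiseSq.comp
    (f := fun x : Draw S A H => (s, x)) (by fun_prop)) (K := (G + G) ^ 2) fun x _ => by
      rw [Real.norm_of_nonneg (noiseSq_nonneg s x)]
      exact h.noiseSq_le s x

lemma integral_noiseSq_le (h : M.Admissible π H Mg Mh G L k c m)
    (hvar : ∀ θ, ∫ τ, ‖M.pgt π τ θ - gradient (M.perf π H) θ‖ ^ 2 ∂(M.trajLaw π H θ) ≤ σ ^ 2)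
    (s : AlgState d) : ∫ x, M.noiseSq π s x ∂(M.drawLaw π H s) ≤ σ ^ 2 := by
  have hi := h.integrable_noiseSq s
  rw [M.integral_drawLaw h.regular s hi]
  have := integral_mono_of_nonneg (μ := volume.restrict (Set.Icc (0 : ℝ) 1))
    (f := fun α => ∫ τ, M.noiseSq π s (α, τ) ∂(M.trajLaw π H (s.query α))) (g := fun _ => σ ^ 2)
    (ae_of_all _ fun α => integral_nonneg fun τ => noiseSq_nonneg s _) (integrable_const _)
    (ae_of_all _ fun α => hvar (s.query α))
  simpa using this

/-- The Lyapunov function after the first iteration, which has no momentum term. -/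
lemma integral_lyapunov_first (h : M.Admissible π H Mg Mh G L k c m)
    (hvar : ∀ θ, ∫ τ, ‖M.pgt π τ θ - gradient (M.perf π H) θ‖ ^ 2 ∂(M.trajLaw π H θ) ≤ σ ^ 2)
    (hi : Integrable (fun x => M.lyapunov π H G L k c m (M.step π k m c 0 (AlgState.start θ₁) x))
      (M.drawLaw π H (AlgState.start θ₁))) :
    16 * M.perf π H θ₁ - σ ^ 2 / (4 * L ^ 2 * stepSize k m 0)
      + c ^ 2 * k ^ 3 / (2 * L ^ 2) * Real.log (G ^ 2)
      ≤ ∫ x, M.lyapunov π H G L k c m (M.step π k m c 0 (AlgState.start θ₁) x)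
        ∂(M.drawLaw π H (AlgState.start θ₁)) := by
  have hg : 0 ≤ (AlgState.start θ₁).gsq := le_rfl
  have hprob := M.isProbabilityMeasure_drawLaw (H := H) h.regular (AlgState.start θ₁)
  have hL := h.L_pos
  have hG := h.G_pos
  have hk := h.k_pos
  have hη := h.stepSize_pos hg
  refine le_trans ?_ (h.integral_lyapunov_step_ge 0 hg hi)
  have hN : ∫ x, huber (7 * G) ‖M.trackErr π H (M.step π k m c 0 (AlgState.start θ₁) x)‖
      ∂(M.drawLaw π H (AlgState.start θ₁)) ≤ σ ^ 2 := by
    refine (integral_mono (h.integrable_huber_trackErr_step 0 hg)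
      (h.integrable_noiseSq (AlgState.start θ₁)) fun x => ?_).trans
      (h.integral_noiseSq_le hvar (AlgState.start θ₁))
    refine (huber_le_sq _ _).trans_eq ?_
    have hq : (AlgState.start θ₁).query x.1 = θ₁ := by
      rw [AlgState.query_eq]; simp [AlgState.start]
    rw [noiseSq, hq]
    rfl
  have hl : Real.log (G ^ 2) ≤ ∫ x, Real.log (G ^ 2 +
      (M.step π k m c 0 (AlgState.start θ₁) x).gsq) ∂(M.drawLaw π H (AlgState.start θ₁)) := by
    have := integral_mono (integrable_const (Real.log (G ^ 2)))
      (h.integrable_log_gsq_step 0 hg) fun x => by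
        refine Real.log_le_log (by positivity) (le_add_of_nonneg_right ?_)
        exact add_nonneg hg (sq_nonneg _)
    rwa [integral_const, probReal_univ, one_smul] at this
  have h1 : (0 : ℝ) < 4 * L ^ 2 * stepSize k m (AlgState.start θ₁).gsq := by positivity
  exact add_le_add (sub_le_sub le_rfl (div_le_div_of_nonneg_right hN h1.le))
    (mul_le_mul_of_nonneg_left hl (by positivity))

lemma measurable_lyapunov_state (h : M.Admissible π H Mg Mh G L k c m) (n : ℕ) :
    Measurable (fun ξ : Fin n → Draw S A H =>
      M.lyapunov π H G L k c m (M.state π k m c θ₁ n ξ)) :=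
  h.measurable_lyapunov.comp (M.measurable_state h.regular k m c θ₁ n)

lemma integrable_lyapunov_state (h : M.Admissible π H Mg Mh G L k c m) (n : ℕ) :
    Integrable (fun ξ => M.lyapunov π H G L k c m (M.state π k m c θ₁ n ξ))
      (M.runLaw π H k m c θ₁ n) := by
  obtain ⟨K, hK⟩ := h.exists_lyapunov_le (θ₁ := θ₁) n
  exact integrable_runLaw h.regular (h.measurable_lyapunov_state n) hK

lemma measurable_gain_state (h : M.Admissible π H Mg Mh G L k c m) (n : ℕ) :
    Measurable (fun ξ : Fin n → Draw S A H => M.gain π H G k m (M.state π k m c θ₁ n ξ)) :=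
  h.measurable_gain.comp (M.measurable_state h.regular k m c θ₁ n)

lemma integrable_gain_state (h : M.Admissible π H Mg Mh G L k c m) (n : ℕ) :
    Integrable (fun ξ => M.gain π H G k m (M.state π k m c θ₁ n ξ))
      (M.runLaw π H k m c θ₁ n) := by
  refine integrable_runLaw h.regular (h.measurable_gain_state n)
    (K := stepSize k m 0 * (4 * G ^ 2)) fun ξ _ => ?_
  rw [abs_of_nonneg (h.gain_nonneg (gsq_state_nonneg ξ))]
  exact h.gain_le (gsq_state_nonneg ξ)

lemma integrable_lyapunov_step (h : M.Admissible π H Mg Mh G L k c m)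
    {ξ : Fin n → Draw S A H} (hξ : ValidDraws ξ) :
    Integrable (fun x => M.lyapunov π H G L k c m
      (M.step π k m c n (M.state π k m c θ₁ n ξ) x))
      (M.drawLaw π H (M.state π k m c θ₁ n ξ)) := by
  obtain ⟨K, hK⟩ := h.exists_lyapunov_le (θ₁ := θ₁) (n + 1)
  refine M.integrable_drawLaw h.regular _
    (h.measurable_lyapunov.comp (h.measurable_step_right n _)) (K := K) fun x hx => ?_
  rw [Real.norm_eq_abs, ← state_snoc]
  exact hK _ (hξ.snoc hx)

lemma integral_lyapunov_state_succ (h : M.Admissible π H Mg Mh G L k c m) (n : ℕ) :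
    ∫ ξ, M.lyapunov π H G L k c m (M.state π k m c θ₁ (n + 1) ξ)
        ∂(M.runLaw π H k m c θ₁ (n + 1))
      = ∫ ξ, ∫ x, M.lyapunov π H G L k c m (M.step π k m c n (M.state π k m c θ₁ n ξ) x)
        ∂(M.drawLaw π H (M.state π k m c θ₁ n ξ)) ∂(M.runLaw π H k m c θ₁ n) := by
  rw [integral_runLaw_succ h.regular (h.measurable_lyapunov_state (n + 1))
    (h.integrable_lyapunov_state (n + 1))]
  simp_rw [state_snoc]

lemma integral_lyapunov_add_gain_le (h : M.Admissible π H Mg Mh G L k c m) (hn : n ≠ 0) :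
    ∫ ξ, M.lyapunov π H G L k c m (M.state π k m c θ₁ n ξ) ∂(M.runLaw π H k m c θ₁ n)
      + ∫ ξ, M.gain π H G k m (M.state π k m c θ₁ n ξ) ∂(M.runLaw π H k m c θ₁ n)
      ≤ ∫ ξ, M.lyapunov π H G L k c m (M.state π k m c θ₁ (n + 1) ξ)
        ∂(M.runLaw π H k m c θ₁ (n + 1)) := by
  rw [h.integral_lyapunov_state_succ, ← integral_add (h.integrable_lyapunov_state n)
    (h.integrable_gain_state n)]
  have hint := integrable_integral_drawLaw (n := n) (k := k) (m := m) (c := c) (θ₁ := θ₁)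
    h.regular (h.measurable_lyapunov_state (n + 1)) (h.integrable_lyapunov_state (n + 1))
  simp_rw [state_snoc] at hint
  refine integral_mono_ae ((h.integrable_lyapunov_state n).add (h.integrable_gain_state n))
    hint ?_
  filter_upwards [ae_validDraws h.regular n] with ξ hξ
  exact h.lyapunov_add_gain_le hn (cur_state ξ) (gsq_state_nonneg ξ)
    (h.integrable_lyapunov_step hξ)

lemma measurable_cumGain (h : M.Admissible π H Mg Mh G L k c m) (n : ℕ) :
    Measurable (M.cumGain π G k m c θ₁ n : (Fin n → Draw S A H) → ℝ) := by
  induction n with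
  | zero => exact measurable_const (a := (0 : ℝ))
  | succ n ih => exact (ih.comp (by fun_prop)).add (h.measurable_gain_state (n + 1))

lemma cumGain_nonneg (h : M.Admissible π H Mg Mh G L k c m) (ξ : Fin n → Draw S A H) :
    0 ≤ M.cumGain π G k m c θ₁ n ξ := by
  induction n with
  | zero => exact le_rfl
  | succ n ih => exact add_nonneg (ih _) (h.gain_nonneg (gsq_state_nonneg ξ))

lemma integrable_cumGain (h : M.Admissible π H Mg Mh G L k c m) (n : ℕ) :
    Integrable (M.cumGain π G k m c θ₁ n) (M.runLaw π H k m c θ₁ n) := by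
  have key : ∀ (n : ℕ) (ξ : Fin n → Draw S A H), M.cumGain π G k m c θ₁ n ξ
      ≤ n * (stepSize k m 0 * (4 * G ^ 2)) := by
    intro n
    induction n with
    | zero => intro ξ; simp [cumGain]
    | succ n ih =>
      intro ξ
      have h1 := ih (fun i => ξ i.castSucc)
      have h2 := h.gain_le (gsq_state_nonneg (M := M) (π := π) (k := k) (m := m) (c := c)
        (θ₁ := θ₁) ξ)
      rw [cumGain]
      push_cast
      linarith
  refine integrable_runLaw h.regular (h.measurable_cumGain n)
    (K := n * (stepSize k m 0 * (4 * G ^ 2))) fun ξ _ => ?_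
  rw [abs_of_nonneg (h.cumGain_nonneg ξ)]
  exact key n ξ

lemma integral_cumGain_succ (h : M.Admissible π H Mg Mh G L k c m) (n : ℕ) :
    ∫ ξ, M.cumGain π G k m c θ₁ (n + 1) ξ ∂(M.runLaw π H k m c θ₁ (n + 1))
      = ∫ ξ, M.cumGain π G k m c θ₁ n ξ ∂(M.runLaw π H k m c θ₁ n)
        + ∫ ξ, M.gain π H G k m (M.state π k m c θ₁ (n + 1) ξ)
          ∂(M.runLaw π H k m c θ₁ (n + 1)) := by
  have i1 := h.integrable_cumGain (θ₁ := θ₁) (n + 1)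
  have i2 := h.integrable_gain_state (θ₁ := θ₁) (n + 1)
  rw [← integral_comp_castSucc h.regular (h.measurable_cumGain n), ← sub_eq_iff_eq_add,
    ← integral_sub i1 i2]
  simp [cumGain]

/-- Telescoped over the iterations, the expected sum of the gains is at most the expected growth of
the Lyapunov function, which starts from its value after the first iteration. -/
lemma integral_cumGain_le_lyapunov (h : M.Admissible π H Mg Mh G L k c m)
    (hvar : ∀ θ, ∫ τ, ‖M.pgt π τ θ - gradient (M.perf π H) θ‖ ^ 2 ∂(M.trajLaw π H θ) ≤ σ ^ 2)
    (n : ℕ) :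
    16 * M.perf π H θ₁ - σ ^ 2 / (4 * L ^ 2 * stepSize k m 0)
        + c ^ 2 * k ^ 3 / (2 * L ^ 2) * Real.log (G ^ 2)
        + ∫ ξ, M.cumGain π G k m c θ₁ (n + 1) ξ ∂(M.runLaw π H k m c θ₁ (n + 1))
      ≤ ∫ ξ, M.lyapunov π H G L k c m (M.state π k m c θ₁ (n + 1) ξ)
          ∂(M.runLaw π H k m c θ₁ (n + 1))
        + ∫ ξ, M.gain π H G k m (M.state π k m c θ₁ (n + 1) ξ)
          ∂(M.runLaw π H k m c θ₁ (n + 1)) := by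
  induction n with
  | zero =>
    rw [h.integral_cumGain_succ]
    have h0 : ∫ ξ, M.cumGain π G k m c θ₁ 0 ξ ∂(M.runLaw π H k m c θ₁ 0) = 0 := by
      simp [cumGain]
    rw [h0, zero_add]
    refine add_le_add ?_ le_rfl
    rw [h.integral_lyapunov_state_succ, runLaw, integral_dirac]
    exact h.integral_lyapunov_first hvar
      (h.integrable_lyapunov_step (n := 0) (θ₁ := θ₁) (ξ := fun i => i.elim0) fun i => i.elim0)
  | succ n ih =>
    rw [h.integral_cumGain_succ]
    have := h.integral_lyapunov_add_gain_le (θ₁ := θ₁) (n := n + 1) n.succ_ne_zero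
    linarith

/-- The bound on the expected sum of the gains. -/
lemma integral_cumGain_le (h : M.Admissible π H Mg Mh G L k c m)
    (hvar : ∀ θ, ∫ τ, ‖M.pgt π τ θ - gradient (M.perf π H) θ‖ ^ 2 ∂(M.trajLaw π H θ) ≤ σ ^ 2)
    {T : ℕ} (hT : 0 < T) :
    ∫ ξ, M.cumGain π G k m c θ₁ T ξ ∂(M.runLaw π H k m c θ₁ T)
      ≤ 16 * ((⨆ θ, M.perf π H θ) - M.perf π H θ₁) + σ ^ 2 / (4 * L ^ 2 * stepSize k m 0)
        + c ^ 2 * k ^ 3 / (2 * L ^ 2) * Real.log (T + 1) := by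
  obtain ⟨n, rfl⟩ : ∃ n, T = n + 1 := ⟨T - 1, by omega⟩
  have hprob := isProbabilityMeasure_runLaw (M := M) (H := H) (k := k) (m := m) (c := c)
    (θ₁ := θ₁) h.regular (n + 1)
  have h1 := h.integral_cumGain_le_lyapunov (θ₁ := θ₁) hvar n
  have hG := h.G_pos
  have hL := h.L_pos
  have hk := h.k_pos
  have hpt : ∀ ξ : Fin (n + 1) → Draw S A H,
      M.lyapunov π H G L k c m (M.state π k m c θ₁ (n + 1) ξ)
        + M.gain π H G k m (M.state π k m c θ₁ (n + 1) ξ)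
      ≤ 16 * (⨆ θ, M.perf π H θ) + c ^ 2 * k ^ 3 / (2 * L ^ 2)
        * (Real.log (G ^ 2) + Real.log ((n + 1 : ℕ) + 1)) := by
    intro ξ
    have hg := gsq_state_nonneg (M := M) (π := π) (k := k) (m := m) (c := c) (θ₁ := θ₁) ξ
    refine (h.lyapunov_add_gain_le_perf (cur_state ξ) hg).trans (add_le_add ?_ ?_)
    · exact mul_le_mul_of_nonneg_left (le_ciSup (M.bddAbove_range_perf π) _) (by norm_num)
    · refine mul_le_mul_of_nonneg_left ?_ (by positivity)
      rw [← Real.log_mul (by positivity) (by positivity)]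
      refine Real.log_le_log (by positivity) ?_
      linarith [h.gsq_state_le (θ₁ := θ₁) ξ]
  have h2 := integral_mono ((h.integrable_lyapunov_state (θ₁ := θ₁) (n + 1)).add
    (h.integrable_gain_state (n + 1))) (integrable_const _) hpt
  rw [integral_add' (h.integrable_lyapunov_state (n + 1)) (h.integrable_gain_state (n + 1)),
    integral_const, probReal_univ, one_smul] at h2
  linarith

/-! ### The squared gradients along a run -/

lemma measurable_cumSq (h : M.Admissible π H Mg Mh G L k c m) (n : ℕ) :
    Measurable (M.cumSq π G k m c θ₁ n : (Fin n → Draw S A H) → ℝ) := by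
  induction n with
  | zero => exact measurable_const (a := (0 : ℝ))
  | succ n ih =>
    have hs : Measurable (fun ξ : Fin (n + 1) → Draw S A H =>
        M.state π k m c θ₁ n (fun i => ξ i.castSucc)) :=
      (M.measurable_state h.regular k m c θ₁ n).comp (by fun_prop)
    exact (ih.comp (by fun_prop)).add
      (((((M.measurable_gradient_perf h.regular h.Mg_nonneg).comp
        (AlgState.measurable_cur.comp hs)).norm).add (measurable_min_u.comp hs)).pow_const 2)

lemma cumSq_nonneg (ξ : Fin n → Draw S A H) : 0 ≤ M.cumSq π G k m c θ₁ n ξ := by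
  induction n with
  | zero => exact le_rfl
  | succ n ih => exact add_nonneg (ih _) (sq_nonneg _)

lemma min_u_nonneg (h : M.Admissible π H Mg Mh G L k c m) (s : AlgState d) :
    0 ≤ min G (‖s.u‖ / 10) := le_min h.G_pos.le (by positivity)

lemma cumSq_le (h : M.Admissible π H Mg Mh G L k c m) (ξ : Fin n → Draw S A H) :
    M.cumSq π G k m c θ₁ n ξ ≤ n * (4 * G ^ 2) := by
  induction n with
  | zero => simp [cumSq]
  | succ n ih =>
    have h1 := ih (fun i => ξ i.castSucc)
    have h2 : (‖gradient (M.perf π H) (M.state π k m c θ₁ n (fun i => ξ i.castSucc)).cur‖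
        + min G (‖(M.state π k m c θ₁ n (fun i => ξ i.castSucc)).u‖ / 10)) ^ 2
        ≤ (G + G) ^ 2 :=
      pow_le_pow_left₀ (add_nonneg (norm_nonneg _) (h.min_u_nonneg _))
        (add_le_add (h.norm_gradient_le _) (min_le_left _ _)) 2
    rw [cumSq]
    push_cast
    linarith

lemma measurable_cumNoise (h : M.Admissible π H Mg Mh G L k c m) (n : ℕ) :
    Measurable (M.cumNoise π k m c θ₁ n : (Fin n → Draw S A H) → ℝ) := by
  induction n with
  | zero => exact measurable_const (a := (0 : ℝ))
  | succ n ih =>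
    have hs : Measurable (fun ξ : Fin (n + 1) → Draw S A H =>
        M.state π k m c θ₁ n (fun i => ξ i.castSucc)) :=
      (M.measurable_state h.regular k m c θ₁ n).comp (by fun_prop)
    exact (ih.comp (by fun_prop)).add (h.measurable_noiseSq.comp
      (f := fun ξ : Fin (n + 1) → Draw S A H =>
        (M.state π k m c θ₁ n (fun i => ξ i.castSucc), ξ (Fin.last n)))
      (hs.prodMk (by fun_prop)))

lemma cumNoise_nonneg (ξ : Fin n → Draw S A H) : 0 ≤ M.cumNoise π k m c θ₁ n ξ := by
  induction n with
  | zero => exact le_rfl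
  | succ n ih => exact add_nonneg (ih _) (noiseSq_nonneg _ _)

lemma cumNoise_le (h : M.Admissible π H Mg Mh G L k c m) (ξ : Fin n → Draw S A H) :
    M.cumNoise π k m c θ₁ n ξ ≤ n * (4 * G ^ 2) := by
  induction n with
  | zero => simp [cumNoise]
  | succ n ih =>
    have h1 := ih (fun i => ξ i.castSucc)
    have h2 := h.noiseSq_le (M.state π k m c θ₁ n (fun i => ξ i.castSucc)) (ξ (Fin.last n))
    rw [cumNoise]
    push_cast
    linarith

lemma integrable_cumNoise (h : M.Admissible π H Mg Mh G L k c m) (n : ℕ) :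
    Integrable (M.cumNoise π k m c θ₁ n) (M.runLaw π H k m c θ₁ n) :=
  integrable_runLaw h.regular (h.measurable_cumNoise n) fun ξ _ => by
    rw [abs_of_nonneg (cumNoise_nonneg ξ)]
    exact h.cumNoise_le ξ

lemma integral_cumNoise_le (h : M.Admissible π H Mg Mh G L k c m)
    (hvar : ∀ θ, ∫ τ, ‖M.pgt π τ θ - gradient (M.perf π H) θ‖ ^ 2 ∂(M.trajLaw π H θ) ≤ σ ^ 2)
    (n : ℕ) : ∫ ξ, M.cumNoise π k m c θ₁ n ξ ∂(M.runLaw π H k m c θ₁ n) ≤ n * σ ^ 2 := by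
  induction n with
  | zero => simp [cumNoise]
  | succ n ih =>
    have hprob := isProbabilityMeasure_runLaw (M := M) (H := H) (k := k) (m := m) (c := c)
      (θ₁ := θ₁) h.regular n
    rw [integral_runLaw_succ h.regular (h.measurable_cumNoise _) (h.integrable_cumNoise _)]
    have e : ∀ ξ : Fin n → Draw S A H, ∫ x, M.cumNoise π k m c θ₁ (n + 1)
        (Fin.snoc (α := fun _ => Draw S A H) ξ x) ∂(M.drawLaw π H (M.state π k m c θ₁ n ξ))
        ≤ M.cumNoise π k m c θ₁ n ξ + σ ^ 2 := by
      intro ξ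
      have hp := M.isProbabilityMeasure_drawLaw (H := H) h.regular (M.state π k m c θ₁ n ξ)
      simp only [cumNoise, Fin.snoc_castSucc, Fin.snoc_last]
      rw [integral_add (integrable_const _) (h.integrable_noiseSq _), integral_const,
        probReal_univ, one_smul]
      linarith [h.integral_noiseSq_le hvar (M.state π k m c θ₁ n ξ)]
    have h2 := integral_mono (integrable_integral_drawLaw (n := n) h.regular
      (h.measurable_cumNoise _) (h.integrable_cumNoise (θ₁ := θ₁) _))
      ((h.integrable_cumNoise n).add (integrable_const (σ ^ 2))) e
    rw [integral_add' (h.integrable_cumNoise n) (integrable_const _), integral_const,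
      probReal_univ, one_smul] at h2
    push_cast
    linarith

/-- The gradient estimator of an iteration is controlled by its noise, the gradient, and the length
of the preceding step, although the trajectory is not sampled at the current parameter. -/
lemma norm_pgt_cur_le (h : M.Admissible π H Mg Mh G L k c m) {s : AlgState d}
    (hs : L * ‖s.cur - s.prev‖ ≤ 1 / 26 * ‖s.u‖) {x : Draw S A H}
    (hx : x.1 ∈ Set.Icc (0 : ℝ) 1) :
    ‖M.pgt π x.2 s.cur‖ ^ 2 ≤ 2 * M.noiseSq π s x
      + 2 * (‖gradient (M.perf π H) s.cur‖ + min G (‖s.u‖ / 10)) ^ 2 := by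
  have hL := h.L_pos
  have hR := M.R_pos.le
  have hq := s.norm_sub_query_le hx
  set q := s.query x.1 with hqdef
  have h1 : ‖M.pgt π x.2 s.cur - M.pgt π x.2 q‖ ≤ L * ‖s.cur - s.prev‖ :=
    (M.norm_pgt_sub_le h.regular h.Mh_nonneg x.2 q s.cur).trans
      (mul_le_mul h.hess_le hq (norm_nonneg _) hL.le)
  have h2 : ‖gradient (M.perf π H) q - gradient (M.perf π H) s.cur‖
      ≤ 3 / 2 * L * ‖s.cur - s.prev‖ := by
    rw [norm_sub_rev]
    refine (M.norm_gradient_perf_sub_le h.regular h.Mg_nonneg h.Mh_nonneg q s.cur).trans ?_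
    rw [← h.G_eq]
    exact mul_le_mul h.hess_le' hq (norm_nonneg _) (by positivity)
  have e : M.pgt π x.2 s.cur = (M.pgt π x.2 s.cur - M.pgt π x.2 q)
      + ((M.pgt π x.2 q - gradient (M.perf π H) q)
      + ((gradient (M.perf π H) q - gradient (M.perf π H) s.cur)
        + gradient (M.perf π H) s.cur)) := by abel
  have h3 : ‖M.pgt π x.2 s.cur‖ ≤ ‖M.pgt π x.2 q - gradient (M.perf π H) q‖
      + (‖gradient (M.perf π H) s.cur‖ + ‖s.u‖ / 10) := by
    have t1 := norm_add_le (M.pgt π x.2 s.cur - M.pgt π x.2 q)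
      ((M.pgt π x.2 q - gradient (M.perf π H) q)
      + ((gradient (M.perf π H) q - gradient (M.perf π H) s.cur)
        + gradient (M.perf π H) s.cur))
    have t2 := norm_add_le (M.pgt π x.2 q - gradient (M.perf π H) q)
      ((gradient (M.perf π H) q - gradient (M.perf π H) s.cur) + gradient (M.perf π H) s.cur)
    have t3 := norm_add_le (gradient (M.perf π H) q - gradient (M.perf π H) s.cur)
      (gradient (M.perf π H) s.cur)
    rw [← e] at t1
    linarith [norm_nonneg s.u]
  have h4 : ‖M.pgt π x.2 s.cur‖ ≤ ‖M.pgt π x.2 q - gradient (M.perf π H) q‖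
      + (‖gradient (M.perf π H) s.cur‖ + min G (‖s.u‖ / 10)) := by
    rcases min_cases G (‖s.u‖ / 10) with ⟨h5, -⟩ | ⟨h5, -⟩
    · rw [h5]
      linarith [h.norm_pgt_le x.2 s.cur, norm_nonneg (M.pgt π x.2 q - gradient (M.perf π H) q),
        norm_nonneg (gradient (M.perf π H) s.cur)]
    · rw [h5]; exact h3
  have h5 := pow_le_pow_left₀ (norm_nonneg _) h4 2
  rw [noiseSq, ← hqdef]
  nlinarith [sq_nonneg (‖M.pgt π x.2 q - gradient (M.perf π H) q‖
    - (‖gradient (M.perf π H) s.cur‖ + min G (‖s.u‖ / 10)))]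

lemma gsq_state_le_cum (h : M.Admissible π H Mg Mh G L k c m) {ξ : Fin n → Draw S A H}
    (hξ : ValidDraws ξ) :
    (M.state π k m c θ₁ n ξ).gsq
      ≤ 2 * M.cumNoise π k m c θ₁ n ξ + 2 * M.cumSq π G k m c θ₁ n ξ := by
  induction n with
  | zero => simp [cumNoise, cumSq, state, AlgState.start]
  | succ n ih =>
    have h1 := ih (ξ := fun i => ξ i.castSucc) fun i => hξ _
    have h2 := h.norm_pgt_cur_le (h.norm_cur_sub_prev_le (θ₁ := θ₁) (fun i => ξ i.castSucc))
      (hξ (Fin.last n))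
    rw [cumNoise, cumSq, state_succ]
    simp only [step]
    linarith

/-- Since the step sizes decrease, the last one times `cumSq` is bounded by the sum of the
gains. -/
lemma stepSize_mul_cumSq_le (h : M.Admissible π H Mg Mh G L k c m) (ξ : Fin n → Draw S A H) :
    stepSize k m (M.state π k m c θ₁ n ξ).gsq * (M.cumSq π G k m c θ₁ n ξ
      + 2 * min G (‖(M.state π k m c θ₁ n ξ).u‖ / 10) ^ 2) ≤ M.cumGain π G k m c θ₁ n ξ := by
  induction n with
  | zero =>
    have := h.G_pos.le
    simp [cumSq, cumGain, state, AlgState.start, this]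
  | succ n ih =>
    have h1 := ih (fun i => ξ i.castSucc)
    have hg := gsq_state_nonneg (M := M) (π := π) (k := k) (m := m) (c := c) (θ₁ := θ₁)
      (fun i => ξ i.castSucc)
    have hη : stepSize k m (M.state π k m c θ₁ (n + 1) ξ).gsq
        ≤ stepSize k m (M.state π k m c θ₁ n (fun i => ξ i.castSucc)).gsq :=
      h.stepSize_anti hg (le_add_of_nonneg_right (sq_nonneg _))
    have hη0 := h.stepSize_pos (gsq_state_nonneg (M := M) (π := π) (k := k) (m := m) (c := c)
      (θ₁ := θ₁) ξ)
    have hprev : (M.state π k m c θ₁ (n + 1) ξ).prev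
        = (M.state π k m c θ₁ n (fun i => ξ i.castSucc)).cur := rfl
    have hc0 := cumSq_nonneg (M := M) (π := π) (G := G) (k := k) (m := m) (c := c) (θ₁ := θ₁)
      (fun i => ξ i.castSucc)
    rw [cumSq, cumGain, gain, hprev]
    set s := M.state π k m c θ₁ n (fun i => ξ i.castSucc)
    set s' := M.state π k m c θ₁ (n + 1) ξ
    set Q := M.cumSq π G k m c θ₁ n (fun i => ξ i.castSucc)
    have h2 := mul_le_mul_of_nonneg_right hη
      (by positivity : 0 ≤ Q + 2 * min G (‖s.u‖ / 10) ^ 2)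
    have h3 : (‖gradient (M.perf π H) s.cur‖ + min G (‖s.u‖ / 10)) ^ 2
        ≤ 2 * ‖gradient (M.perf π H) s.cur‖ ^ 2 + 2 * min G (‖s.u‖ / 10) ^ 2 := by
      nlinarith [sq_nonneg (‖gradient (M.perf π H) s.cur‖ - min G (‖s.u‖ / 10))]
    have h4 := mul_le_mul_of_nonneg_left h3 hη0.le
    linarith

lemma sum_norm_gradient_iter_sq_le (h : M.Admissible π H Mg Mh G L k c m)
    (ξ : Fin n → Draw S A H) :
    ∑ t : Fin n, ‖gradient (M.perf π H) (M.iter π k m c θ₁ ξ t)‖ ^ 2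
      ≤ M.cumSq π G k m c θ₁ n ξ := by
  induction n with
  | zero => simp [cumSq]
  | succ n ih =>
    rw [Fin.sum_univ_castSucc, cumSq]
    refine add_le_add (ih (fun i => ξ i.castSucc)) ?_
    refine pow_le_pow_left₀ (norm_nonneg _) ?_ 2
    exact le_add_of_nonneg_right (h.min_u_nonneg _)

end Admissible

end MDP

/-! ### From the weighted sum of squared gradients to the mean gradient -/

/-- Jensen's inequality for a power with exponent in `[0, 1]`. -/
lemma integral_rpow_le_rpow_integral {Ω : Type*} [MeasurableSpace Ω] {μ : Measure Ω}
    [IsProbabilityMeasure μ] {f : Ω → ℝ} (hf : Integrable f μ) (hf0 : ∀ ω, 0 ≤ f ω) {p : ℝ}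
    (hp0 : 0 ≤ p) (hp1 : p ≤ 1) :
    Integrable (fun ω => f ω ^ p) μ ∧ ∫ ω, f ω ^ p ∂μ ≤ (∫ ω, f ω ∂μ) ^ p := by
  have hi : Integrable (fun ω => f ω ^ p) μ := by
    refine ((integrable_const (1 : ℝ)).add hf).mono'
      (hf.aestronglyMeasurable.aemeasurable.pow_const p).aestronglyMeasurable
      (ae_of_all _ fun ω => ?_)
    rw [Real.norm_of_nonneg (Real.rpow_nonneg (hf0 ω) p), Pi.add_apply]
    have h1 : f ω ^ p ≤ (1 + f ω) ^ p :=
      Real.rpow_le_rpow (hf0 ω) (by linarith) hp0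
    have h2 : (1 + f ω) ^ p ≤ (1 + f ω) ^ (1 : ℝ) :=
      Real.rpow_le_rpow_of_exponent_le (by linarith [hf0 ω]) hp1
    rw [Real.rpow_one] at h2
    exact h1.trans h2
  exact ⟨hi, (Real.concaveOn_rpow hp0 hp1).le_map_integral
    (Real.continuous_rpow_const hp0).continuousOn isClosed_Ici (ae_of_all _ hf0) hf hi⟩

/-- A Cauchy–Schwarz inequality for a random sum of squares `Q` that is controlled only after
multiplication with a step size which depends on `Q` itself. -/
lemma sq_integral_sqrt_le {Ω : Type*} [MeasurableSpace Ω] {μ : Measure Ω}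
    [IsProbabilityMeasure μ] {Q N g : Ω → ℝ} {k m I s : ℝ} (hk : 0 < k) (hm : 0 < m)
    (hQ : Integrable (fun ω => √(Q ω)) μ) (hQ0 : ∀ ω, 0 ≤ Q ω)
    (hN : Integrable N μ) (hN0 : ∀ ω, 0 ≤ N ω) (hNs : ∫ ω, N ω ∂μ ≤ s)
    (hg0 : ∀ ω, 0 ≤ g ω) (hg : ∀ᵐ ω ∂μ, g ω ≤ 2 * N ω + 2 * Q ω)
    (hi : Integrable (fun ω => stepSize k m (g ω) * Q ω) μ)
    (hI : ∫ ω, stepSize k m (g ω) * Q ω ∂μ ≤ k * I) :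
    (∫ ω, √(Q ω) ∂μ) ^ 2 ≤ I * ((m + 2 * s) ^ ((1 : ℝ) / 3)
      + (2 : ℝ) ^ ((1 : ℝ) / 3) * (∫ ω, √(Q ω) ∂μ) ^ ((2 : ℝ) / 3)) := by
  set x := ∫ ω, √(Q ω) ∂μ with hx
  set B := (m + 2 * s) ^ ((1 : ℝ) / 3) + (2 : ℝ) ^ ((1 : ℝ) / 3) * x ^ ((2 : ℝ) / 3)
  have hx0 : 0 ≤ x := integral_nonneg fun ω => Real.sqrt_nonneg _
  have hs : 0 ≤ s := (integral_nonneg fun ω => hN0 ω).trans hNs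
  have hB : 0 < B := add_pos_of_pos_of_nonneg (Real.rpow_pos_of_pos (by linarith) _) (by positivity)
  have hI0 : 0 ≤ I := by
    refine nonneg_of_mul_nonneg_right ((integral_nonneg fun ω => ?_).trans hI) hk
    have := hg0 ω
    exact mul_nonneg (div_nonneg hk.le (Real.rpow_nonneg (by linarith) _)) (hQ0 ω)
  rcases hx0.eq_or_lt with h0 | h0
  · rw [← h0]; simp only [ne_eq, OfNat.ofNat_ne_zero, not_false_eq_true, zero_pow]; positivity
  obtain ⟨iN, jN⟩ := integral_rpow_le_rpow_integral (μ := μ) (f := fun ω => m + 2 * N ω)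
    (p := 1 / 3) ((integrable_const m).add (hN.const_mul 2))
    (fun ω => by linarith [hN0 ω]) (by norm_num) (by norm_num)
  obtain ⟨iX, jX⟩ := integral_rpow_le_rpow_integral (μ := μ) (p := 2 / 3) hQ
    (fun ω => Real.sqrt_nonneg _) (by norm_num) (by norm_num)
  have jN' : ∫ ω, (m + 2 * N ω) ^ ((1 : ℝ) / 3) ∂μ ≤ (m + 2 * s) ^ ((1 : ℝ) / 3) := by
    refine jN.trans ?_
    rw [integral_add (integrable_const m) (hN.const_mul 2), integral_const, probReal_univ,
      one_smul, integral_const_mul]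
    have : 0 ≤ ∫ ω, N ω ∂μ := integral_nonneg fun ω => hN0 ω
    exact Real.rpow_le_rpow (by positivity) (by linarith) (by norm_num)
  -- the elementary inequality `2 √Q ≤ λ Q / D + D / λ` for `D = (m + g)^{1/3}`, `λ = B / x`
  have key : ∀ᵐ ω ∂μ, 2 * √(Q ω) ≤ B / x * (1 / k * (stepSize k m (g ω) * Q ω))
      + x / B * ((m + 2 * N ω) ^ ((1 : ℝ) / 3)
        + (2 : ℝ) ^ ((1 : ℝ) / 3) * √(Q ω) ^ ((2 : ℝ) / 3)) := by
    filter_upwards [hg] with ω hω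
    have hgω := hg0 ω
    have hNω := hN0 ω
    have hQω := hQ0 ω
    have hD : 0 < (m + g ω) ^ ((1 : ℝ) / 3) := Real.rpow_pos_of_pos (by linarith) _
    have h1 : (m + g ω) ^ ((1 : ℝ) / 3) ≤ (m + 2 * N ω) ^ ((1 : ℝ) / 3)
        + (2 : ℝ) ^ ((1 : ℝ) / 3) * √(Q ω) ^ ((2 : ℝ) / 3) := by
      have e : (2 : ℝ) ^ ((1 : ℝ) / 3) * √(Q ω) ^ ((2 : ℝ) / 3) = (2 * Q ω) ^ ((1 : ℝ) / 3) := by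
        rw [Real.mul_rpow (by norm_num) hQω, Real.sqrt_eq_rpow, ← Real.rpow_mul hQω]
        norm_num
      rw [e]
      refine le_trans (Real.rpow_le_rpow (by linarith) (by linarith : m + g ω
        ≤ (m + 2 * N ω) + 2 * Q ω) (by norm_num)) ?_
      exact Real.rpow_add_le_add_rpow (by linarith) (by linarith) (by norm_num) (by norm_num)
    refine le_trans ?_ (add_le_add le_rfl (mul_le_mul_of_nonneg_left h1 (by positivity)))
    rw [stepSize]
    set D := (m + g ω) ^ ((1 : ℝ) / 3)
    have hq := Real.sq_sqrt hQω
    set q := √(Q ω)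
    have e : B / x * (1 / k * (k / D * Q ω)) + x / B * D - 2 * q
        = (B * q - x * D) ^ 2 / (B * x * D) := by
      rw [← hq]; field_simp; ring
    have : 0 ≤ (B * q - x * D) ^ 2 / (B * x * D) := by positivity
    linarith
  have i1 := (hi.const_mul (1 / k)).const_mul (B / x)
  have i2 := (iN.add (iX.const_mul ((2 : ℝ) ^ ((1 : ℝ) / 3)))).const_mul (x / B)
  have h1 := integral_mono_ae (hQ.const_mul 2) (i1.add i2) key
  rw [integral_add' i1 i2, integral_const_mul, integral_const_mul, integral_const_mul,
    integral_const_mul, integral_add' iN (iX.const_mul _), integral_const_mul, ← hx] at h1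
  have h2 : 1 / k * ∫ ω, stepSize k m (g ω) * Q ω ∂μ ≤ I := by
    rw [one_div_mul_eq_div, div_le_iff₀ hk]; linarith
  have h3 : ∫ ω, (m + 2 * N ω) ^ ((1 : ℝ) / 3) ∂μ
      + (2 : ℝ) ^ ((1 : ℝ) / 3) * ∫ ω, √(Q ω) ^ ((2 : ℝ) / 3) ∂μ ≤ B :=
    add_le_add jN' (mul_le_mul_of_nonneg_left jX (by positivity))
  have h4 := mul_le_mul_of_nonneg_left h2 (by positivity : 0 ≤ B / x)
  have h5 := mul_le_mul_of_nonneg_left h3 (by positivity : 0 ≤ x / B)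
  rw [div_mul_cancel₀ _ hB.ne'] at h5
  have h6 : x ≤ B / x * I := by linarith
  rw [div_mul_eq_mul_div, le_div_iff₀ h0] at h6
  linarith

/-- The implicit inequality `x² ≤ Λ (v^{1/3} + 2^{1/3} x^{2/3})`, solved for `x`. -/
lemma le_of_sq_le_mul_add_rpow {x v Λ : ℝ} (hx : 0 ≤ x) (hv : 0 ≤ v) (hΛ : 0 ≤ Λ)
    (h : x ^ 2 ≤ Λ * (v ^ ((1 : ℝ) / 3) + (2 : ℝ) ^ ((1 : ℝ) / 3) * x ^ ((2 : ℝ) / 3))) :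
    x ≤ √(2 * Λ) * v ^ ((1 : ℝ) / 6) + 2 * Λ ^ ((3 : ℝ) / 4) := by
  have n1 : 0 ≤ √(2 * Λ) * v ^ ((1 : ℝ) / 6) := by positivity
  have n2 : 0 ≤ 2 * Λ ^ ((3 : ℝ) / 4) := by positivity
  rcases le_total ((2 : ℝ) ^ ((1 : ℝ) / 3) * x ^ ((2 : ℝ) / 3)) (v ^ ((1 : ℝ) / 3)) with h1 | h1
  · have h2 : x ^ 2 ≤ (√(2 * Λ) * v ^ ((1 : ℝ) / 6)) ^ 2 := by
      have e : (v ^ ((1 : ℝ) / 6)) ^ 2 = v ^ ((1 : ℝ) / 3) := by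
        rw [← Real.rpow_natCast, ← Real.rpow_mul hv]; norm_num
      rw [mul_pow, Real.sq_sqrt (by positivity), e]
      nlinarith
    linarith [abs_le_of_sq_le_sq' h2 n1 |>.2]
  · rcases hx.eq_or_lt with h0 | h0
    · rw [← h0]; positivity
    have h2 : x ^ 2 ≤ Λ * (2 * ((2 : ℝ) ^ ((1 : ℝ) / 3) * x ^ ((2 : ℝ) / 3))) :=
      h.trans (mul_le_mul_of_nonneg_left (by linarith) hΛ)
    have e1 : (2 : ℝ) * (2 : ℝ) ^ ((1 : ℝ) / 3) = (2 : ℝ) ^ ((4 : ℝ) / 3) := by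
      rw [← Real.rpow_one_add' (by norm_num) (by norm_num)]; norm_num
    have e2 : x ^ 2 = x ^ ((4 : ℝ) / 3) * x ^ ((2 : ℝ) / 3) := by
      rw [← Real.rpow_add h0, ← Real.rpow_natCast]; norm_num
    have h3 : x ^ ((4 : ℝ) / 3) ≤ (2 : ℝ) ^ ((4 : ℝ) / 3) * Λ := by
      refine le_of_mul_le_mul_right (a := x ^ ((2 : ℝ) / 3)) ?_ (Real.rpow_pos_of_pos h0 _)
      rw [← e1, ← e2]
      linarith
    have h4 := Real.rpow_le_rpow (by positivity) h3 (by norm_num : (0 : ℝ) ≤ 3 / 4)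
    rw [Real.mul_rpow (by positivity) hΛ, ← Real.rpow_mul hx, ← Real.rpow_mul (by norm_num)]
      at h4
    norm_num at h4
    linarith

/-- The bound of the theorem in terms of the number of iterations. -/
lemma bound_div_le {x m Λ σ T : ℝ} (hm : 0 ≤ m) (hσ : 0 ≤ σ)
    (hT : 0 < T)
    (h : x ≤ √(2 * Λ) * (m + 2 * (T * σ ^ 2)) ^ ((1 : ℝ) / 6) + 2 * Λ ^ ((3 : ℝ) / 4)) :
    x / √T ≤ (√(2 * Λ) * m ^ ((1 : ℝ) / 6) + 2 * Λ ^ ((3 : ℝ) / 4)) / √T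
      + 2 * √Λ * σ ^ ((1 : ℝ) / 3) / T ^ ((1 : ℝ) / 3) := by
  have h1 : (m + 2 * (T * σ ^ 2)) ^ ((1 : ℝ) / 6)
      ≤ m ^ ((1 : ℝ) / 6) + (2 * (T * σ ^ 2)) ^ ((1 : ℝ) / 6) :=
    Real.rpow_add_le_add_rpow hm (by positivity) (by norm_num) (by norm_num)
  have h2 : (2 * (T * σ ^ 2)) ^ ((1 : ℝ) / 6)
      = (2 : ℝ) ^ ((1 : ℝ) / 6) * (T ^ ((1 : ℝ) / 6) * σ ^ ((1 : ℝ) / 3)) := by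
    rw [Real.mul_rpow (by norm_num) (by positivity), Real.mul_rpow hT.le (by positivity),
      ← Real.rpow_natCast σ, ← Real.rpow_mul hσ]
    norm_num
  have h3 : √(2 * Λ) * (2 : ℝ) ^ ((1 : ℝ) / 6) ≤ 2 * √Λ := by
    rw [Real.sqrt_mul (by norm_num), Real.sqrt_eq_rpow 2]
    have : (2 : ℝ) ^ ((1 : ℝ) / 2) * (2 : ℝ) ^ ((1 : ℝ) / 6) ≤ 2 := by
      rw [← Real.rpow_add (by norm_num)]
      calc (2 : ℝ) ^ ((1 : ℝ) / 2 + 1 / 6) ≤ (2 : ℝ) ^ (1 : ℝ) :=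
            Real.rpow_le_rpow_of_exponent_le (by norm_num) (by norm_num)
        _ = 2 := Real.rpow_one 2
    nlinarith [Real.sqrt_nonneg Λ]
  have h4 : √T = T ^ ((1 : ℝ) / 6) * T ^ ((1 : ℝ) / 3) := by
    rw [Real.sqrt_eq_rpow, ← Real.rpow_add hT]; norm_num
  have h5 : 0 < T ^ ((1 : ℝ) / 6) := Real.rpow_pos_of_pos hT _
  have h6 : 0 < T ^ ((1 : ℝ) / 3) := Real.rpow_pos_of_pos hT _
  have e : 2 * √Λ * σ ^ ((1 : ℝ) / 3) / T ^ ((1 : ℝ) / 3)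
      = 2 * √Λ * (T ^ ((1 : ℝ) / 6) * σ ^ ((1 : ℝ) / 3)) / √T := by
    rw [h4]; field_simp
  rw [e, ← add_div]
  refine div_le_div_of_nonneg_right ?_ (Real.sqrt_nonneg _)
  have h7 := mul_le_mul_of_nonneg_left h1 (Real.sqrt_nonneg (2 * Λ))
  have h8 := mul_le_mul_of_nonneg_right h3
    (by positivity : 0 ≤ T ^ ((1 : ℝ) / 6) * σ ^ ((1 : ℝ) / 3))
  rw [h2] at h7
  linarith

namespace MDP

variable {S A : Type*} [MeasurableSpace S] [MeasurableSpace A] {d H : ℕ}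
  {π : ParamPolicy (EuclideanSpace ℝ (Fin d)) S A} {Mg Mh : ℝ}
  {M : MDP S A} {G L k c m σ : ℝ} {θ₁ : EuclideanSpace ℝ (Fin d)} {n : ℕ}

lemma isProbabilityMeasure_outLaw (hπ : π.IsRegular Mg Mh) {T : ℕ} (hT : 0 < T) :
    IsProbabilityMeasure (M.outLaw π H k m c θ₁ T) := by
  have := isProbabilityMeasure_runLaw (M := M) (H := H) (k := k) (m := m) (c := c)
    (θ₁ := θ₁) hπ T
  have : Nonempty (Fin T) := ⟨⟨0, hT⟩⟩
  have : IsProbabilityMeasure (uniformOn (Set.univ : Set (Fin T))) :=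
    isProbabilityMeasure_uniformOn Set.finite_univ Set.univ_nonempty
  unfold outLaw
  infer_instance

lemma measurable_norm_gradient_iter (hπ : π.IsRegular Mg Mh) (hMg : 0 ≤ Mg) {T : ℕ} (t : Fin T) :
    Measurable (fun ξ : Fin T → Draw S A H =>
      ‖gradient (M.perf π H) (M.iter π k m c θ₁ ξ t)‖) := by
  have h1 : Measurable (fun ξ : Fin T → Draw S A H =>
      M.state π k m c θ₁ t (fun i => ξ (Fin.castLE t.isLt.le i))) :=
    (M.measurable_state hπ k m c θ₁ t).comp (by fun_prop)
  exact ((M.measurable_gradient_perf hπ hMg).comp (AlgState.measurable_cur.comp h1)).norm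

namespace Admissible

lemma integrable_norm_gradient_iter (h : M.Admissible π H Mg Mh G L k c m) {T : ℕ} (t : Fin T) :
    Integrable (fun ξ => ‖gradient (M.perf π H) (M.iter π k m c θ₁ ξ t)‖)
      (M.runLaw π H k m c θ₁ T) :=
  integrable_runLaw h.regular (measurable_norm_gradient_iter h.regular h.Mg_nonneg t)
    (K := G) fun ξ _ => by
      rw [abs_norm]
      exact h.norm_gradient_le _

lemma integrable_norm_gradient_out (h : M.Admissible π H Mg Mh G L k c m) {T : ℕ} (hT : 0 < T) :
    Integrable (fun z => ‖gradient (M.perf π H) (M.iter π k m c θ₁ z.1 z.2)‖)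
      (M.outLaw π H k m c θ₁ T) := by
  have := isProbabilityMeasure_outLaw (M := M) (H := H) (k := k) (m := m) (c := c)
    (θ₁ := θ₁) h.regular hT
  have hm : Measurable (fun z : (Fin T → Draw S A H) × Fin T =>
      ‖gradient (M.perf π H) (M.iter π k m c θ₁ z.1 z.2)‖) :=
    measurable_from_prod_countable_left fun t =>
      measurable_norm_gradient_iter h.regular h.Mg_nonneg t
  refine Integrable.of_bound hm.aestronglyMeasurable G (ae_of_all _ fun z => ?_)
  rw [norm_norm]
  exact h.norm_gradient_le _

lemma integral_norm_gradient_out (h : M.Admissible π H Mg Mh G L k c m) {T : ℕ} (hT : 0 < T) :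
    ∫ z, ‖gradient (M.perf π H) (M.iter π k m c θ₁ z.1 z.2)‖ ∂(M.outLaw π H k m c θ₁ T)
      = 1 / T * ∫ ξ, ∑ t : Fin T, ‖gradient (M.perf π H) (M.iter π k m c θ₁ ξ t)‖
          ∂(M.runLaw π H k m c θ₁ T) := by
  have := isProbabilityMeasure_runLaw (M := M) (H := H) (k := k) (m := m) (c := c)
    (θ₁ := θ₁) h.regular T
  have : Nonempty (Fin T) := ⟨⟨0, hT⟩⟩
  have : IsProbabilityMeasure (uniformOn (Set.univ : Set (Fin T))) :=
    isProbabilityMeasure_uniformOn Set.finite_univ Set.univ_nonempty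
  have hi := h.integrable_norm_gradient_out (θ₁ := θ₁) hT
  rw [outLaw] at hi ⊢
  rw [integral_prod _ hi, ← integral_const_mul]
  congr 1 with ξ
  rw [integral_fintype Integrable.of_finite, Finset.mul_sum]
  refine Finset.sum_congr rfl fun t _ => ?_
  have : (uniformOn (Set.univ : Set (Fin T))).real {t} = 1 / T := by
    rw [Measure.real, uniformOn_univ]
    simp
  rw [this, smul_eq_mul]

/-- The output is as good as the square root of the mean of `cumSq`. -/
lemma integral_norm_gradient_out_le (h : M.Admissible π H Mg Mh G L k c m) {T : ℕ} (hT : 0 < T)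
    (hi : Integrable (fun ξ => √(M.cumSq π G k m c θ₁ T ξ)) (M.runLaw π H k m c θ₁ T)) :
    ∫ z, ‖gradient (M.perf π H) (M.iter π k m c θ₁ z.1 z.2)‖ ∂(M.outLaw π H k m c θ₁ T)
      ≤ (∫ ξ, √(M.cumSq π G k m c θ₁ T ξ) ∂(M.runLaw π H k m c θ₁ T)) / √T := by
  have hT' : (0 : ℝ) < T := by exact_mod_cast hT
  rw [h.integral_norm_gradient_out hT]
  have h1 : ∫ ξ, ∑ t : Fin T, ‖gradient (M.perf π H) (M.iter π k m c θ₁ ξ t)‖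
      ∂(M.runLaw π H k m c θ₁ T)
      ≤ ∫ ξ, √T * √(M.cumSq π G k m c θ₁ T ξ) ∂(M.runLaw π H k m c θ₁ T) := by
    refine integral_mono (integrable_finsetSum _ fun t _ => h.integrable_norm_gradient_iter t)
      (hi.const_mul _) fun ξ => ?_
    rw [← Real.sqrt_mul hT'.le]
    refine Real.le_sqrt_of_sq_le ?_
    have h2 := sq_sum_le_card_mul_sum_sq (s := (Finset.univ : Finset (Fin T)))
      (f := fun t => ‖gradient (M.perf π H) (M.iter π k m c θ₁ ξ t)‖)
    rw [Finset.card_univ, Fintype.card_fin] at h2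
    exact h2.trans (mul_le_mul_of_nonneg_left (h.sum_norm_gradient_iter_sq_le ξ) hT'.le)
  rw [integral_const_mul] at h1
  refine (mul_le_mul_of_nonneg_left h1 (by positivity)).trans_eq ?_
  have hs := Real.sq_sqrt hT'.le
  have hs0 : 0 < √(T : ℝ) := Real.sqrt_pos.2 hT'
  field_simp
  rw [hs]

/-- The convergence bound. -/
lemma integral_norm_gradient_out_le_bound (h : M.Admissible π H Mg Mh G L k c m) (hσ : 0 ≤ σ)
    (hvar : ∀ θ, ∫ τ, ‖M.pgt π τ θ - gradient (M.perf π H) θ‖ ^ 2 ∂(M.trajLaw π H θ) ≤ σ ^ 2)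
    {T : ℕ} (hT : 0 < T) {Λ : ℝ}
    (hΛ : 16 * ((⨆ θ, M.perf π H θ) - M.perf π H θ₁) + σ ^ 2 / (4 * L ^ 2 * stepSize k m 0)
        + c ^ 2 * k ^ 3 / (2 * L ^ 2) * Real.log (T + 1) ≤ k * Λ) :
    ∫ z, ‖gradient (M.perf π H) (M.iter π k m c θ₁ z.1 z.2)‖ ∂(M.outLaw π H k m c θ₁ T)
      ≤ (√(2 * Λ) * m ^ ((1 : ℝ) / 6) + 2 * Λ ^ ((3 : ℝ) / 4)) / √T
        + 2 * √Λ * σ ^ ((1 : ℝ) / 3) / (T : ℝ) ^ ((1 : ℝ) / 3) := by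
  have hT' : (0 : ℝ) < T := by exact_mod_cast hT
  have := isProbabilityMeasure_runLaw (M := M) (H := H) (k := k) (m := m) (c := c)
    (θ₁ := θ₁) h.regular T
  have hk := h.k_pos
  have hm := h.m_pos
  have iX : Integrable (fun ξ => √(M.cumSq π G k m c θ₁ T ξ)) (M.runLaw π H k m c θ₁ T) :=
    integrable_runLaw h.regular (h.measurable_cumSq T).sqrt (K := √(T * (4 * G ^ 2)))
      fun ξ _ => by
        rw [abs_of_nonneg (Real.sqrt_nonneg _)]
        exact Real.sqrt_le_sqrt (h.cumSq_le ξ)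
  have hpt : ∀ ξ : Fin T → Draw S A H, stepSize k m (M.state π k m c θ₁ T ξ).gsq
      * M.cumSq π G k m c θ₁ T ξ ≤ M.cumGain π G k m c θ₁ T ξ := fun ξ => by
    refine le_trans (mul_le_mul_of_nonneg_left ?_ (h.stepSize_pos (gsq_state_nonneg ξ)).le)
      (h.stepSize_mul_cumSq_le ξ)
    exact le_add_of_nonneg_right (by positivity)
  have iQ : Integrable (fun ξ => stepSize k m (M.state π k m c θ₁ T ξ).gsq
      * M.cumSq π G k m c θ₁ T ξ) (M.runLaw π H k m c θ₁ T) := by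
    refine (h.integrable_cumGain T).mono' (((measurable_stepSize k m).comp
      (AlgState.measurable_gsq.comp (M.measurable_state h.regular k m c θ₁ T))).mul
      (h.measurable_cumSq T)).aestronglyMeasurable (ae_of_all _ fun ξ => ?_)
    rw [Real.norm_of_nonneg (mul_nonneg (h.stepSize_pos (gsq_state_nonneg ξ)).le
      (cumSq_nonneg ξ))]
    exact hpt ξ
  have hI : ∫ ξ, stepSize k m (M.state π k m c θ₁ T ξ).gsq * M.cumSq π G k m c θ₁ T ξ
      ∂(M.runLaw π H k m c θ₁ T) ≤ k * Λ :=
    (integral_mono iQ (h.integrable_cumGain T) hpt).trans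
      ((h.integral_cumGain_le hvar hT).trans hΛ)
  have hΛ0 : 0 ≤ Λ := by
    refine nonneg_of_mul_nonneg_right ((integral_nonneg fun ξ => ?_).trans hI) hk
    exact mul_nonneg (h.stepSize_pos (gsq_state_nonneg ξ)).le (cumSq_nonneg ξ)
  have hsq := sq_integral_sqrt_le hk hm iX cumSq_nonneg (h.integrable_cumNoise T)
    cumNoise_nonneg (h.integral_cumNoise_le hvar T) gsq_state_nonneg
    ((ae_validDraws h.regular T).mono fun ξ hξ => h.gsq_state_le_cum hξ) iQ hI
  refine (h.integral_norm_gradient_out_le hT iX).trans (bound_div_le hm.le hσ hT' ?_)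
  exact le_of_sq_le_mul_add_rpow (integral_nonneg fun ξ => Real.sqrt_nonneg _) (by positivity)
    hΛ0 hsq

end Admissible

end MDP

/-! ### Sample complexity -/

lemma one_le_log_add_two {T : ℝ} (hT : 1 ≤ T) : 1 ≤ Real.log (T + 2) := by
  rw [Real.le_log_iff_exp_le (by linarith)]
  linarith [Real.exp_one_lt_three]

lemma log_add_two_le {T : ℝ} (hT : 1 ≤ T) : Real.log (T + 2) ≤ 2 + Real.log T := by
  have h3 : Real.log 3 ≤ 2 := by
    have := Real.log_le_sub_one_of_pos (by norm_num : (0 : ℝ) < 3)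
    linarith
  calc Real.log (T + 2) ≤ Real.log (3 * T) := Real.log_le_log (by linarith) (by linarith)
    _ = Real.log 3 + Real.log T := Real.log_mul (by norm_num) (by linarith)
    _ ≤ _ := by linarith

/-- If `Λ` grows at most logarithmically, then the slowest term `√Λ / T^{1/3}` dominates the
convergence bound. -/
lemma bound_le_sqrt_log_div {μ ς Λ D T : ℝ} (hμ : 0 ≤ μ) (hς : 0 ≤ ς) (hT : 1 ≤ T)
    (hΛ0 : 0 ≤ Λ) (hΛ : Λ ≤ D * Real.log (T + 2)) :
    (√(2 * Λ) * μ + 2 * Λ ^ ((3 : ℝ) / 4)) / √T + 2 * √Λ * ς / T ^ ((1 : ℝ) / 3)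
      ≤ (√(2 * D) * μ + 4 * D ^ ((3 : ℝ) / 4) + 2 * √D * ς)
        * (√(Real.log (T + 2)) / T ^ ((1 : ℝ) / 3)) := by
  have hT0 : 0 < T := by linarith
  have hl1 := one_le_log_add_two hT
  have hD : 0 ≤ D := nonneg_of_mul_nonneg_left (hΛ0.trans hΛ) (by linarith)
  have hl := log_add_two_le hT
  set l := Real.log (T + 2)
  have hl0 : 0 ≤ l := by linarith
  set y := T ^ ((1 : ℝ) / 3) with hy
  have hy1 : 1 ≤ y := Real.one_le_rpow hT (by norm_num)
  have hy0 : 0 < y := by linarith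
  have hTy : T = y ^ 3 := by
    rw [hy, ← Real.rpow_natCast, ← Real.rpow_mul hT0.le]; norm_num
  have hl4 : l ≤ (2 * y) ^ 2 := by
    have h1 : Real.log T ≤ 3 * (y - 1) := by
      rw [hTy, Real.log_pow]
      have := Real.log_le_sub_one_of_pos hy0
      push_cast
      linarith
    nlinarith [sq_nonneg (2 * y - 1)]
  have hsy : y ≤ √T := by
    refine Real.le_sqrt_of_sq_le ?_
    rw [hTy]
    nlinarith [sq_nonneg y]
  have hsT : 0 < √T := Real.sqrt_pos.2 hT0
  have h1 : √(2 * Λ) ≤ √(2 * D) * √l := by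
    rw [← Real.sqrt_mul (by positivity)]
    exact Real.sqrt_le_sqrt (by linarith)
  have h2 : √Λ ≤ √D * √l := by
    rw [← Real.sqrt_mul hD]
    exact Real.sqrt_le_sqrt hΛ
  have h3 : Λ ^ ((3 : ℝ) / 4) ≤ D ^ ((3 : ℝ) / 4) * l ^ ((3 : ℝ) / 4) := by
    rw [← Real.mul_rpow hD hl0]
    exact Real.rpow_le_rpow hΛ0 hΛ (by norm_num)
  -- `l^{3/4} / √T = (√l / T^{1/3})^{3/2}`, and `√l / T^{1/3} ≤ 2`
  have h4 : l ^ ((3 : ℝ) / 4) / √T ≤ 2 * (√l / y) := by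
    have e1 : l ^ ((3 : ℝ) / 4) = √l * √(√l) := by
      simp only [Real.sqrt_eq_rpow]
      rw [← Real.rpow_mul hl0, ← Real.rpow_add (by linarith)]
      norm_num
    have e2 : √T = y * √y := by
      rw [hTy, show y ^ 3 = y ^ 2 * y by ring, Real.sqrt_mul (by positivity),
        Real.sqrt_sq hy0.le]
    have e3 : √(√l) ≤ 2 * √y := by
      have : √l ≤ 2 ^ 2 * y := by
        rw [Real.sqrt_le_left (by positivity)]
        refine hl4.trans ?_
        nlinarith [sq_nonneg y]
      calc √(√l) ≤ √(2 ^ 2 * y) := Real.sqrt_le_sqrt this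
        _ = 2 * √y := by rw [Real.sqrt_mul (by norm_num), Real.sqrt_sq (by norm_num)]
    have hsy0 : 0 < √y := Real.sqrt_pos.2 hy0
    rw [e1, e2, div_le_iff₀ (by positivity)]
    have : 2 * (√l / y) * (y * √y) = √l * (2 * √y) := by field_simp
    rw [this]
    exact mul_le_mul_of_nonneg_left e3 (Real.sqrt_nonneg _)
  have h5 : √(2 * Λ) * μ / √T ≤ √(2 * D) * μ * (√l / y) := by
    calc √(2 * Λ) * μ / √T ≤ √(2 * D) * √l * μ / y := by gcongr
      _ = _ := by ring
  have h6 : 2 * Λ ^ ((3 : ℝ) / 4) / √T ≤ 4 * D ^ ((3 : ℝ) / 4) * (√l / y) := by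
    calc 2 * Λ ^ ((3 : ℝ) / 4) / √T ≤ 2 * (D ^ ((3 : ℝ) / 4) * l ^ ((3 : ℝ) / 4)) / √T := by
          gcongr
      _ = 2 * D ^ ((3 : ℝ) / 4) * (l ^ ((3 : ℝ) / 4) / √T) := by ring
      _ ≤ 2 * D ^ ((3 : ℝ) / 4) * (2 * (√l / y)) := by gcongr
      _ = _ := by ring
  have h7 : 2 * √Λ * ς / y ≤ 2 * √D * ς * (√l / y) := by
    calc 2 * √Λ * ς / y ≤ 2 * (√D * √l) * ς / y := by gcongr
      _ = _ := by ring
  rw [add_div]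
  linarith

/-- `T ≥ K³ ε⁻³ log(1/ε)^{3/2}` iterations make `√(log T) / T^{1/3}` of the order of `ε`. -/
lemma sqrt_log_div_le {B ε T : ℝ} (hε : 0 < ε) (hε2 : ε ≤ 1 / 2) (hT : 1 ≤ T)
    (h : (13 * B ^ 2 + 2) ^ 3 * ε⁻¹ ^ 3 * Real.log ε⁻¹ ^ ((3 : ℝ) / 2) ≤ T) :
    B * (√(Real.log (T + 2)) / T ^ ((1 : ℝ) / 3)) ≤ ε := by
  have hT0 : 0 < T := by linarith
  have hl := log_add_two_le hT
  have hℓ : 1 / 2 ≤ Real.log ε⁻¹ := by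
    have : (2 : ℝ) ≤ ε⁻¹ := by
      rw [le_inv_comm₀ (by norm_num) hε]; linarith
    have := Real.log_le_log (by norm_num) this
    linarith [Real.log_two_gt_d9]
  set ℓ := Real.log ε⁻¹ with hℓdef
  set y := T ^ ((1 : ℝ) / 3) with hy
  have hy0 : 0 < y := Real.rpow_pos_of_pos hT0 _
  have hTy : T = y ^ 3 := by
    rw [hy, ← Real.rpow_natCast, ← Real.rpow_mul hT0.le]; norm_num
  set K := 13 * B ^ 2 + 2 with hK
  have hK2 : 2 ≤ K := by nlinarith [sq_nonneg B]
  have hp : K * √ℓ ≤ y * ε := by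
    have h1 : (K * ε⁻¹ * √ℓ) ^ 3 ≤ y ^ 3 := by
      rw [← hTy]
      refine le_trans (le_of_eq ?_) h
      rw [mul_pow, mul_pow, Real.sqrt_eq_rpow, ← Real.rpow_natCast (ℓ ^ _),
        ← Real.rpow_mul (by linarith)]
      norm_num
    have h2 : K * ε⁻¹ * √ℓ ≤ y := le_of_pow_le_pow_left₀ (by norm_num) hy0.le h1
    calc K * √ℓ = K * ε⁻¹ * √ℓ * ε := by field_simp
      _ ≤ y * ε := mul_le_mul_of_nonneg_right h2 hε.le
  set p := y * ε with hpdef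
  have hp0 : 0 < p := mul_pos hy0 hε
  have hsq : √ℓ ^ 2 = ℓ := Real.sq_sqrt (by linarith)
  have hs : 1 / 2 ≤ √ℓ := Real.le_sqrt_of_sq_le (by linarith)
  have hpK : K ≤ 2 * p := by nlinarith
  have hpℓ : K * ℓ ≤ p ^ 2 := by
    have h1 := pow_le_pow_left₀ (by positivity) hp 2
    rw [mul_pow, hsq] at h1
    have h2 : K * ℓ ≤ K ^ 2 * ℓ := mul_le_mul_of_nonneg_right (by nlinarith) (by linarith)
    exact h2.trans h1
  have hlogT : Real.log T ≤ 3 * p + 3 * ℓ := by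
    have e : y = p * ε⁻¹ := by rw [hpdef]; field_simp
    rw [hTy, Real.log_pow, e, Real.log_mul hp0.ne' (by positivity), ← hℓdef]
    have := Real.log_le_sub_one_of_pos hp0
    push_cast
    linarith
  have hKl : K * Real.log (T + 2) ≤ 13 * p ^ 2 := by
    calc K * Real.log (T + 2) ≤ K * (2 + (3 * p + 3 * ℓ)) := by gcongr; linarith
      _ ≤ K * (5 * p) + 3 * (K * ℓ) := by nlinarith
      _ ≤ 2 * p * (5 * p) + 3 * p ^ 2 := by gcongr
      _ = _ := by ring
  have hBl : B ^ 2 * Real.log (T + 2) ≤ p ^ 2 := by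
    have := one_le_log_add_two hT
    nlinarith
  have hfin : B * √(Real.log (T + 2)) ≤ p := by
    refine (abs_le_of_sq_le_sq' ?_ hp0.le).2
    rw [mul_pow, Real.sq_sqrt (by linarith [one_le_log_add_two hT])]
    exact hBl
  rw [← mul_div_assoc, div_le_iff₀ hy0, mul_comm ε]
  exact hfin

/-! ### The constants of the algorithm -/

namespace MDP

variable {S A : Type*} [MeasurableSpace S] [MeasurableSpace A] {d H : ℕ}
  {π : ParamPolicy (EuclideanSpace ℝ (Fin d)) S A}

/-- The constants prescribed by the algorithm are admissible. -/
lemma Admissible.of_eq (M : MDP S A) {Mg Mh G L k c m : ℝ} (hπ : π.IsRegular Mg Mh)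
    (hMg : 0 < Mg) (hMh : 0 < Mh)
    (hG : G = Mg * M.R / (1 - M.γ) ^ 2)
    (hL : L = max (Mh * M.R / (1 - M.γ) ^ 2)
      (Real.sqrt (((H : ℝ) ^ 2 * Mg ^ 4 * M.R ^ 2 + Mh ^ 2 * M.R ^ 2) / (1 - M.γ) ^ 4)))
    (hk : 0 < k)
    (hc : c = G ^ 2 / (3 * k ^ 3 * L) + 52 * L ^ 2)
    (hm : m = max (2 * G ^ 2) (max ((2 * L * k) ^ 3) ((c * k / (2 * L)) ^ 3))) :
    M.Admissible π H Mg Mh G L k c m := by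
  have hR := M.R_pos
  have hγ : 0 < 1 - M.γ := sub_pos.2 M.γ_lt_one
  have hb : 0 < Mh * M.R / (1 - M.γ) ^ 2 := by positivity
  have hbL : Mh * M.R / (1 - M.γ) ^ 2 ≤ L := hL ▸ le_max_left _ _
  have hG0 : 0 < G := by rw [hG]; positivity
  have ha : 0 ≤ H * Mg * G := by positivity
  have hsq : (H * Mg * G) ^ 2 + (Mh * M.R / (1 - M.γ) ^ 2) ^ 2 ≤ L ^ 2 := by
    have h1 : Real.sqrt (((H : ℝ) ^ 2 * Mg ^ 4 * M.R ^ 2 + Mh ^ 2 * M.R ^ 2)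
      / (1 - M.γ) ^ 4) ≤ L := hL ▸ le_max_right _ _
    have h2 := (Real.sqrt_le_left (hb.le.trans hbL)).1 h1
    refine le_trans (le_of_eq ?_) h2
    rw [hG]
    field_simp
  have hL0 : 0 < L := hb.trans_le hbL
  exact
    { G_pos := hG0
      L_pos := hL0
      k_pos := hk
      c_eq := hc
      sq_le := hm ▸ le_max_left _ _
      cube_le := hm ▸ (le_max_right _ _).trans (le_max_right _ _)
      regular := hπ
      Mg_nonneg := hMg.le
      Mh_nonneg := hMh.le
      G_eq := hG
      score_mul_le := (abs_le_of_sq_le_sq' (by nlinarith) hL0.le).2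
      hess_le := hbL
      hess_sq_le := by nlinarith [sq_nonneg (H * Mg * G - Mh * M.R / (1 - M.γ) ^ 2)] }

end MDP

end

theorem theorem2 {S A : Type*} [MeasurableSpace S] [MeasurableSpace A]
    (d H : ℕ) (M : MDP S A) (π : ParamPolicy (EuclideanSpace ℝ (Fin d)) S A)
    -- bounded gradient and Hessian of `log π_θ(a | s)`
    (Mg Mh : ℝ) (hMg : 0 < Mg) (hMh : 0 < Mh)
    (hdiff : ∀ s a, Differentiable ℝ (fun θ => Real.log (π.dens θ s a)))
    (hdiff2 : ∀ s a, Differentiable ℝ (gradient (fun θ => Real.log (π.dens θ s a))))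
    (hgrad : ∀ θ s a, ‖gradient (fun x => Real.log (π.dens x s a)) θ‖ ≤ Mg)
    (hhess : ∀ θ s a, ‖fderiv ℝ (gradient (fun x => Real.log (π.dens x s a))) θ‖ ≤ Mh)
    -- bounded variance of the stochastic gradient
    (σ : ℝ) (hσ : 0 < σ)
    (hvar : ∀ θ, ∫ τ, ‖M.pgt π τ θ - gradient (M.perf π H) θ‖ ^ 2 ∂(M.trajLaw π H θ) ≤ σ ^ 2)
    -- bounded variance of the importance weights
    (W : ℝ) (hW : 0 < W)
    (hweight : ∀ θ₁ θ₂, evariance (fun τ => π.weight τ θ₁ θ₂) (M.trajLaw π H θ₂)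
      ≤ ENNReal.ofReal W)
    -- the constants
    (G L k c m : ℝ)
    (hG : G = Mg * M.R / (1 - M.γ) ^ 2)
    (hL : L = max (Mh * M.R / (1 - M.γ) ^ 2)
      (Real.sqrt (((H : ℝ) ^ 2 * Mg ^ 4 * M.R ^ 2 + Mh ^ 2 * M.R ^ 2) / (1 - M.γ) ^ 4)))
    (hk : 0 < k)
    (hc : c = G ^ 2 / (3 * k ^ 3 * L) + 52 * L ^ 2)
    (hm : m = max (2 * G ^ 2) (max ((2 * L * k) ^ 3) ((c * k / (2 * L)) ^ 3)))
    (θ₁ : EuclideanSpace ℝ (Fin d))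
    (Λ : ℕ → ℝ)
    (hΛ : ∀ T : ℕ, Λ T = 1 / k * (16 * ((⨆ θ, M.perf π H θ) - M.perf π H θ₁)
      + m ^ ((1 : ℝ) / 3) / (4 * L ^ 2 * k) * σ ^ 2
      + (W + 1) * c ^ 2 * k ^ 3 / (2 * L ^ 2) * Real.log ((T : ℝ) + 2))) :
    -- the objects in the bound are well defined
    Differentiable ℝ (M.perf π H) ∧ BddAbove (Set.range (M.perf π H)) ∧
    (∀ T : ℕ, 0 < T →
      IsProbabilityMeasure (M.outLaw π H k m c θ₁ T) ∧
      Integrable (fun z => ‖gradient (M.perf π H) (M.iter π k m c θ₁ z.1 z.2)‖)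
        (M.outLaw π H k m c θ₁ T) ∧
      -- the convergence bound
      ∫ z, ‖gradient (M.perf π H) (M.iter π k m c θ₁ z.1 z.2)‖ ∂(M.outLaw π H k m c θ₁ T)
        ≤ (Real.sqrt (2 * Λ T) * m ^ ((1 : ℝ) / 6) + 2 * Λ T ^ ((3 : ℝ) / 4)) / Real.sqrt T
          + 2 * Real.sqrt (Λ T) * σ ^ ((1 : ℝ) / 3) / (T : ℝ) ^ ((1 : ℝ) / 3)) ∧
    -- `Λ = O(ln T)`
    Λ =O[atTop] (fun T : ℕ => Real.log T) ∧
    -- sample complexity: with one trajectory per iteration, `O(ε⁻³)` trajectories suffice up to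
    -- a logarithmic factor
    (∃ C : ℝ, 0 < C ∧ ∀ ε : ℝ, 0 < ε → ε ≤ 1 / 2 → ∀ T : ℕ,
      C * ε⁻¹ ^ 3 * Real.log ε⁻¹ ^ ((3 : ℝ) / 2) ≤ T →
      ∫ z, ‖gradient (M.perf π H) (M.iter π k m c θ₁ z.1 z.2)‖ ∂(M.outLaw π H k m c θ₁ T)
        ≤ ε) := by
  have hadm : M.Admissible π H Mg Mh G L k c m :=
    MDP.Admissible.of_eq M ⟨hdiff, hdiff2, hgrad, hhess⟩ hMg hMh hG hL hk hc hm
  have hL0 := hadm.L_pos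
  have hm0 := hadm.m_pos
  have hbdd := M.bddAbove_range_perf (H := H) π
  have hJ : 0 ≤ (⨆ θ, M.perf π H θ) - M.perf π H θ₁ := sub_nonneg.2 (le_ciSup hbdd θ₁)
  -- `Λ T = a + b log (T + 2)`
  set a := 1 / k * (16 * ((⨆ θ, M.perf π H θ) - M.perf π H θ₁)
    + m ^ ((1 : ℝ) / 3) / (4 * L ^ 2 * k) * σ ^ 2) with ha
  set b := 1 / k * ((W + 1) * c ^ 2 * k ^ 3 / (2 * L ^ 2)) with hb
  have ha0 : 0 ≤ a := by positivity
  have hb0 : 0 ≤ b := by positivity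
  have hΛab : ∀ T : ℕ, Λ T = a + b * Real.log ((T : ℝ) + 2) := fun T => by
    rw [hΛ, ha, hb]; ring
  have hlog : ∀ T : ℕ, 1 ≤ T → 1 ≤ Real.log ((T : ℝ) + 2) := fun T hT =>
    one_le_log_add_two (by exact_mod_cast hT)
  have hΛ0 : ∀ T : ℕ, 1 ≤ T → 0 ≤ Λ T := fun T hT => by
    rw [hΛab]
    have := mul_nonneg hb0 (zero_le_one.trans (hlog T hT))
    linarith
  have hΛle : ∀ T : ℕ, 1 ≤ T → Λ T ≤ (a + b) * Real.log ((T : ℝ) + 2) := fun T hT => by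
    rw [hΛab]
    nlinarith [hlog T hT]
  have hbound : ∀ T : ℕ, 0 < T →
      ∫ z, ‖gradient (M.perf π H) (M.iter π k m c θ₁ z.1 z.2)‖ ∂(M.outLaw π H k m c θ₁ T)
        ≤ (Real.sqrt (2 * Λ T) * m ^ ((1 : ℝ) / 6) + 2 * Λ T ^ ((3 : ℝ) / 4)) / Real.sqrt T
          + 2 * Real.sqrt (Λ T) * σ ^ ((1 : ℝ) / 3) / (T : ℝ) ^ ((1 : ℝ) / 3) := by
    intro T hT
    refine hadm.integral_norm_gradient_out_le_bound hσ.le hvar hT ?_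
    have e1 : k * Λ T = 16 * ((⨆ θ, M.perf π H θ) - M.perf π H θ₁)
        + m ^ ((1 : ℝ) / 3) / (4 * L ^ 2 * k) * σ ^ 2
        + (W + 1) * (c ^ 2 * k ^ 3 / (2 * L ^ 2) * Real.log ((T : ℝ) + 2)) := by
      rw [hΛ]; field_simp
    have e2 : σ ^ 2 / (4 * L ^ 2 * stepSize k m 0)
        = m ^ ((1 : ℝ) / 3) / (4 * L ^ 2 * k) * σ ^ 2 := by
      rw [stepSize, add_zero]
      field_simp
    have h1 : c ^ 2 * k ^ 3 / (2 * L ^ 2) * Real.log ((T : ℝ) + 1)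
        ≤ c ^ 2 * k ^ 3 / (2 * L ^ 2) * Real.log ((T : ℝ) + 2) :=
      mul_le_mul_of_nonneg_left (Real.log_le_log (by positivity) (by linarith)) (by positivity)
    have h2 : 0 ≤ c ^ 2 * k ^ 3 / (2 * L ^ 2) * Real.log ((T : ℝ) + 2) :=
      mul_nonneg (by positivity) (zero_le_one.trans (hlog T hT))
    rw [e1, e2]
    nlinarith [mul_nonneg hW.le h2]
  refine ⟨fun θ => (M.hasGradientAt_perf hadm.regular hMg.le θ).differentiableAt, hbdd,
    fun T hT => ⟨MDP.isProbabilityMeasure_outLaw hadm.regular hT,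
      hadm.integrable_norm_gradient_out hT, hbound T hT⟩, ?_, ?_⟩
  · refine IsBigO.of_bound (2 * (a + b)) ?_
    filter_upwards [eventually_ge_atTop 2] with T hT
    have hT' : (2 : ℝ) ≤ T := by exact_mod_cast hT
    have hlT : 0 ≤ Real.log T := Real.log_nonneg (by linarith)
    rw [Real.norm_of_nonneg (hΛ0 T (by omega)), Real.norm_of_nonneg hlT]
    refine (hΛle T (by omega)).trans ?_
    have h1 : Real.log ((T : ℝ) + 2) ≤ 2 * Real.log T := by
      rw [← Real.log_rpow (by linarith)]
      refine Real.log_le_log (by linarith) ?_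
      norm_num
      nlinarith
    nlinarith
  · set B := √(2 * (a + b)) * m ^ ((1 : ℝ) / 6) + 4 * (a + b) ^ ((3 : ℝ) / 4)
      + 2 * √(a + b) * σ ^ ((1 : ℝ) / 3)
    refine ⟨(13 * B ^ 2 + 2) ^ 3, by positivity, fun ε hε hε2 T hT => ?_⟩
    have hℓ : 0 < Real.log ε⁻¹ := Real.log_pos (by
      rw [one_lt_inv₀ hε]; linarith)
    have hT0 : 0 < (T : ℝ) := lt_of_lt_of_le (by positivity) hT
    have hT1 : 0 < T := by exact_mod_cast hT0
    have hT1' : (1 : ℝ) ≤ T := by exact_mod_cast hT1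
    exact (hbound T hT1).trans ((bound_le_sqrt_log_div (by positivity) (by positivity) hT1'
      (hΛ0 T hT1) (hΛle T hT1)).trans (sqrt_log_div_le hε hε2 hT1' hT))
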